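/- A closed curve on the unit sphere $S^2\subset\mathbb R^3$ is a continuous map $\gamma\colon S^1=\mathbb R/\mathbb Z\to S^2$. It is generic if it is injective except at finitely many self-intersection points (its vertices), each of which is a transverse double point: $\gamma$ passes through it exactly twice, is differentiable at both times, and the two derivatives are linearly independent. For a generic closed curve, traversed from the basepoint $\gamma(0)$, put $\operatorname{sgn}(x)=+1$ if the first traversal through the vertex $x$ crosses the second from right to left, and $\operatorname{sgn}(x)=-1$ otherwise. Two vertices $x,y$ are interleaved, written $x\between y$, if they alternate $x,y,x,y$ along $\gamma$. Define $$\operatorname{defect}(\gamma)=-2\sum_{x\between y}\operatorname{sgn}(x)\operatorname{sgn}(y),$$ where the sum is over all unordered interleaved pairs of vertices. Let $\Psi$ be a $C^1$ diffeomorphism of $S^2$, let $\sigma=\Psi^{-1}(\{z=0\})$ be the corresponding simple closed curve, let $D=\Psi^{-1}(\{z\ge 0\})$ be a disk bounded by it, and let $\varphi=\Psi^{-1}\circ R\circ\Psi$, where $R(x,y,z)=(-x,y,z)$, be the corresponding reflection of $D$. Let $\gamma$ be a generic closed curve on $S^2$ that meets $\sigma$ in exactly four points, none of which is a vertex of $\gamma$,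 and that passes from one side of $\sigma$ to the other at each of them; thus the part of $\gamma$ in $D$ is a tangle with two strands, whose endpoints are these four points. Suppose that $\varphi$ maps each of the four points to a different one of the four points. Flipping the tangle means replacing the image $\gamma(S^1)$ by $$(\gamma(S^1)\setminus D)\,\cup\,\varphi(\gamma(S^1)\cap D).$$ Lemma. The flipped set is again the image of a single generic closed curve, and every generic closed curve $\gamma'$ with this image satisfies $\operatorname{defect}(\gamma')=\operatorname{defect}(\gamma)$. -/

import Mathlib

open Set Filter Topology
open scoped Manifold ContDiff

noncomputable section

namespace TangleFlip

/-- Euclidean three-space. -/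
abbrev E3 : Type := EuclideanSpace ℝ (Fin 3)

instance factFinrankE3 : Fact (Module.finrank ℝ E3 = 2 + 1) := ⟨by simp⟩

/-- The sphere: the unit sphere of Euclidean three-space. -/
abbrev S2 : Type := Metric.sphere (0 : E3) 1

/-- The closed curve `γ : S¹ → S²`, with `S¹ = ℝ/ℤ`, read as a `1`-periodic path in `ℝ³`. -/
def path (γ : UnitAddCircle → S2) (t : ℝ) : E3 := (γ (t : UnitAddCircle) : E3)

/-- The vertices of a closed curve are its self-intersection points. -/
def vertices (γ : UnitAddCircle → S2) : Set S2 :=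
  {x | ∃ s t : UnitAddCircle, s ≠ t ∧ γ s = x ∧ γ t = x}

/-- A generic closed curve: continuous, and injective except at finitely many
self-intersections, each of which is a transverse double point. Differentiability is asked for
only where the curve crosses itself, so that corners elsewhere are allowed. -/
structure IsGeneric (γ : UnitAddCircle → S2) : Prop where
  continuous : Continuous γ
  finite_vertices : (vertices γ).Finite
  double : ∀ r s t : UnitAddCircle, γ r = γ s → γ s = γ t → r = s ∨ s = t ∨ r = t
  transverse : ∀ s t : ℝ, (s : UnitAddCircle) ≠ (t : UnitAddCircle) →
    γ (s : UnitAddCircle) = γ (t : UnitAddCircle) →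
    DifferentiableAt ℝ (path γ) s ∧ DifferentiableAt ℝ (path γ) t ∧
      LinearIndependent ℝ ![deriv (path γ) s, deriv (path γ) t]

/-- The vertices of `γ`, each recorded by the times `s < t` in `[0, 1)` of its first and its
second traversal, starting from the basepoint `γ 0`. -/
def crossings (γ : UnitAddCircle → S2) : Set (ℝ × ℝ) :=
  {p | 0 ≤ p.1 ∧ p.1 < p.2 ∧ p.2 < 1 ∧
    γ (p.1 : UnitAddCircle) = γ (p.2 : UnitAddCircle)}

/-- The determinant of three vectors of `ℝ³`. -/
def det3 (u v w : E3) : ℝ :=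
  Matrix.det !![u 0, u 1, u 2; v 0, v 1, v 2; w 0, w 1, w 2]

open Classical in
/-- The sign of a vertex: `+1` if the first traversal crosses the second from right to left,
that is, if the direction of the first points to the left of the direction of the second (seen
from outside the sphere, the outward normal at a point being the point itself); `-1` otherwise. -/
def sgn (γ : UnitAddCircle → S2) (p : ℝ × ℝ) : ℤ :=
  if 0 < det3 (path γ p.1) (deriv (path γ) p.2) (deriv (path γ) p.1) then 1 else -1

/-- The interleaved pairs of vertices: those traversed in the cyclic order `x, y, x, y`. Each
unordered pair occurs once, with the vertex that is met first in the first place. -/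
def interleaved (γ : UnitAddCircle → S2) : Set ((ℝ × ℝ) × (ℝ × ℝ)) :=
  {q | q.1 ∈ crossings γ ∧ q.2 ∈ crossings γ ∧
    q.1.1 < q.2.1 ∧ q.2.1 < q.1.2 ∧ q.1.2 < q.2.2}

/-- The defect, by Polyak's formula. For a generic curve the sum is finite. -/
def defect (γ : UnitAddCircle → S2) : ℤ :=
  -2 * ∑ᶠ q ∈ interleaved γ, sgn γ q.1 * sgn γ q.2

/-- The reflection `(x, y, z) ↦ (-x, y, z)` of the sphere. -/
def mirror (x : S2) : S2 :=
  ⟨!₂[-(x : E3) 0, (x : E3) 1, (x : E3) 2], by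
    have h : ‖(x : E3)‖ = 1 := norm_eq_of_mem_sphere x
    rw [EuclideanSpace.norm_eq, Fin.sum_univ_three] at h
    rw [mem_sphere_zero_iff_norm, EuclideanSpace.norm_eq, Fin.sum_univ_three]
    simpa using h⟩

/-- A `C¹` diffeomorphism `Ψ` of the sphere, used to describe a simple closed curve `σ` (the
preimage of the equator) together with one of the two disks that `σ` bounds (the preimage of the
closed upper hemisphere) and a reflection of this disk (the conjugate of `mirror`). Composing `Ψ`
with isometries of the sphere gives the other disk and the other reflection. -/
abbrev DiskChart : Type := S2 ≃ₘ^1⟮𝓡 2, 𝓡 2⟯ S2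

/-- The height above the equator, after normalization by `Ψ`. -/
def height (Ψ : DiskChart) (x : S2) : ℝ := (Ψ x : E3) 2

/-- The simple closed curve `σ`. -/
def boundaryCurve (Ψ : DiskChart) : Set S2 := {x | height Ψ x = 0}

/-- The closed disk bounded by `σ`. -/
def disk (Ψ : DiskChart) : Set S2 := {x | 0 ≤ height Ψ x}

/-- The reflection of the disk. -/
def reflect (Ψ : DiskChart) (x : S2) : S2 := Ψ.symm (mirror (Ψ x))

/-- At time `t` the curve passes from one side of `σ` to the other. -/
def CrossesAt (γ : UnitAddCircle → S2) (Ψ : DiskChart) (t : ℝ) : Prop :=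
  ((∀ᶠ s : ℝ in 𝓝[<] t, height Ψ (γ (s : UnitAddCircle)) < 0) ∧
    ∀ᶠ s : ℝ in 𝓝[>] t, 0 < height Ψ (γ (s : UnitAddCircle))) ∨
  ((∀ᶠ s : ℝ in 𝓝[<] t, 0 < height Ψ (γ (s : UnitAddCircle))) ∧
    ∀ᶠ s : ℝ in 𝓝[>] t, height Ψ (γ (s : UnitAddCircle)) < 0)

/-- The intersection of `γ` with the disk is a tangle with two strands that can be flipped by the
reflection of the disk: `σ` avoids the vertices of `γ`, every intersection of `γ` with `σ` is
a crossing, there are exactly four such points (the ends of the two strands), and the reflection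
maps each of them to a different one of them. -/
structure IsTwoStrandTangle (γ : UnitAddCircle → S2) (Ψ : DiskChart) : Prop where
  avoids_vertices : Disjoint (vertices γ) (boundaryCurve Ψ)
  crosses : ∀ t : ℝ, γ (t : UnitAddCircle) ∈ boundaryCurve Ψ → CrossesAt γ Ψ t
  four_points : (range γ ∩ boundaryCurve Ψ).ncard = 4
  reflect_endpoint : ∀ x ∈ range γ ∩ boundaryCurve Ψ,
    reflect Ψ x ∈ range γ ∩ boundaryCurve Ψ ∧ reflect Ψ x ≠ x

/-- Flipping: the part of the image of the curve in the disk is replaced by its reflection. -/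
def flip (Ψ : DiskChart) (X : Set S2) : Set S2 :=
  (X \ disk Ψ) ∪ reflect Ψ '' (X ∩ disk Ψ)

end TangleFlip

end

/-! Each vertex is recorded by its two times on the circle. This gives a chord diagram whose ends
carry signs, opposite at the two ends of a chord, and the defect is -2 times the signed number of
interleaved pairs of chords (`IsGeneric.defect_eq`).

The basepoint is moved so that the curve runs through the disk in two strands and outside it in two
strands. A vertex inside and a vertex outside interleave only if the first is a crossing of the two
strands inside and the second a crossing of the two strands outside. The mixed pairs therefore
contribute a product of two algebraic crossing numbers. Arcs in a disk whose ends do not separate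
each other on the boundary circle have crossing number zero, and the pairings of the four points by
the strands inside and by the strands outside cannot both be separating. So the product vanishes
(`IsNormalTangle.arcSum_mul_arcSum`, `IsNormalTangle.interSum_eq`).

Pairs outside are not affected by the flip. Inside, the reflection changes every sign and hence no
product of two signs. What changes is the order of the times inside. The reflection pairs the four
ends without fixed points, so there are three cases: both strands are reversed, the strands are
exchanged, or both happen. In each case the strands fit together again to a single closed curve. A
reversal of the whole order preserves interleaving; up to this, the only change is an exchange of
two blocks of times. The exchange is harmless (`interSum_swap`) as soon as the chords within one
block are crossed with total sign zero by the chords that leave the block. This holds because a loop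
cut off from one strand has crossing number zero with the other strand
(`IsGeneric.arcSum_loop_arc`).

The defect depends only on the image. Generic curves with the same image differ by a homeomorphism
of the circle that matches tangent branches (`IsGeneric.exists_reparam`). Reversal is harmless as
before. A change of the basepoint is again an exchange of two blocks, harmless because the two loops
at a vertex have crossing number zero (`IsGeneric.arcSum_loops`, `IsGeneric.defect_rotate`).

All crossing numbers come from the argument principle (`boundaryChange_eq_sum`). In a planar chart,
the crossings of two arcs are the zeros of p(u) - p(v) on a rectangle, and the index of a zero is
the sign of the crossing up to the orientation of the chart. The winding along the boundary vanishes
by comparison with a function without zeros, or because opposite edges cancel. This needs continuity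
everywhere and differentiability only at the crossings, so corners elsewhere do no harm. -/

noncomputable section

namespace TangleFlip

/-! ### Continuous logarithms and winding numbers on rectangles -/

/-- The change of a continuous logarithm of `f` along `[a, b]`. -/
def logChange (f : ℝ → ℂ) (a b : ℝ) : ℂ :=
  open Classical in
  if h : ∃ g : ℝ → ℂ, ContinuousOn g (Icc a b) ∧ ∀ t ∈ Icc a b, Complex.exp (g t) = f t
  then h.choose b - h.choose a else 0

/-- By uniqueness of lifts through the covering map `exp`, two continuous logarithms on an interval
differ by a constant. So every logarithm computes the change, and the one chosen in the definition
never matters. -/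
lemma logChange_eq {f g : ℝ → ℂ} {a b : ℝ} (hab : a ≤ b) (hg : ContinuousOn g (Icc a b))
    (h : ∀ t ∈ Icc a b, Complex.exp (g t) = f t) : logChange f a b = g b - g a := by
  have H : ∃ g : ℝ → ℂ, ContinuousOn g (Icc a b) ∧ ∀ t ∈ Icc a b, Complex.exp (g t) = f t :=
    ⟨g, hg, h⟩
  rw [logChange, dif_pos H]
  obtain ⟨h1, h2⟩ := H.choose_spec
  set g₁ := H.choose
  have ha : a ∈ Icc a b := ⟨le_rfl, hab⟩
  have key : EqOn g₁ (fun t => g t + (g₁ a - g a)) (Icc a b) := by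
    refine Complex.isCoveringMap_exp.eqOn_of_comp_eqOn isPreconnected_Icc h1
      (hg.add continuousOn_const) (fun t ht => ?_) ha (by ring)
    apply Subtype.ext
    simp only [Function.comp_apply]
    rw [Complex.exp_add, Complex.exp_sub, h2 t ht, h t ht, h2 a ha, h a ha, div_self, mul_one]
    rw [← h a ha]
    exact Complex.exp_ne_zero _
  rw [key ⟨hab, le_rfl⟩]
  ring

/-- A nowhere vanishing function on a rectangle has a continuous logarithm there. -/
lemma exists_log_rect {F : ℝ × ℝ → ℂ} {a b c d : ℝ} (hab : a ≤ b) (hcd : c ≤ d)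
    (hF : ContinuousOn F (Icc a b ×ˢ Icc c d)) (h0 : ∀ p ∈ Icc a b ×ˢ Icc c d, F p ≠ 0) :
    ∃ g : ℝ × ℝ → ℂ, Continuous g ∧ ∀ p ∈ Icc a b ×ˢ Icc c d, Complex.exp (g p) = F p := by
  -- The clamp onto the rectangle extends `F` without zeros to the whole plane, which is open and
  -- simply connected.
  let P : ℝ × ℝ → ℝ × ℝ := fun p => (projIcc a b hab p.1, projIcc c d hcd p.2)
  have hP : ∀ p, P p ∈ Icc a b ×ˢ Icc c d := fun p => ⟨(projIcc a b hab p.1).2,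
    (projIcc c d hcd p.2).2⟩
  have hPc : Continuous P := by
    refine Continuous.prodMk ?_ ?_
    · exact continuous_subtype_val.comp (continuous_projIcc.comp continuous_fst)
    · exact continuous_subtype_val.comp (continuous_projIcc.comp continuous_snd)
  have hG : Continuous (F ∘ P) := hF.comp_continuous hPc hP
  have hsc : IsSimplyConnected (univ : Set (ℝ × ℝ)) := by
    have := (convex_univ (𝕜 := ℝ) (E := ℝ × ℝ)).contractibleSpace univ_nonempty
    exact (inferInstance : SimplyConnectedSpace (univ : Set (ℝ × ℝ)))
  obtain ⟨g, hg, hg2⟩ := Complex.exists_continuousOn_eqOn_exp_comp hsc isOpen_univ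
    hG.continuousOn (by rintro ⟨p, -, hp⟩; exact h0 _ (hP p) hp)
  refine ⟨g, continuousOn_univ.1 hg, fun p hp => ?_⟩
  have := hg2 (mem_univ p)
  simp only [Function.comp_apply] at this
  rw [this]
  congr 1
  ext
  · exact congrArg Subtype.val (projIcc_of_mem hab hp.1)
  · exact congrArg Subtype.val (projIcc_of_mem hcd hp.2)

lemma exists_log_Icc {f : ℝ → ℂ} {a b : ℝ} (hab : a ≤ b) (hf : ContinuousOn f (Icc a b))
    (h0 : ∀ t ∈ Icc a b, f t ≠ 0) :
    ∃ g : ℝ → ℂ, Continuous g ∧ ∀ t ∈ Icc a b, Complex.exp (g t) = f t := by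
  obtain ⟨g, hg, hg2⟩ := exists_log_rect (F := fun p => f p.1) hab (le_refl (0 : ℝ))
    (hf.comp continuousOn_fst fun p hp => hp.1) (fun p hp => h0 _ hp.1)
  exact ⟨fun t => g (t, 0), by fun_prop, fun t ht => hg2 (t, 0) ⟨ht, by simp⟩⟩

lemma logChange_add {f : ℝ → ℂ} {a b c : ℝ} (hab : a ≤ b) (hbc : b ≤ c)
    (hf : ContinuousOn f (Icc a c)) (h0 : ∀ t ∈ Icc a c, f t ≠ 0) :
    logChange f a b + logChange f b c = logChange f a c := by
  obtain ⟨g, hg, hg2⟩ := exists_log_Icc (hab.trans hbc) hf h0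
  rw [logChange_eq hab hg.continuousOn fun t ht => hg2 t ⟨ht.1, ht.2.trans hbc⟩,
    logChange_eq hbc hg.continuousOn fun t ht => hg2 t ⟨hab.trans ht.1, ht.2⟩,
    logChange_eq (hab.trans hbc) hg.continuousOn hg2]
  ring

lemma logChange_congr {f g : ℝ → ℂ} {a b : ℝ} (h : EqOn f g (Icc a b)) :
    logChange f a b = logChange g a b := by
  -- The value depends on a choice, so the two predicates are shown to be equal. This needs neither
  -- continuity nor the absence of zeros.
  have : (fun k : ℝ → ℂ => ContinuousOn k (Icc a b) ∧ ∀ t ∈ Icc a b, Complex.exp (k t) = f t)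
      = fun k => ContinuousOn k (Icc a b) ∧ ∀ t ∈ Icc a b, Complex.exp (k t) = g t := by
    funext k
    refine propext (and_congr_right fun _ => forall₂_congr fun t ht => ?_)
    rw [h ht]
  exact congrArg (fun P : (ℝ → ℂ) → Prop =>
    open Classical in if h : ∃ k, P k then h.choose b - h.choose a else 0) this

lemma logChange_of_slitPlane {f : ℝ → ℂ} {a b : ℝ} (hab : a ≤ b) (hf : ContinuousOn f (Icc a b))
    (h : ∀ t ∈ Icc a b, f t ∈ Complex.slitPlane) :
    logChange f a b = Complex.log (f b) - Complex.log (f a) :=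
  logChange_eq (g := fun t => Complex.log (f t)) hab (hf.clog h)
    fun t ht => Complex.exp_log (Complex.slitPlane_ne_zero (h t ht))

lemma logChange_mul {f g : ℝ → ℂ} {a b : ℝ} (hab : a ≤ b) (hf : ContinuousOn f (Icc a b))
    (h0 : ∀ t ∈ Icc a b, f t ≠ 0) (hg : ContinuousOn g (Icc a b))
    (h1 : ∀ t ∈ Icc a b, g t ≠ 0) :
    logChange (fun t => f t * g t) a b = logChange f a b + logChange g a b := by
  obtain ⟨k, hk, hk2⟩ := exists_log_Icc hab hf h0
  obtain ⟨l, hl, hl2⟩ := exists_log_Icc hab hg h1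
  rw [logChange_eq hab hk.continuousOn hk2, logChange_eq hab hl.continuousOn hl2,
    logChange_eq (g := fun t => k t + l t) hab (hk.add hl).continuousOn fun t ht => by
      rw [Complex.exp_add, hk2 t ht, hl2 t ht]]
  ring

/-- If `f / g` avoids the closed negative half-line then the logarithms of `f` and `g` change by
amounts that differ by the change of the principal logarithm of `f / g`. -/
lemma logChange_of_div {f g : ℝ → ℂ} {a b : ℝ} (hab : a ≤ b) (hf : ContinuousOn f (Icc a b))
    (hg : ContinuousOn g (Icc a b)) (h0 : ∀ t ∈ Icc a b, g t ≠ 0)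
    (h : ∀ t ∈ Icc a b, f t / g t ∈ Complex.slitPlane) :
    logChange f a b = logChange g a b +
      (Complex.log (f b / g b) - Complex.log (f a / g a)) := by
  have hq : ContinuousOn (fun t => f t / g t) (Icc a b) := hf.div hg h0
  rw [← logChange_of_slitPlane hab hq h, ← logChange_mul hab hg h0 hq
    fun t ht => Complex.slitPlane_ne_zero (h t ht)]
  refine logChange_congr fun t ht => ?_
  rw [mul_div_cancel₀ _ (h0 t ht)]

/-- The change of the logarithm of `F` along the boundary of a rectangle, counterclockwise. -/
def boundaryChange (F : ℝ × ℝ → ℂ) (a b c d : ℝ) : ℂ :=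
  logChange (fun u => F (u, c)) a b + logChange (fun v => F (b, v)) c d
    - logChange (fun u => F (u, d)) a b - logChange (fun v => F (a, v)) c d

lemma boundaryChange_eq_zero {F : ℝ × ℝ → ℂ} {a b c d : ℝ} (hab : a ≤ b) (hcd : c ≤ d)
    (hF : ContinuousOn F (Icc a b ×ˢ Icc c d)) (h0 : ∀ p ∈ Icc a b ×ˢ Icc c d, F p ≠ 0) :
    boundaryChange F a b c d = 0 := by
  obtain ⟨g, hg, hg2⟩ := exists_log_rect hab hcd hF h0
  have ha : a ∈ Icc a b := ⟨le_rfl, hab⟩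
  have hb : b ∈ Icc a b := ⟨hab, le_rfl⟩
  have hc : c ∈ Icc c d := ⟨le_rfl, hcd⟩
  have hd : d ∈ Icc c d := ⟨hcd, le_rfl⟩
  unfold boundaryChange
  rw [logChange_eq (g := fun u => g (u, c)) hab (by fun_prop) fun t ht => hg2 _ ⟨ht, hc⟩,
    logChange_eq (g := fun u => g (b, u)) hcd (by fun_prop) fun t ht => hg2 _ ⟨hb, ht⟩,
    logChange_eq (g := fun u => g (u, d)) hab (by fun_prop) fun t ht => hg2 _ ⟨ht, hd⟩,
    logChange_eq (g := fun u => g (a, u)) hcd (by fun_prop) fun t ht => hg2 _ ⟨ha, ht⟩]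
  ring

/-- The boundary of a rectangle. -/
def rectBoundary (a b c d : ℝ) : Set (ℝ × ℝ) :=
  {p | p ∈ Icc a b ×ˢ Icc c d ∧ (p.1 = a ∨ p.1 = b ∨ p.2 = c ∨ p.2 = d)}

lemma boundaryChange_of_div {F G : ℝ × ℝ → ℂ} {a b c d : ℝ} (hab : a ≤ b) (hcd : c ≤ d)
    (hF : ContinuousOn F (rectBoundary a b c d)) (hG : ContinuousOn G (rectBoundary a b c d))
    (h0 : ∀ p ∈ rectBoundary a b c d, G p ≠ 0)
    (h : ∀ p ∈ rectBoundary a b c d, F p / G p ∈ Complex.slitPlane) :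
    boundaryChange F a b c d = boundaryChange G a b c d := by
  have ha : a ∈ Icc a b := ⟨le_rfl, hab⟩
  have hb : b ∈ Icc a b := ⟨hab, le_rfl⟩
  have hc : c ∈ Icc c d := ⟨le_rfl, hcd⟩
  have hd : d ∈ Icc c d := ⟨hcd, le_rfl⟩
  have m1 : MapsTo (fun u : ℝ => (u, c)) (Icc a b) (rectBoundary a b c d) :=
    fun t ht => ⟨⟨ht, hc⟩, by simp⟩
  have m2 : MapsTo (fun u : ℝ => (b, u)) (Icc c d) (rectBoundary a b c d) :=
    fun t ht => ⟨⟨hb, ht⟩, by simp⟩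
  have m3 : MapsTo (fun u : ℝ => (u, d)) (Icc a b) (rectBoundary a b c d) :=
    fun t ht => ⟨⟨ht, hd⟩, by simp⟩
  have m4 : MapsTo (fun u : ℝ => (a, u)) (Icc c d) (rectBoundary a b c d) :=
    fun t ht => ⟨⟨ha, ht⟩, by simp⟩
  unfold boundaryChange
  rw [logChange_of_div (f := fun u => F (u, c)) (g := fun u => G (u, c)) hab (hF.comp (by fun_prop) m1)
      (hG.comp (by fun_prop) m1) (fun t ht => h0 _ (m1 ht)) (fun t ht => h _ (m1 ht)),
    logChange_of_div (f := fun u => F (b, u)) (g := fun u => G (b, u)) hcd (hF.comp (by fun_prop) m2)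
      (hG.comp (by fun_prop) m2) (fun t ht => h0 _ (m2 ht)) (fun t ht => h _ (m2 ht)),
    logChange_of_div (f := fun u => F (u, d)) (g := fun u => G (u, d)) hab (hF.comp (by fun_prop) m3)
      (hG.comp (by fun_prop) m3) (fun t ht => h0 _ (m3 ht)) (fun t ht => h _ (m3 ht)),
    logChange_of_div (f := fun u => F (a, u)) (g := fun u => G (a, u)) hcd (hF.comp (by fun_prop) m4)
      (hG.comp (by fun_prop) m4) (fun t ht => h0 _ (m4 ht)) (fun t ht => h _ (m4 ht))]
  ring

lemma boundaryChange_cut_fst {F : ℝ × ℝ → ℂ} {a m b c d : ℝ} (ham : a ≤ m) (hmb : m ≤ b)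
    (hcd : c ≤ d) (hF : ContinuousOn F (rectBoundary a b c d))
    (h0 : ∀ p ∈ rectBoundary a b c d, F p ≠ 0) :
    boundaryChange F a b c d = boundaryChange F a m c d + boundaryChange F m b c d := by
  have m1 : MapsTo (fun u : ℝ => (u, c)) (Icc a b) (rectBoundary a b c d) :=
    fun t ht => ⟨⟨ht, ⟨le_rfl, hcd⟩⟩, by simp⟩
  have m3 : MapsTo (fun u : ℝ => (u, d)) (Icc a b) (rectBoundary a b c d) :=
    fun t ht => ⟨⟨ht, ⟨hcd, le_rfl⟩⟩, by simp⟩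
  unfold boundaryChange
  rw [← logChange_add (f := fun u => F (u, c)) ham hmb (hF.comp (by fun_prop) m1) (fun t ht => h0 _ (m1 ht)),
    ← logChange_add (f := fun u => F (u, d)) ham hmb (hF.comp (by fun_prop) m3) (fun t ht => h0 _ (m3 ht))]
  ring

lemma boundaryChange_cut_snd {F : ℝ × ℝ → ℂ} {a b c m d : ℝ} (hab : a ≤ b) (hcm : c ≤ m)
    (hmd : m ≤ d) (hF : ContinuousOn F (rectBoundary a b c d))
    (h0 : ∀ p ∈ rectBoundary a b c d, F p ≠ 0) :
    boundaryChange F a b c d = boundaryChange F a b c m + boundaryChange F a b m d := by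
  have m1 : MapsTo (fun u : ℝ => (a, u)) (Icc c d) (rectBoundary a b c d) :=
    fun t ht => ⟨⟨⟨le_rfl, hab⟩, ht⟩, by simp⟩
  have m3 : MapsTo (fun u : ℝ => (b, u)) (Icc c d) (rectBoundary a b c d) :=
    fun t ht => ⟨⟨⟨hab, le_rfl⟩, ht⟩, by simp⟩
  unfold boundaryChange
  rw [← logChange_add (f := fun u => F (a, u)) hcm hmd (hF.comp (by fun_prop) m1) (fun t ht => h0 _ (m1 ht)),
    ← logChange_add (f := fun u => F (b, u)) hcm hmd (hF.comp (by fun_prop) m3) (fun t ht => h0 _ (m3 ht))]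
  ring

/-- Seen from the centre of a square, an edge spans a quarter turn: the factor after `w` moves on a
vertical line in the right half-plane between the arguments -π/4 and π/4, upwards or downwards
according to `e`. -/
lemma logChange_edge {w : ℂ} (hw : w ≠ 0) {r e : ℝ} (hr : 0 < r) (he : e = 1 ∨ e = -1) (t₀ : ℝ) :
    logChange (fun t => w * (r + e * (t - t₀ : ℝ) * Complex.I)) (t₀ - r) (t₀ + r)
      = e * (Real.pi / 2) * Complex.I := by
  have hs : ∀ t : ℝ, (r + e * (t - t₀ : ℝ) * Complex.I : ℂ) ∈ Complex.slitPlane := by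
    intro t
    left
    simpa using hr
  have hlog : ∀ f : ℝ, f = 1 ∨ f = -1 → Complex.log (r + f * r * Complex.I)
      = Real.log (r * √2) + f * (Real.pi / 4) * Complex.I := by
    intro f hf
    have h2 : (√2 : ℂ) * √2 = 2 := by
      rw [← Complex.ofReal_mul, Real.mul_self_sqrt (by norm_num)]; norm_num
    have e1 : (r + f * r * Complex.I : ℂ) = ((r * √2 : ℝ) : ℂ) *
        (Complex.cos (f * (Real.pi / 4) : ℝ) + Complex.sin (f * (Real.pi / 4) : ℝ) * Complex.I) := by
      have c1 : Real.cos (f * (Real.pi / 4)) = √2 / 2 := by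
        rcases hf with rfl | rfl
        · simp
        · rw [neg_one_mul, Real.cos_neg]; simp
      have s1 : Real.sin (f * (Real.pi / 4)) = f * (√2 / 2) := by
        rcases hf with rfl | rfl
        · simp
        · rw [neg_one_mul, Real.sin_neg]; simp
      rw [← Complex.ofReal_cos, ← Complex.ofReal_sin, c1, s1]
      push_cast
      linear_combination (-(r : ℂ) / 2 - f * r * Complex.I / 2) * h2
    have hpos : 0 < r * √2 := by positivity
    have hmem : f * (Real.pi / 4) ∈ Ioc (-Real.pi) Real.pi := by
      have := Real.pi_pos
      rcases hf with rfl | rfl <;> constructor <;> linarith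
    have harg := Complex.arg_mul_cos_add_sin_mul_I hpos hmem
    have hnorm : ‖(((r * √2 : ℝ) : ℂ) *
        (Complex.cos (f * (Real.pi / 4) : ℝ) + Complex.sin (f * (Real.pi / 4) : ℝ) * Complex.I))‖
        = r * √2 := by
      rw [norm_mul, Complex.norm_cos_add_sin_mul_I, mul_one, Complex.norm_real, Real.norm_eq_abs,
        abs_of_pos hpos]
    rw [e1, Complex.log, hnorm, harg]
    push_cast
    ring
  rw [logChange_eq (g := fun t => Complex.log w + Complex.log (r + e * (t - t₀ : ℝ) * Complex.I))
    (by linarith)]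
  · have h1 := hlog e he
    have h2 := hlog (-e) (by rcases he with rfl | rfl <;> simp)
    have e1 : (r + e * ((t₀ + r - t₀ : ℝ) : ℂ) * Complex.I : ℂ) = r + e * r * Complex.I := by
      push_cast; ring
    have e2 : (r + e * ((t₀ - r - t₀ : ℝ) : ℂ) * Complex.I : ℂ)
        = r + (-e : ℝ) * r * Complex.I := by
      push_cast; ring
    rw [e1, e2, h1, h2]
    push_cast
    ring
  · refine continuousOn_const.add (ContinuousOn.clog (by fun_prop) fun t _ => hs t)
  · intro t _
    rw [Complex.exp_add, Complex.exp_log hw, Complex.exp_log (Complex.slitPlane_ne_zero (hs t))]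

/-- The model maps `z ↦ w z` and `z ↦ w z̄` have index `1` and `-1`. -/
lemma boundaryChange_model {w : ℂ} (hw : w ≠ 0) {r e : ℝ} (hr : 0 < r) (he : e = 1 ∨ e = -1)
    (u v : ℝ) :
    boundaryChange (fun p => w * ((p.1 - u : ℝ) + e * (p.2 - v : ℝ) * Complex.I))
      (u - r) (u + r) (v - r) (v + r) = 2 * Real.pi * Complex.I * e := by
  have hee : (e : ℂ) * e = 1 := by
    rcases he with rfl | rfl <;> simp
  have he0 : (e : ℂ) ≠ 0 := by rcases he with rfl | rfl <;> simp
  have he' : -e = 1 ∨ -e = -1 := by rcases he with rfl | rfl <;> simp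
  have hI := Complex.I_mul_I
  unfold boundaryChange
  -- Up to a constant factor every edge is the one of `logChange_edge`. The top and left edges occur
  -- with sign `-e`, but they are also traversed backwards, so all four quarter turns add up.
  have b1 := logChange_edge (w := w * (-e * Complex.I))
    (mul_ne_zero hw (mul_ne_zero (neg_ne_zero.2 he0) Complex.I_ne_zero)) hr he u
  have b2 := logChange_edge hw hr he v
  have b3 := logChange_edge (w := w * (e * Complex.I))
    (mul_ne_zero hw (mul_ne_zero he0 Complex.I_ne_zero)) hr he' u
  have b4 := logChange_edge (w := -w) (neg_ne_zero.2 hw) hr he' v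
  have e1 : ∀ t : ℝ, w * (((t - u : ℝ) : ℂ) + e * ((v - r - v : ℝ) : ℂ) * Complex.I)
      = w * (-e * Complex.I) * (r + e * (t - u : ℝ) * Complex.I) := by
    intro t
    push_cast
    linear_combination (w * ((t : ℂ) - u)) * hee * (-1) + (-w * (e : ℂ) * e * ((t : ℂ) - u)) * hI * (-1)
  have e2 : ∀ t : ℝ, w * (((u + r - u : ℝ) : ℂ) + e * ((t - v : ℝ) : ℂ) * Complex.I)
      = w * (r + e * (t - v : ℝ) * Complex.I) := by
    intro t
    push_cast
    ring
  have e3 : ∀ t : ℝ, w * (((t - u : ℝ) : ℂ) + e * ((v + r - v : ℝ) : ℂ) * Complex.I)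
      = w * (e * Complex.I) * (r + (-e : ℝ) * (t - u : ℝ) * Complex.I) := by
    intro t
    push_cast
    linear_combination (w * ((t : ℂ) - u)) * hee * (-1) + (-w * (e : ℂ) * e * ((t : ℂ) - u)) * hI * (-1)
  have e4 : ∀ t : ℝ, w * (((u - r - u : ℝ) : ℂ) + e * ((t - v : ℝ) : ℂ) * Complex.I)
      = -w * (r + (-e : ℝ) * (t - v : ℝ) * Complex.I) := by
    intro t
    push_cast
    ring
  simp only [e1, e2, e3, e4]
  rw [b1, b2, b3, b4]
  push_cast
  ring

/-- `F` has index `n` at `p`: along small squares centered at `p` its logarithm changes by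
`2πin`. -/
def HasIndex (F : ℝ × ℝ → ℂ) (p : ℝ × ℝ) (n : ℤ) : Prop :=
  ∀ᶠ r : ℝ in 𝓝[>] 0,
    boundaryChange F (p.1 - r) (p.1 + r) (p.2 - r) (p.2 + r) = 2 * Real.pi * Complex.I * n

lemma norm_le_of_mem_square {p q : ℝ × ℝ} {r : ℝ}
    (hq : q ∈ rectBoundary (p.1 - r) (p.1 + r) (p.2 - r) (p.2 + r)) : ‖q - p‖ ≤ r := by
  obtain ⟨⟨⟨h1, h2⟩, h3, h4⟩, -⟩ := hq
  rw [Prod.norm_def, max_le_iff]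
  constructor
  · rw [Real.norm_eq_abs, Prod.fst_sub, abs_le]; constructor <;> linarith
  · rw [Real.norm_eq_abs, Prod.snd_sub, abs_le]; constructor <;> linarith

lemma ne_of_mem_square {p q : ℝ × ℝ} {r : ℝ} (hr : 0 < r)
    (hq : q ∈ rectBoundary (p.1 - r) (p.1 + r) (p.2 - r) (p.2 + r)) : q ≠ p := by
  rintro rfl
  obtain ⟨-, h | h | h | h⟩ := hq <;> linarith

lemma mem_slitPlane_of_norm_sub_lt {z : ℂ} (h : ‖z - 1‖ < 1) : z ∈ Complex.slitPlane := by
  left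
  have := (Complex.abs_re_le_norm (z - 1)).trans_lt h
  rw [Complex.sub_re, Complex.one_re, abs_lt] at this
  linarith [this.1]

/-- The index of a nondegenerate zero is the sign of its Jacobian. -/
lemma hasIndex_of_hasFDerivAt {F : ℝ × ℝ → ℂ} {p : ℝ × ℝ} {L : ℝ × ℝ →L[ℝ] ℂ}
    (hc : ∀ᶠ q in 𝓝 p, ContinuousAt F q) (h0 : F p = 0) (hL : HasFDerivAt F L p)
    (hD : ((starRingEnd ℂ) (L (1, 0)) * L (0, 1)).im ≠ 0) :
    HasIndex F p (SignType.sign ((starRingEnd ℂ) (L (1, 0)) * L (0, 1)).im) := by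
  set A := L (1, 0) with hA
  set B := L (0, 1) with hB
  set D := ((starRingEnd ℂ) A * B).im with hDdef
  have hLe : ∀ q : ℝ × ℝ, L q = q.1 * A + q.2 * B := by
    intro q
    have : q = q.1 • ((1, 0) : ℝ × ℝ) + q.2 • ((0, 1) : ℝ × ℝ) := by ext <;> simp
    conv_lhs => rw [this]
    rw [map_add, map_smul, map_smul, Complex.real_smul, Complex.real_smul]
  -- With ζ = x + e y i, the differential is w ζ plus w' times the conjugate of ζ, and the
  -- difference of the squared norms of the two coefficients is the Jacobian up to sign. The choice
  -- of `e` makes `w` the larger coefficient, so that w ζ determines the winding.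
  obtain ⟨w, w', e, hww, he, hsgn, hdec⟩ : ∃ w w' : ℂ, ∃ e : ℝ, ‖w'‖ < ‖w‖ ∧ (e = 1 ∨ e = -1) ∧
      (((SignType.sign D : ℤ) : ℝ) = e) ∧
      ∀ x y : ℝ, (x * A + y * B : ℂ) = w * (x + e * y * Complex.I) + w' * (x - e * y * Complex.I) := by
    have key : ‖(A - Complex.I * B) / 2‖ ^ 2 - ‖(A + Complex.I * B) / 2‖ ^ 2 = D := by
      rw [← Complex.normSq_eq_norm_sq, ← Complex.normSq_eq_norm_sq, Complex.normSq_apply,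
        Complex.normSq_apply, hDdef]
      simp
      ring
    rcases lt_or_gt_of_ne hD with h | h
    · refine ⟨(A + Complex.I * B) / 2, (A - Complex.I * B) / 2, -1, ?_, Or.inr rfl, ?_, ?_⟩
      · refine lt_of_pow_lt_pow_left₀ 2 (norm_nonneg _) (by linarith)
      · rw [sign_neg h]; simp
      · intro x y
        push_cast
        linear_combination ((y : ℂ) * B) * Complex.I_mul_I
    · refine ⟨(A - Complex.I * B) / 2, (A + Complex.I * B) / 2, 1, ?_, Or.inl rfl, ?_, ?_⟩
      · refine lt_of_pow_lt_pow_left₀ 2 (norm_nonneg _) (by linarith)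
      · rw [sign_pos h]; simp
      · intro x y
        push_cast
        linear_combination ((y : ℂ) * B) * Complex.I_mul_I
  have hw : w ≠ 0 := norm_pos_iff.1 ((norm_nonneg _).trans_lt hww)
  -- Half of the gap between the coefficients bounds the remainder; the other half keeps the
  -- distance from `F` to its leading term strictly below the norm of this term.
  have hlit := hL.isLittleO.def (c := (‖w‖ - ‖w'‖) / 2) (by linarith)
  obtain ⟨ρ, hρ, hball⟩ := Metric.eventually_nhds_iff.1 (hc.and hlit)
  have hmem : Ioo (0 : ℝ) ρ ∈ 𝓝[>] (0 : ℝ) := Ioo_mem_nhdsGT hρ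
  filter_upwards [hmem] with r hr
  have hin : ∀ q ∈ rectBoundary (p.1 - r) (p.1 + r) (p.2 - r) (p.2 + r), dist q p < ρ := by
    intro q hq
    rw [dist_eq_norm]
    exact (norm_le_of_mem_square hq).trans_lt hr.2
  have hnorm : ∀ q : ℝ × ℝ, ∀ f : ℝ, f = e ∨ f = -e →
      ‖(((q.1 - p.1 : ℝ) : ℂ) + f * ((q.2 - p.2 : ℝ) : ℂ) * Complex.I)‖ ^ 2
        = (q.1 - p.1) ^ 2 + (q.2 - p.2) ^ 2 := by
    intro q f hf
    have : f * f = 1 := by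
      rcases he with rfl | rfl <;> rcases hf with rfl | rfl <;> norm_num
    rw [← Complex.normSq_eq_norm_sq, Complex.normSq_apply]
    simp
    linear_combination (q.2 - p.2) ^ 2 * this
  have hnormeq : ∀ q : ℝ × ℝ,
      ‖(((q.1 - p.1 : ℝ) : ℂ) - e * ((q.2 - p.2 : ℝ) : ℂ) * Complex.I)‖
        = ‖(((q.1 - p.1 : ℝ) : ℂ) + e * ((q.2 - p.2 : ℝ) : ℂ) * Complex.I)‖ := by
    intro q
    have h1 := hnorm q e (Or.inl rfl)
    have h2 := hnorm q (-e) (Or.inr rfl)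
    rw [← h1] at h2
    have := (pow_left_inj₀ (norm_nonneg _) (norm_nonneg _) two_ne_zero).1 h2
    rw [← this]
    congr 1
    push_cast
    ring
  have hle : ∀ q : ℝ × ℝ, ‖q - p‖ ≤
      ‖(((q.1 - p.1 : ℝ) : ℂ) + e * ((q.2 - p.2 : ℝ) : ℂ) * Complex.I)‖ := by
    intro q
    have h1 := hnorm q e (Or.inl rfl)
    rw [Prod.norm_def, max_le_iff]
    constructor <;> refine abs_le_of_sq_le_sq ?_ (norm_nonneg _)
    · rw [h1, Prod.fst_sub]; nlinarith [sq_nonneg (q.2 - p.2)]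
    · rw [h1, Prod.snd_sub]; nlinarith [sq_nonneg (q.1 - p.1)]
  have hz0 : ∀ q ∈ rectBoundary (p.1 - r) (p.1 + r) (p.2 - r) (p.2 + r),
      (((q.1 - p.1 : ℝ) : ℂ) + e * ((q.2 - p.2 : ℝ) : ℂ) * Complex.I) ≠ 0 := by
    intro q hq
    have := (norm_pos_iff.2 (sub_ne_zero.2 (ne_of_mem_square hr.1 hq))).trans_le (hle q)
    exact norm_pos_iff.1 this
  rw [boundaryChange_of_div (G := fun q => w * ((q.1 - p.1 : ℝ) + e * (q.2 - p.2 : ℝ) * Complex.I))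
    (by linarith [hr.1]) (by linarith [hr.1])
    (fun q hq => (hball (hin q hq)).1.continuousWithinAt) (by fun_prop)
    (fun q hq => mul_ne_zero hw (hz0 q hq)), boundaryChange_model hw hr.1 he]
  · rw [← hsgn, Complex.ofReal_intCast]
  · intro q hq
    apply mem_slitPlane_of_norm_sub_lt
    have hzq := hz0 q hq
    have hzpos := norm_pos_iff.2 hzq
    have hwpos := norm_pos_iff.2 hw
    rw [div_sub_one (mul_ne_zero hw hzq), norm_div, div_lt_one (norm_pos_iff.2 (mul_ne_zero hw hzq)), norm_mul]
    have h1 := (hball (hin q hq)).2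
    rw [h0, sub_zero, hLe] at h1
    have h2 := hdec (q.1 - p.1) (q.2 - p.2)
    rw [Prod.fst_sub, Prod.snd_sub, h2] at h1
    have h3 : F q - w * (((q.1 - p.1 : ℝ) : ℂ) + e * ((q.2 - p.2 : ℝ) : ℂ) * Complex.I)
        = (F q - (w * (((q.1 - p.1 : ℝ) : ℂ) + e * ((q.2 - p.2 : ℝ) : ℂ) * Complex.I)
          + w' * (((q.1 - p.1 : ℝ) : ℂ) - e * ((q.2 - p.2 : ℝ) : ℂ) * Complex.I)))
          + w' * (((q.1 - p.1 : ℝ) : ℂ) - e * ((q.2 - p.2 : ℝ) : ℂ) * Complex.I) := by ring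
    rw [h3]
    refine (norm_add_le _ _).trans_lt ?_
    rw [norm_mul w', hnormeq]
    have h4 := mul_le_mul_of_nonneg_left (hle q) (show 0 ≤ (‖w‖ - ‖w'‖) / 2 by linarith)
    nlinarith

/-- A rectangle with a single zero of index `n`. -/
lemma boundaryChange_of_single_zero {F : ℝ × ℝ → ℂ} {a b c d : ℝ}
    (hF : ContinuousOn F (Icc a b ×ˢ Icc c d)) {p : ℝ × ℝ} (hp : p ∈ Ioo a b ×ˢ Ioo c d)
    (h0 : ∀ q ∈ Icc a b ×ˢ Icc c d, F q = 0 → q = p) {n : ℤ} (hn : HasIndex F p n) :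
    boundaryChange F a b c d = 2 * Real.pi * Complex.I * n := by
  obtain ⟨⟨hp1, hp2⟩, hp3, hp4⟩ := hp
  have ev : ∀ x : ℝ, 0 < x → ∀ᶠ r : ℝ in 𝓝[>] 0, r < x := fun x hx =>
    Filter.mem_of_superset (Ioo_mem_nhdsGT hx) fun r hr => hr.2
  obtain ⟨r, hr, hra, hrb, hrc, hrd, hr0⟩ := (hn.and ((ev _ (sub_pos.2 hp1)).and
    ((ev _ (sub_pos.2 hp2)).and ((ev _ (sub_pos.2 hp3)).and ((ev _ (sub_pos.2 hp4)).and
    self_mem_nhdsWithin))))).exists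
  replace hr0 : 0 < r := hr0
  rw [← hr]
  have sub : ∀ {a' b' c' d' : ℝ}, a ≤ a' → b' ≤ b → c ≤ c' → d' ≤ d →
      Icc a' b' ×ˢ Icc c' d' ⊆ Icc a b ×ˢ Icc c d := fun h1 h2 h3 h4 =>
    prod_mono (Icc_subset_Icc h1 h2) (Icc_subset_Icc h3 h4)
  have bc : ∀ {a' b' c' d' : ℝ}, a ≤ a' → b' ≤ b → c ≤ c' → d' ≤ d →
      ContinuousOn F (rectBoundary a' b' c' d') := fun h1 h2 h3 h4 =>
    hF.mono fun q hq => sub h1 h2 h3 h4 hq.1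
  have b0 : ∀ {a' b' c' d' : ℝ}, a ≤ a' → b' ≤ b → c ≤ c' → d' ≤ d → a' ≠ p.1 → b' ≠ p.1 →
      c' ≠ p.2 → d' ≠ p.2 → ∀ q ∈ rectBoundary a' b' c' d', F q ≠ 0 := by
    intro a' b' c' d' h1 h2 h3 h4 h5 h6 h7 h8 q hq hq0
    have := h0 q (sub h1 h2 h3 h4 hq.1) hq0
    subst this
    obtain ⟨-, h | h | h | h⟩ := hq
    · exact h5 h.symm
    · exact h6 h.symm
    · exact h7 h.symm
    · exact h8 h.symm
  have z : ∀ {a' b' c' d' : ℝ}, a ≤ a' → b' ≤ b → c ≤ c' → d' ≤ d → a' ≤ b' → c' ≤ d' →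
      p ∉ Icc a' b' ×ˢ Icc c' d' → boundaryChange F a' b' c' d' = 0 := by
    intro a' b' c' d' h1 h2 h3 h4 h5 h6 h7
    refine boundaryChange_eq_zero h5 h6 (hF.mono (sub h1 h2 h3 h4)) fun q hq hq0 => h7 ?_
    rwa [← h0 q (sub h1 h2 h3 h4 hq) hq0]
  -- Four cuts remove the strips to the left, to the right, below and above the small square; none
  -- of them contains the zero.
  rw [boundaryChange_cut_fst (m := p.1 - r) (by linarith) (by linarith) (by linarith)
      (bc le_rfl le_rfl le_rfl le_rfl)
      (b0 le_rfl le_rfl le_rfl le_rfl hp1.ne hp2.ne' hp3.ne hp4.ne'),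
    z le_rfl (by linarith) le_rfl le_rfl (by linarith) (by linarith)
      (fun h => by linarith [h.1.2]), zero_add,
    boundaryChange_cut_fst (a := p.1 - r) (m := p.1 + r) (by linarith) (by linarith) (by linarith)
      (bc (by linarith) le_rfl le_rfl le_rfl)
      (b0 (by linarith) le_rfl le_rfl le_rfl (by linarith) hp2.ne' hp3.ne hp4.ne'),
    z (a' := p.1 + r) (by linarith) le_rfl le_rfl le_rfl (by linarith) (by linarith)
      (fun h => by linarith [h.1.1]), add_zero,
    boundaryChange_cut_snd (m := p.2 - r) (by linarith) (by linarith) (by linarith)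
      (bc (by linarith) (by linarith) le_rfl le_rfl)
      (b0 (by linarith) (by linarith) le_rfl le_rfl (by linarith) (by linarith) hp3.ne hp4.ne'),
    z (d' := p.2 - r) (by linarith) (by linarith) le_rfl (by linarith) (by linarith) (by linarith)
      (fun h => by linarith [h.2.2]), zero_add,
    boundaryChange_cut_snd (c := p.2 - r) (m := p.2 + r) (by linarith) (by linarith) (by linarith)
      (bc (by linarith) (by linarith) (by linarith) le_rfl)
      (b0 (by linarith) (by linarith) (by linarith) le_rfl (by linarith) (by linarith)
        (by linarith) hp4.ne'),
    z (c' := p.2 + r) (by linarith) (by linarith) (by linarith) le_rfl (by linarith) (by linarith)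
      (fun h => by linarith [h.2.1]), add_zero]

lemma exists_between_notMem {x y : ℝ} (h : x < y) (s : Finset ℝ) : ∃ m, x < m ∧ m < y ∧ m ∉ s := by
  obtain ⟨m, hm, hms⟩ := (Ioo_infinite h).exists_notMem_finset s
  exact ⟨m, hm.1, hm.2, hms⟩

/-- The argument principle on a rectangle. -/
theorem boundaryChange_eq_sum {F : ℝ × ℝ → ℂ} {a b c d : ℝ} (hab : a ≤ b) (hcd : c ≤ d)
    (hF : ContinuousOn F (Icc a b ×ˢ Icc c d)) (Z : Finset (ℝ × ℝ))
    (hZ : ∀ p ∈ Icc a b ×ˢ Icc c d, F p = 0 → p ∈ Z) (hin : ∀ p ∈ Z, p ∈ Ioo a b ×ˢ Ioo c d)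
    (h0 : ∀ p ∈ Z, F p = 0) (n : ℝ × ℝ → ℤ) (hn : ∀ p ∈ Z, HasIndex F p (n p)) :
    boundaryChange F a b c d = 2 * Real.pi * Complex.I * ((∑ p ∈ Z, n p : ℤ) : ℂ) := by
  induction hk : Z.card using Nat.strong_induction_on generalizing Z a b c d with
  | _ k ih =>
  subst hk
  have hb0 : ∀ q ∈ rectBoundary a b c d, F q ≠ 0 := by
    intro q hq hq0
    obtain ⟨⟨h1, h2⟩, h3, h4⟩ := hin q (hZ q hq.1 hq0)
    obtain ⟨-, h | h | h | h⟩ := hq <;> linarith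
  have hbc : ContinuousOn F (rectBoundary a b c d) := hF.mono fun q hq => hq.1
  rcases Nat.lt_or_ge 1 Z.card with hcard | hcard
  · obtain ⟨p, hp, q, hq, hpq⟩ := Finset.one_lt_card.1 hcard
    -- Two distinct zeros differ in one coordinate. A cut between them, at a value that avoids this
    -- coordinate of every zero, leaves fewer zeros on either side.
    have hcase : (∃ p ∈ Z, ∃ q ∈ Z, p.1 < q.1) ∨ (∃ p ∈ Z, ∃ q ∈ Z, p.2 < q.2) := by
      rcases lt_trichotomy p.1 q.1 with h | h | h
      · exact Or.inl ⟨p, hp, q, hq, h⟩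
      · rcases lt_trichotomy p.2 q.2 with h' | h' | h'
        · exact Or.inr ⟨p, hp, q, hq, h'⟩
        · exact absurd (Prod.ext h h') hpq
        · exact Or.inr ⟨q, hq, p, hp, h'⟩
      · exact Or.inl ⟨q, hq, p, hp, h⟩
    clear hpq hp hq p q
    rcases hcase with ⟨p, hp, q, hq, hlt⟩ | ⟨p, hp, q, hq, hlt⟩
    · obtain ⟨m, hpm, hmq, hm⟩ := exists_between_notMem hlt (Z.image Prod.fst)
      have hmZ : ∀ x ∈ Z, x.1 ≠ m := fun x hx h => hm (Finset.mem_image.2 ⟨x, hx, h⟩)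
      have ham : a ≤ m := ((hin p hp).1.1.trans hpm).le
      have hmb : m ≤ b := (hmq.trans (hin q hq).1.2).le
      rw [boundaryChange_cut_fst ham hmb hcd hbc hb0,
        ih _ (Finset.card_lt_card ((Finset.filter_ssubset (p := fun x : ℝ × ℝ => x.1 < m)).2 ⟨q, hq, by simpa using hmq.le⟩)) ham hcd
          (hF.mono (prod_mono (Icc_subset_Icc le_rfl hmb) subset_rfl))
          (Z.filter fun x => x.1 < m) ?_ ?_ ?_ ?_ rfl,
        ih _ (Finset.card_lt_card ((Finset.filter_ssubset (p := fun x : ℝ × ℝ => ¬ x.1 < m)).2 ⟨p, hp, by simpa using hpm⟩)) hmb hcd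
          (hF.mono (prod_mono (Icc_subset_Icc ham le_rfl) subset_rfl))
          (Z.filter fun x => ¬ x.1 < m) ?_ ?_ ?_ ?_ rfl,
        ← mul_add, ← Int.cast_add, Finset.sum_filter_add_sum_filter_not]
      · intro x hx hx0
        have := hZ x ⟨⟨ham.trans hx.1.1, hx.1.2⟩, hx.2⟩ hx0
        exact Finset.mem_filter.2 ⟨this, not_lt.2 hx.1.1⟩
      · intro x hx
        obtain ⟨hx, h⟩ := Finset.mem_filter.1 hx
        exact ⟨⟨lt_of_le_of_ne (not_lt.1 h) (hmZ x hx).symm, (hin x hx).1.2⟩, (hin x hx).2⟩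
      · exact fun x hx => h0 x (Finset.mem_filter.1 hx).1
      · exact fun x hx => hn x (Finset.mem_filter.1 hx).1
      · intro x hx hx0
        have := hZ x ⟨⟨hx.1.1, hx.1.2.trans hmb⟩, hx.2⟩ hx0
        exact Finset.mem_filter.2 ⟨this, lt_of_le_of_ne hx.1.2 (hmZ x this)⟩
      · intro x hx
        obtain ⟨hx, h⟩ := Finset.mem_filter.1 hx
        exact ⟨⟨(hin x hx).1.1, h⟩, (hin x hx).2⟩
      · exact fun x hx => h0 x (Finset.mem_filter.1 hx).1
      · exact fun x hx => hn x (Finset.mem_filter.1 hx).1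
    · obtain ⟨m, hpm, hmq, hm⟩ := exists_between_notMem hlt (Z.image Prod.snd)
      have hmZ : ∀ x ∈ Z, x.2 ≠ m := fun x hx h => hm (Finset.mem_image.2 ⟨x, hx, h⟩)
      have ham : c ≤ m := ((hin p hp).2.1.trans hpm).le
      have hmb : m ≤ d := (hmq.trans (hin q hq).2.2).le
      rw [boundaryChange_cut_snd hab ham hmb hbc hb0,
        ih _ (Finset.card_lt_card ((Finset.filter_ssubset (p := fun x : ℝ × ℝ => x.2 < m)).2 ⟨q, hq, by simpa using hmq.le⟩)) hab ham
          (hF.mono (prod_mono subset_rfl (Icc_subset_Icc le_rfl hmb)))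
          (Z.filter fun x => x.2 < m) ?_ ?_ ?_ ?_ rfl,
        ih _ (Finset.card_lt_card ((Finset.filter_ssubset (p := fun x : ℝ × ℝ => ¬ x.2 < m)).2 ⟨p, hp, by simpa using hpm⟩)) hab hmb
          (hF.mono (prod_mono subset_rfl (Icc_subset_Icc ham le_rfl)))
          (Z.filter fun x => ¬ x.2 < m) ?_ ?_ ?_ ?_ rfl,
        ← mul_add, ← Int.cast_add, Finset.sum_filter_add_sum_filter_not]
      · intro x hx hx0
        have := hZ x ⟨hx.1, ⟨ham.trans hx.2.1, hx.2.2⟩⟩ hx0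
        exact Finset.mem_filter.2 ⟨this, not_lt.2 hx.2.1⟩
      · intro x hx
        obtain ⟨hx, h⟩ := Finset.mem_filter.1 hx
        exact ⟨(hin x hx).1, ⟨lt_of_le_of_ne (not_lt.1 h) (hmZ x hx).symm, (hin x hx).2.2⟩⟩
      · exact fun x hx => h0 x (Finset.mem_filter.1 hx).1
      · exact fun x hx => hn x (Finset.mem_filter.1 hx).1
      · intro x hx hx0
        have := hZ x ⟨hx.1, ⟨hx.2.1, hx.2.2.trans hmb⟩⟩ hx0
        exact Finset.mem_filter.2 ⟨this, lt_of_le_of_ne hx.2.2 (hmZ x this)⟩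
      · intro x hx
        obtain ⟨hx, h⟩ := Finset.mem_filter.1 hx
        exact ⟨(hin x hx).1, ⟨(hin x hx).2.1, h⟩⟩
      · exact fun x hx => h0 x (Finset.mem_filter.1 hx).1
      · exact fun x hx => hn x (Finset.mem_filter.1 hx).1
  · rcases Nat.lt_or_ge 0 Z.card with h1 | h1
    · obtain ⟨p, rfl⟩ := Finset.card_eq_one.1 (le_antisymm hcard h1)
      rw [Finset.sum_singleton]
      exact boundaryChange_of_single_zero hF (hin p (Finset.mem_singleton_self p))
        (fun q hq hq0 => Finset.mem_singleton.1 (hZ q hq hq0))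
        (hn p (Finset.mem_singleton_self p))
    · obtain rfl : Z = ∅ := Finset.card_eq_zero.1 (Nat.le_zero.1 h1)
      rw [boundaryChange_eq_zero hab hcd hF fun p hp hp0 => by simpa using hZ p hp hp0]
      simp

/-! ### Signed chord diagrams -/

lemma ite_zero_congr {P Q : Prop} {dP : Decidable P} {dQ : Decidable Q} {a b : ℤ} (h : P ↔ Q)
    (hab : a = b) : (@ite ℤ P dP a 0) = @ite ℤ Q dQ b 0 := by
  subst hab
  by_cases hP : P
  · rw [if_pos hP, if_pos (h.1 hP)]
  · rw [if_neg hP, if_neg fun hQ => hP (h.2 hQ)]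

section ChordDiagram

variable {ι : Type*}

/-- A finite set of chord ends: `τ` exchanges the two ends of each chord, and `ε` is a sign that
changes when the ends are exchanged. -/
structure IsChordDiagram (T : Finset ι) (τ : ι → ι) (ε : ι → ℤ) : Prop where
  mem : ∀ s ∈ T, τ s ∈ T
  invol : ∀ s ∈ T, τ (τ s) = s
  anti : ∀ s ∈ T, ε (τ s) = -ε s

open Classical in
/-- The sum of `ε s * ε t` over the pairs that satisfy `P`. -/
def pairSum (T : Finset ι) (ε : ι → ℤ) (P : ι → ι → Prop) : ℤ :=
  ∑ s ∈ T, ∑ t ∈ T, if P s t then ε s * ε t else 0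

/-- The signed number of interleaved pairs of chords, the ends being ordered by `x`. -/
def interSum (T : Finset ι) (τ : ι → ι) (ε : ι → ℤ) (x : ι → ℝ) : ℤ :=
  pairSum T ε fun s t => x s < x t ∧ x t < x (τ s) ∧ x (τ s) < x (τ t)

/-- The signed number of pairs of a chord with both ends in `A` and a chord that leaves `A` from
between them. -/
def exitSum (T : Finset ι) (τ : ι → ι) (ε : ι → ℤ) (x : ι → ℝ) (A : ι → Prop) : ℤ :=
  pairSum T ε fun s t => A s ∧ A (τ s) ∧ A t ∧ ¬ A (τ t) ∧ x s < x t ∧ x t < x (τ s)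

variable {T : Finset ι} {τ : ι → ι} {ε : ι → ℤ} {x y : ι → ℝ} {A : ι → Prop}

lemma IsChordDiagram.sum_comp (h : IsChordDiagram T τ ε) (f : ι → ℤ) :
    ∑ s ∈ T, f (τ s) = ∑ s ∈ T, f s :=
  Finset.sum_nbij' τ τ h.mem h.mem h.invol h.invol fun _ _ => rfl

lemma IsChordDiagram.sum_sum_comp (h : IsChordDiagram T τ ε) (f : ι → ι → ℤ) :
    ∑ s ∈ T, ∑ t ∈ T, f (τ s) (τ t) = ∑ s ∈ T, ∑ t ∈ T, f s t := by
  rw [← h.sum_comp fun s => ∑ t ∈ T, f s t]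
  exact Finset.sum_congr rfl fun s _ => h.sum_comp (f (τ s))

/-- Sums over ordered pairs of ends are invariant under rotation of `s, t, τ s, τ t`. -/
lemma IsChordDiagram.sum_sum_rotate (h : IsChordDiagram T τ ε) (f : ι → ι → ℤ) :
    ∑ s ∈ T, ∑ t ∈ T, f t (τ s) = ∑ s ∈ T, ∑ t ∈ T, f s t := by
  rw [Finset.sum_comm]
  exact Finset.sum_congr rfl fun s _ => h.sum_comp (f s)

lemma pairSum_congr {P Q : ι → ι → Prop} (h : ∀ s ∈ T, ∀ t ∈ T, P s t ↔ Q s t) :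
    pairSum T ε P = pairSum T ε Q :=
  Finset.sum_congr rfl fun s hs => Finset.sum_congr rfl fun t ht =>
    ite_zero_congr (h s hs t ht) rfl

open Classical in
lemma IsChordDiagram.pairSum_comp (h : IsChordDiagram T τ ε) (P : ι → ι → Prop) :
    pairSum T ε (fun s t => P (τ s) (τ t)) = pairSum T ε P := by
  unfold pairSum
  rw [← h.sum_sum_comp fun s t => if P s t then ε s * ε t else 0]
  refine Finset.sum_congr rfl fun s hs => Finset.sum_congr rfl fun t ht => ?_
  rw [h.anti s hs, h.anti t ht, neg_mul_neg]

-- The rotation exchanges the ends of only one of the two chords, so exactly one of the two signs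
-- changes.
open Classical in
lemma IsChordDiagram.pairSum_rotate (h : IsChordDiagram T τ ε) (P : ι → ι → Prop) :
    pairSum T ε (fun s t => P t (τ s)) = -pairSum T ε P := by
  unfold pairSum
  rw [← h.sum_sum_rotate fun s t => if P s t then ε s * ε t else 0,
    ← Finset.sum_neg_distrib]
  refine Finset.sum_congr rfl fun s hs => ?_
  rw [← Finset.sum_neg_distrib]
  refine Finset.sum_congr rfl fun t ht => ?_
  rw [h.anti s hs]
  split_ifs <;> ring

lemma pairSum_or {P Q : ι → ι → Prop} (h : ∀ s ∈ T, ∀ t ∈ T, ¬ (P s t ∧ Q s t)) :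
    pairSum T ε (fun s t => P s t ∨ Q s t) = pairSum T ε P + pairSum T ε Q := by
  unfold pairSum
  rw [← Finset.sum_add_distrib]
  refine Finset.sum_congr rfl fun s hs => ?_
  rw [← Finset.sum_add_distrib]
  refine Finset.sum_congr rfl fun t ht => ?_
  have := h s hs t ht
  by_cases hP : P s t <;> by_cases hQ : Q s t <;> simp_all

lemma interSum_congr (h : IsChordDiagram T τ ε)
    (hxy : ∀ s ∈ T, ∀ t ∈ T, x s < x t ↔ y s < y t) :
    interSum T τ ε x = interSum T τ ε y :=
  pairSum_congr fun s hs t ht => by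
    rw [hxy s hs t ht, hxy t ht _ (h.mem s hs), hxy _ (h.mem s hs) _ (h.mem t ht)]

/-- Read backwards, the pattern `s, t, τ s, τ t` is that of the pair `τ t, τ s`. Both signs change,
and their product does not. -/
lemma interSum_neg (h : IsChordDiagram T τ ε) :
    interSum T τ ε (fun s => -x s) = interSum T τ ε x := by
  unfold interSum
  rw [← h.pairSum_comp]
  unfold pairSum
  rw [Finset.sum_comm]
  refine Finset.sum_congr rfl fun s hs => Finset.sum_congr rfl fun t ht => ?_
  simp only [neg_lt_neg_iff, h.invol s hs, h.invol t ht]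
  exact ite_zero_congr ⟨fun ⟨a, b, c⟩ => ⟨c, b, a⟩, fun ⟨a, b, c⟩ => ⟨c, b, a⟩⟩ (mul_comm _ _)

/-- For comparing the diagrams of two curves. Only products of signs have to agree, because a flip
changes every sign inside the disk. -/
lemma interSum_transfer {κ : Type*} {T' : Finset κ} {τ' : κ → κ} {ε' : κ → ℤ} {k : κ → ι}
    (hk : ∀ s ∈ T', k s ∈ T) (hinj : Set.InjOn k T') (hsurj : ∀ s ∈ T, ∃ s' ∈ T', k s' = s)
    (hτ : ∀ s ∈ T', k (τ' s) = τ (k s))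
    (hε : ∀ s ∈ T', ∀ t ∈ T', ε' s * ε' t = ε (k s) * ε (k t)) (x : ι → ℝ) :
    interSum T' τ' ε' (fun s => x (k s)) = interSum T τ ε x := by
  unfold interSum pairSum
  have key : ∀ f : ι → ℤ, ∑ s ∈ T', f (k s) = ∑ s ∈ T, f s := fun f =>
    Finset.sum_bij (fun s _ => k s) hk (fun s hs t ht hst => hinj hs ht hst)
      (fun s hs => by obtain ⟨s', h, h'⟩ := hsurj s hs; exact ⟨s', h, h'⟩) fun _ _ => rfl
  rw [← key]
  refine Finset.sum_congr rfl fun s hs => ?_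
  rw [← key]
  refine Finset.sum_congr rfl fun t ht => ?_
  exact ite_zero_congr (by simp only [hτ s hs, hτ t ht]) (hε s hs t ht)

/-- Exchanging two consecutive blocks of ends does not change the signed number of interleaved
pairs, provided that both exit sums vanish. -/
lemma interSum_swap (h : IsChordDiagram T τ ε)
    (hx : ∀ s ∈ T, ∀ t ∈ T, A s → ¬ A t → x s < x t)
    (hy : ∀ s ∈ T, ∀ t ∈ T, A s → ¬ A t → y t < y s)
    (hxy : ∀ s ∈ T, ∀ t ∈ T, (A s ↔ A t) → (x s < x t ↔ y s < y t))
    (hA : exitSum T τ ε x A = 0) (hB : exitSum T τ ε x (fun s => ¬ A s) = 0) :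
    interSum T τ ε x = interSum T τ ε y := by
  -- Since `A` precedes its complement in the order `x`, the ends `s, t, τ s, τ t` of an interleaved
  -- pair are sorted by how many of them lie in `A`: four or none (`same`), three (`exA`), two
  -- (`cross`), one (`exB`, rotated). In the order `y` the complement comes first, and the classes
  -- become `same`, `exB`, `cross` with both chords turned around, and `exA` rotated.
  let same (s t : ι) : Prop := (A s ↔ A t) ∧ (A s ↔ A (τ s)) ∧ (A s ↔ A (τ t)) ∧
    x s < x t ∧ x t < x (τ s) ∧ x (τ s) < x (τ t)
  let cross (s t : ι) : Prop := A s ∧ A t ∧ ¬ A (τ s) ∧ ¬ A (τ t) ∧ x s < x t ∧ x (τ s) < x (τ t)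
  let exA (s t : ι) : Prop := A s ∧ A (τ s) ∧ A t ∧ ¬ A (τ t) ∧ x s < x t ∧ x t < x (τ s)
  let exB (s t : ι) : Prop := ¬ A s ∧ ¬ A (τ s) ∧ ¬ A t ∧ ¬ ¬ A (τ t) ∧ x s < x t ∧ x t < x (τ s)
  have hA' : pairSum T ε exA = 0 := hA
  have hB' : pairSum T ε exB = 0 := hB
  have e1 : interSum T τ ε x = pairSum T ε same + (pairSum T ε cross +
      (pairSum T ε exA + pairSum T ε fun s t => exB t (τ s))) := by
    rw [← pairSum_or, ← pairSum_or, ← pairSum_or]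
    · refine pairSum_congr fun s hs t ht => ?_
      have a1 := hx s hs t ht
      have a2 := hx t ht s hs
      have a3 := hx _ (h.mem s hs) _ (h.mem t ht)
      have a4 := hx _ (h.mem t ht) _ (h.mem s hs)
      have a5 := hx _ ht _ (h.mem s hs)
      have a6 := hx _ (h.mem s hs) _ ht
      have i1 := h.invol s hs
      simp only [same, cross, exA, exB, i1]
      grind
    all_goals
      intro s hs t ht
      have i1 := h.invol s hs
      simp only [same, cross, exA, exB, i1]
      grind
  have e2 : interSum T τ ε y = pairSum T ε same + (pairSum T ε (fun s t => cross (τ s) (τ t)) +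
      (pairSum T ε exB + pairSum T ε fun s t => exA t (τ s))) := by
    rw [← pairSum_or, ← pairSum_or, ← pairSum_or]
    · refine pairSum_congr fun s hs t ht => ?_
      have a1 := hy s hs t ht
      have a2 := hy t ht s hs
      have a3 := hy _ (h.mem s hs) _ (h.mem t ht)
      have a4 := hy _ (h.mem t ht) _ (h.mem s hs)
      have a5 := hy _ ht _ (h.mem s hs)
      have a6 := hy _ (h.mem s hs) _ ht
      have b1 := hxy s hs t ht
      have b2 := hxy _ ht _ (h.mem s hs)
      have b3 := hxy _ (h.mem s hs) _ (h.mem t ht)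
      have i1 := h.invol s hs
      have i2 := h.invol t ht
      simp only [same, cross, exA, exB, i1, i2]
      clear hA hB hA' hB' e1 hx hy hxy h i1 i2
      by_cases c1 : A s <;> by_cases c2 : A t <;> by_cases c3 : A (τ s) <;>
        by_cases c4 : A (τ t) <;> grind
    all_goals
      intro s hs t ht
      have i1 := h.invol s hs
      have i2 := h.invol t ht
      simp only [same, cross, exA, exB, i1, i2]
      grind
  -- Turning both chords around preserves `cross`. Rotation only negates the exit sums, which
  -- vanish.
  rw [e1, e2, h.pairSum_rotate, h.pairSum_rotate, h.pairSum_comp, hA', hB']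

open Classical in
/-- The exit sum of an interval of ends vanishes if every chord is met by the others with total
sign zero. -/
lemma exitSum_eq_zero (h : IsChordDiagram T τ ε)
    (hconv : ∀ s ∈ T, ∀ t ∈ T, ∀ u ∈ T, A s → A u → x s < x t → x t < x u → A t)
    (hinj : Set.InjOn x T)
    (hloop : ∀ s ∈ T, x s < x (τ s) →
      ∑ t ∈ T, (if x s < x t ∧ x t < x (τ s) ∧ (x (τ t) < x s ∨ x (τ s) < x (τ t)) then ε t else 0)
        = 0) : exitSum T τ ε x A = 0 := by
  -- The sum over the ends between `s` and `τ s` whose partners lie beyond splits by the partner: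
  -- outside `A`, in `A` after `τ s` (`X`), or in `A` before `s` (`Y`). The classes `X` and `Y` are
  -- the same interleaved pairs seen from either chord, with opposite signs, so they cancel and the
  -- exit sum remains.
  let X (s t : ι) : Prop := A s ∧ A t ∧ A (τ s) ∧ A (τ t) ∧ x s < x t ∧ x t < x (τ s) ∧
    x (τ s) < x (τ t)
  let Y (s t : ι) : Prop := A s ∧ A t ∧ A (τ s) ∧ A (τ t) ∧ x (τ t) < x s ∧ x s < x t ∧
    x t < x (τ s)
  have hXY : pairSum T ε X = -pairSum T ε Y := by
    rw [← h.pairSum_rotate]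
    refine pairSum_congr fun s hs t ht => ?_
    simp only [X, Y, h.invol s hs]
    tauto
  have key : exitSum T τ ε x A + (pairSum T ε X + pairSum T ε Y) = 0 := by
    unfold exitSum
    rw [← pairSum_or, ← pairSum_or]
    · refine Finset.sum_eq_zero fun s hs => ?_
      by_cases hc : A s ∧ A (τ s) ∧ x s < x (τ s)
      · obtain ⟨c1, c2, c3⟩ := hc
        have := congrArg (ε s * ·) (hloop s hs c3)
        simp only [mul_zero] at this
        refine Eq.trans ?_ this
        rw [Finset.mul_sum]
        refine Finset.sum_congr rfl fun t ht => ?_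
        rw [mul_ite, mul_zero]
        refine ite_zero_congr ?_ rfl
        have k1 := hconv s hs t ht _ (h.mem s hs) c1 c2
        have k2 := hconv s hs _ (h.mem t ht) _ (h.mem s hs) c1 c2
        have i1 : x (τ t) = x s → t = τ s := fun e => by
          rw [← hinj (h.mem t ht) hs e, h.invol t ht]
        have i2 : x (τ t) = x (τ s) → t = s := fun e => by
          rw [← h.invol t ht, hinj (h.mem t ht) (h.mem s hs) e, h.invol s hs]
        have i3 : t = τ s → ¬ x t < x (τ s) := by rintro rfl; exact lt_irrefl _
        have i4 : t = s → ¬ x s < x t := by rintro rfl; exact lt_irrefl _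
        have j1 := lt_trichotomy (x (τ t)) (x s)
        have j2 := lt_trichotomy (x (τ t)) (x (τ s))
        simp only [X, Y]
        grind
      · refine Finset.sum_eq_zero fun t ht => if_neg ?_
        simp only [X, Y]
        grind
    all_goals
      intro s hs t ht
      simp only [X, Y]
      grind
  linarith

end ChordDiagram

/-! ### Determinants of tangent vectors of the sphere -/

lemma det3_eq (u v w : E3) : det3 u v w =
    u 0 * (v 1 * w 2 - v 2 * w 1) - u 1 * (v 0 * w 2 - v 2 * w 0)
      + u 2 * (v 0 * w 1 - v 1 * w 0) := by
  simp [det3, Matrix.det_fin_three]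
  ring

lemma det3_swap (u v w : E3) : det3 u w v = -det3 u v w := by
  rw [det3_eq, det3_eq]
  ring

lemma det3_smul_smul (u v w : E3) (a b : ℝ) : det3 u (a • v) (b • w) = a * b * det3 u v w := by
  rw [det3_eq, det3_eq]
  simp
  ring

lemma det3_map (f : E3 →L[ℝ] E3) (u v w : E3) :
    det3 (f u) (f v) (f w) = f.det * det3 u v w := by
  have key : ∀ a b c : E3, det3 a b c =
      (EuclideanSpace.basisFun (Fin 3) ℝ).toBasis.det ![a, b, c] := by
    intro a b c
    rw [Module.Basis.det_apply, det3, ← Matrix.det_transpose]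
    congr 1
    ext i j
    fin_cases i <;> fin_cases j <;> simp [Module.Basis.toMatrix_apply]
  rw [key, key, ContinuousLinearMap.det, ← Module.Basis.det_comp]
  congr 1
  ext i
  fin_cases i <;> simp

lemma inner_eq (u v : E3) : inner ℝ u v = u 0 * v 0 + u 1 * v 1 + u 2 * v 2 := by
  rw [PiLp.inner_apply, Fin.sum_univ_three]
  simp
  ring

lemma sphere_sq (p : S2) : (p : E3) 0 * (p : E3) 0 + (p : E3) 1 * (p : E3) 1
    + (p : E3) 2 * (p : E3) 2 = 1 := by
  rw [← inner_eq, real_inner_self_eq_norm_sq, norm_eq_of_mem_sphere]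
  norm_num

/-- The cross product of two tangent vectors is normal to the sphere. -/
lemma cross_tangent (p : S2) {v w : E3} (hv : inner ℝ (p : E3) v = 0)
    (hw : inner ℝ (p : E3) w = 0) :
    v 1 * w 2 - v 2 * w 1 = det3 p v w * (p : E3) 0 ∧
    v 2 * w 0 - v 0 * w 2 = det3 p v w * (p : E3) 1 ∧
    v 0 * w 1 - v 1 * w 0 = det3 p v w * (p : E3) 2 := by
  have h := sphere_sq p
  rw [inner_eq] at hv hw
  rw [det3_eq]
  set a := (p : E3) 0
  set b := (p : E3) 1
  set c := (p : E3) 2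
  refine ⟨?_, ?_, ?_⟩
  · linear_combination (-(v 1 * w 2 - v 2 * w 1)) * h + (b * w 2 - c * w 1) * hv
      - (b * v 2 - c * v 1) * hw
  · linear_combination (-(v 2 * w 0 - v 0 * w 2)) * h + (c * w 0 - a * w 2) * hv
      - (c * v 0 - a * v 2) * hw
  · linear_combination (-(v 0 * w 1 - v 1 * w 0)) * h + (a * w 1 - b * w 0) * hv
      - (a * v 1 - b * v 0) * hw

lemma det3_ne_zero (p : S2) {v w : E3} (hv : inner ℝ (p : E3) v = 0)
    (hw : inner ℝ (p : E3) w = 0) (hvw : LinearIndependent ℝ ![v, w]) : det3 p v w ≠ 0 := by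
  intro h0
  obtain ⟨h1, h2, h3⟩ := cross_tangent p hv hw
  rw [h0, zero_mul] at h1 h2 h3
  -- The vanishing cross product, expanded in w × (v × w) = ⟨w, w⟩ v - ⟨v, w⟩ w, is a linear
  -- relation between `v` and `w`.
  have hlin := LinearIndependent.pair_iff.1 hvw (inner ℝ w w) (-inner ℝ v w) (by
    rw [inner_eq w w, inner_eq v w]
    ext i
    fin_cases i <;> simp
    · linear_combination w 1 * h3 - w 2 * h2
    · linear_combination w 2 * h1 - w 0 * h3
    · linear_combination w 0 * h2 - w 1 * h1)
  have hw0 : w = 0 := inner_self_eq_zero.1 hlin.1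
  exact hvw.ne_zero 1 (by simpa using hw0)

/-- The velocity of a curve on the sphere is tangent to the sphere. -/
lemma inner_velocity {f : ℝ → S2} {v : E3} {t : ℝ} (hf : HasDerivAt (fun t => (f t : E3)) v t) :
    inner ℝ (f t : E3) v = 0 := by
  have h1 := hf.inner ℝ hf
  have h2 : (fun t => inner ℝ (f t : E3) (f t : E3)) = fun _ => (1 : ℝ) := by
    funext t
    rw [real_inner_self_eq_norm_sq, norm_eq_of_mem_sphere]
    norm_num
  rw [h2] at h1
  have := h1.unique (hasDerivAt_const t (1 : ℝ))
  have h3 := real_inner_comm v (f t : E3)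
  linarith

/-! ### Homogeneous extensions of maps of the sphere -/

/-- The radial projection to the sphere. -/
def radial (x : E3) : S2 :=
  open Classical in
  if h : x = 0 then ⟨EuclideanSpace.single 0 1, by simp⟩
  else ⟨‖x‖⁻¹ • x, by simp [norm_smul, norm_ne_zero_iff.2 h]⟩

/-- The extension of a map of the sphere to Euclidean space that is homogeneous of degree one. -/
def homExt (f : S2 → S2) (x : E3) : E3 := ‖x‖ • (f (radial x) : E3)

lemma radial_coe (p : S2) : radial (p : E3) = p := by
  have : (p : E3) ≠ 0 := ne_zero_of_mem_unit_sphere p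
  apply Subtype.ext
  simp [radial, this]

lemma radial_smul {r : ℝ} (hr : 0 < r) (x : E3) (hx : x ≠ 0) : radial (r • x) = radial x := by
  have : r • x ≠ 0 := smul_ne_zero hr.ne' hx
  apply Subtype.ext
  simp only [radial, dif_neg hx, dif_neg this]
  rw [norm_smul, Real.norm_eq_abs, abs_of_pos hr, smul_smul, mul_inv]
  congr 1
  field_simp

lemma norm_smul_radial {x : E3} (hx : x ≠ 0) : ‖x‖ • (radial x : E3) = x := by
  simp only [radial, dif_neg hx]
  rw [smul_smul, mul_inv_cancel₀ (norm_ne_zero_iff.2 hx), one_smul]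

lemma homExt_coe (f : S2 → S2) (p : S2) : homExt f p = f p := by
  rw [homExt, radial_coe, norm_eq_of_mem_sphere, one_smul]

lemma homExt_homExt (f g : S2 → S2) {x : E3} (hx : x ≠ 0) :
    homExt f (homExt g x) = homExt (f ∘ g) x := by
  have hn : 0 < ‖x‖ := norm_pos_iff.2 hx
  have : radial (homExt g x) = g (radial x) := by
    rw [homExt, radial_smul hn _ (ne_zero_of_mem_unit_sphere _), radial_coe]
  rw [homExt, this, homExt, homExt, norm_smul, norm_eq_of_mem_sphere, mul_one, norm_norm]
  rfl

/-- Away from the origin this is a product of the norm with `f` after the radial projection. The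
extension gives a map of the sphere an ordinary derivative on `E3`, whose determinant tells whether
orientation is preserved. -/
lemma contDiffAt_homExt {f : S2 → S2} (hf : ContMDiff (𝓡 2) (𝓡 2) 1 f) {x : E3} (hx : x ≠ 0) :
    ContDiffAt ℝ 1 (homExt f) x := by
  let U : TopologicalSpace.Opens E3 := ⟨{0}ᶜ, isOpen_compl_singleton⟩
  have h1 : ContMDiff 𝓘(ℝ, E3) 𝓘(ℝ, E3) 1 (fun y : U => ‖(y : E3)‖⁻¹ • (y : E3)) := by
    intro y
    have hy : (y : E3) ≠ 0 := y.2
    have : ContDiffAt ℝ 1 (fun y : E3 => ‖y‖⁻¹ • y) (y : E3) :=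
      ((contDiffAt_norm ℝ hy).inv (norm_ne_zero_iff.2 hy)).smul contDiffAt_id
    exact contMDiffAt_subtype_iff (f := fun y : E3 => ‖y‖⁻¹ • y) (x := y) |>.2 this.contMDiffAt
  have h2 : ∀ y : U, ‖(y : E3)‖⁻¹ • (y : E3) ∈ Metric.sphere (0 : E3) 1 := by
    intro y
    have hy : (y : E3) ≠ 0 := y.2
    simp [norm_smul, norm_ne_zero_iff.2 hy]
  have h3 : ContMDiff 𝓘(ℝ, E3) (𝓡 2) 1 (Set.codRestrict _ _ h2 : U → S2) :=
    ContMDiff.codRestrict_sphere h1 h2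
  have h4 : ContMDiff (𝓡 2) 𝓘(ℝ, E3) 1 ((↑) : S2 → E3) := contMDiff_coe_sphere
  have h5 := (h4.comp hf).comp h3
  have h6 : ContMDiffAt 𝓘(ℝ, E3) 𝓘(ℝ, E3) 1 (fun y : U => (f (radial (y : E3)) : E3)) ⟨x, hx⟩ := by
    convert! h5.contMDiffAt using 1
    funext y
    have hy : (y : E3) ≠ 0 := y.2
    simp only [Function.comp_apply, radial, dif_neg hy]
    rfl
  have h7 : ContDiffAt ℝ 1 (fun y : E3 => (f (radial y) : E3)) x :=
    (contMDiffAt_subtype_iff (f := fun y : E3 => (f (radial y) : E3)).1 h6).contDiffAt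
  exact (contDiffAt_norm ℝ hx).smul h7

lemma isPreconnected_compl_zero : IsPreconnected ({0}ᶜ : Set E3) :=
  (isConnected_compl_singleton_of_one_lt_rank (by
    rw [← Module.finrank_eq_rank]
    simp) 0).isPreconnected

/-- The Jacobian of the homogeneous extension. -/
def jac (f : S2 → S2) (x : E3) : ℝ := (fderiv ℝ (homExt f) x).det

lemma hasFDerivAt_homExt {f : S2 → S2} (hf : ContMDiff (𝓡 2) (𝓡 2) 1 f) {x : E3} (hx : x ≠ 0) :
    HasFDerivAt (homExt f) (fderiv ℝ (homExt f) x) x :=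
  ((contDiffAt_homExt hf hx).differentiableAt one_ne_zero).hasFDerivAt

lemma homExt_ne_zero (f : S2 → S2) {x : E3} (hx : x ≠ 0) : homExt f x ≠ 0 :=
  smul_ne_zero (norm_ne_zero_iff.2 hx) (ne_zero_of_mem_unit_sphere _)

lemma jac_symm_mul (Ψ : DiskChart) {x : E3} (hx : x ≠ 0) :
    jac Ψ.symm (homExt Ψ x) * jac Ψ x = 1 := by
  have h1 := hasFDerivAt_homExt Ψ.contMDiff hx
  have h2 := hasFDerivAt_homExt Ψ.symm.contMDiff (homExt_ne_zero Ψ hx)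
  have h3 := h2.comp x h1
  have h4 : (homExt Ψ.symm ∘ homExt Ψ) =ᶠ[𝓝 x] id := by
    filter_upwards [isOpen_compl_singleton.mem_nhds hx] with y hy
    rw [Function.comp_apply, homExt_homExt _ _ hy, homExt]
    have : (Ψ.symm ∘ Ψ) (radial y) = radial y := Ψ.symm_apply_apply _
    rw [this, norm_smul_radial hy, id]
  have h5 := h3.unique ((hasFDerivAt_id x).congr_of_eventuallyEq h4)
  have h6 := congrArg ContinuousLinearMap.det h5
  simpa [jac, ContinuousLinearMap.det] using h6

lemma jac_ne_zero (Ψ : DiskChart) {x : E3} (hx : x ≠ 0) : jac Ψ x ≠ 0 := fun h => by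
  have := jac_symm_mul Ψ hx
  rw [h, mul_zero] at this
  exact zero_ne_one this

/-- A diffeomorphism of the sphere preserves the orientation everywhere or reverses it
everywhere. -/
lemma sign_jac_eq (Ψ : DiskChart) {x y : E3} (hx : x ≠ 0) (hy : y ≠ 0) :
    SignType.sign (jac Ψ x) = SignType.sign (jac Ψ y) := by
  have hc : ContinuousOn (jac Ψ) ({0}ᶜ : Set E3) := by
    have h1 : ContDiffOn ℝ 1 (homExt Ψ) ({0}ᶜ : Set E3) := fun z hz =>
      (contDiffAt_homExt Ψ.contMDiff hz).contDiffWithinAt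
    exact ContinuousLinearMap.continuous_det.comp_continuousOn
      (h1.continuousOn_fderiv_of_isOpen isOpen_compl_singleton le_rfl)
  have h0 : ∀ z ∈ ({0}ᶜ : Set E3), jac Ψ z ≠ 0 := fun z hz => jac_ne_zero Ψ hz
  have key : ∀ {x y : E3}, x ≠ 0 → y ≠ 0 → 0 < jac Ψ x → 0 < jac Ψ y := by
    intro x y hx hy hpos
    by_contra hneg
    obtain ⟨z, hz, hz0⟩ := isPreconnected_compl_zero.intermediate_value hy hx hc
      (show (0 : ℝ) ∈ Icc _ _ from ⟨not_lt.1 hneg, hpos.le⟩)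
    exact h0 z hz hz0
  rcases lt_or_gt_of_ne (h0 x hx) with h | h
  · have : jac Ψ y < 0 := by
      rcases lt_or_gt_of_ne (h0 y hy) with h' | h'
      · exact h'
      · exact absurd (key hy hx h') (not_lt.2 h.le)
    rw [sign_neg h, sign_neg this]
  · rw [sign_pos h, sign_pos (key hx hy h)]

/-- This is homogeneity along the ray through `p`. It makes the derivative carry the outward normal
to the outward normal, so that `det3` of a normal and two tangent vectors is multiplied by the full
determinant `jac`. -/
lemma fderiv_homExt_self {f : S2 → S2} (hf : ContMDiff (𝓡 2) (𝓡 2) 1 f) (p : S2) :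
    fderiv ℝ (homExt f) p (p : E3) = f p := by
  have hp : (p : E3) ≠ 0 := ne_zero_of_mem_unit_sphere p
  have h1 : HasDerivAt (fun r : ℝ => r • (p : E3)) ((1 : ℝ) • (p : E3)) 1 :=
    (hasDerivAt_id (1 : ℝ)).smul_const (p : E3)
  have h2 : HasFDerivAt (homExt f) (fderiv ℝ (homExt f) p) ((1 : ℝ) • (p : E3)) := by
    rw [one_smul]; exact hasFDerivAt_homExt hf hp
  have h3 := h2.comp_hasDerivAt (1 : ℝ) h1
  have h4 : HasDerivAt (fun r : ℝ => r • (f p : E3)) ((1 : ℝ) • (f p : E3)) 1 :=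
    (hasDerivAt_id (1 : ℝ)).smul_const _
  have h5 : (homExt f ∘ fun r : ℝ => r • (p : E3)) =ᶠ[𝓝 1] fun r : ℝ => r • (f p : E3) := by
    filter_upwards [lt_mem_nhds (zero_lt_one (α := ℝ))] with r hr
    rw [Function.comp_apply, homExt, radial_smul hr _ hp, radial_coe, norm_smul,
      norm_eq_of_mem_sphere, mul_one, Real.norm_eq_abs, abs_of_pos hr]
  have := h3.unique (h4.congr_of_eventuallyEq h5)
  rwa [one_smul, one_smul] at this

lemma det3_fderiv_homExt {f : S2 → S2} (hf : ContMDiff (𝓡 2) (𝓡 2) 1 f) (p : S2) (v w : E3) :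
    det3 (f p) (fderiv ℝ (homExt f) p v) (fderiv ℝ (homExt f) p w) = jac f p * det3 p v w := by
  rw [← fderiv_homExt_self hf p, det3_map, jac]

lemma hasDerivAt_comp_sphere {f : S2 → S2} (hf : ContMDiff (𝓡 2) (𝓡 2) 1 f) {g : ℝ → S2} {v : E3}
    {t : ℝ} (hg : HasDerivAt (fun t => (g t : E3)) v t) :
    HasDerivAt (fun t => (f (g t) : E3)) (fderiv ℝ (homExt f) (g t) v) t := by
  have := (hasFDerivAt_homExt hf (ne_zero_of_mem_unit_sphere (g t))).comp_hasDerivAt t hg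
  convert! this using 1
  funext s
  rw [Function.comp_apply, homExt_coe]

/-- The extension preserves norms; differentiating the squared norm gives the claim. In particular
tangent vectors go to tangent vectors. -/
lemma inner_fderiv_homExt {f : S2 → S2} (hf : ContMDiff (𝓡 2) (𝓡 2) 1 f) (p : S2) (v : E3) :
    inner ℝ (f p : E3) (fderiv ℝ (homExt f) p v) = inner ℝ (p : E3) v := by
  have hp : (p : E3) ≠ 0 := ne_zero_of_mem_unit_sphere p
  have h1 := hasFDerivAt_homExt hf hp
  have h2 := (h1.inner ℝ h1)
  have h3 := ((hasFDerivAt_id (𝕜 := ℝ) (p : E3)).inner ℝ (hasFDerivAt_id (𝕜 := ℝ) (p : E3)))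
  have h4 : (fun x : E3 => inner ℝ (homExt f x) (homExt f x)) = fun x => inner ℝ (id x) (id x) := by
    funext x
    rw [real_inner_self_eq_norm_sq, real_inner_self_eq_norm_sq, homExt, norm_smul,
      norm_eq_of_mem_sphere, mul_one, norm_norm]
    rfl
  rw [h4] at h2
  have := congrArg (fun L => L v) (h2.unique h3)
  simp only [ContinuousLinearMap.comp_apply, ContinuousLinearMap.prod_apply, fderivInnerCLM_apply,
    homExt_coe, ContinuousLinearMap.id_apply, id] at this
  have h5 := real_inner_comm (fderiv ℝ (homExt f) p v) (f p : E3)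
  have h6 := real_inner_comm v (p : E3)
  linarith

/-! ### Planar charts -/

/-- The determinant of two vectors of the plane. -/
def cross2 (z w : ℂ) : ℝ := ((starRingEnd ℂ) z * w).im

lemma cross2_eq (z w : ℂ) : cross2 z w = z.re * w.im - z.im * w.re := by
  simp [cross2]
  ring

/-- `π` is a chart of the part `U` of the sphere, with orientation sign `η`. -/
structure IsPlanarChart (π : E3 → ℂ) (U : Set S2) (η : SignType) : Prop where
  diff : ∀ p ∈ U, DifferentiableAt ℝ π (p : E3)
  inj : InjOn (fun p : S2 => π (p : E3)) U
  ne_zero : η ≠ 0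
  cross : ∀ p ∈ U, ∀ v w : E3, inner ℝ (p : E3) v = 0 → inner ℝ (p : E3) w = 0 →
    SignType.sign (cross2 (fderiv ℝ π p v) (fderiv ℝ π p w)) = η * SignType.sign (det3 p v w)

/-- The first two coordinates, as a complex number. -/
def planar : E3 →L[ℝ] ℂ :=
  (EuclideanSpace.proj 0 : E3 →L[ℝ] ℝ).smulRight (1 : ℂ)
    + (EuclideanSpace.proj 1 : E3 →L[ℝ] ℝ).smulRight Complex.I

lemma planar_re (x : E3) : (planar x).re = x 0 := by simp [planar]

lemma planar_im (x : E3) : (planar x).im = x 1 := by simp [planar]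

/-- After `Ψ` the chart is the orthogonal projection of a hemisphere. The planar determinant is the
third coordinate of the cross product, that is, the height times `det3`, so the orientation is the
sign of the hemisphere times the sign of `jac Ψ`. -/
lemma isPlanarChart_hemisphere (Ψ : DiskChart) {e : ℝ} (he : e = 1 ∨ e = -1) :
    ∃ η, IsPlanarChart (fun x => planar (homExt Ψ x)) {p | 0 < e * height Ψ p} η := by
  have hp0 : ∀ p : S2, (p : E3) ≠ 0 := fun p => ne_zero_of_mem_unit_sphere p
  -- A reference point; any would do, because the sign of `jac Ψ` is the same everywhere.
  let p₀ : S2 := radial 0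
  have hee : e ≠ 0 := by rcases he with rfl | rfl <;> norm_num
  have hder : ∀ p : S2, HasFDerivAt (fun x => planar (homExt Ψ x))
      (planar.comp (fderiv ℝ (homExt Ψ) p)) (p : E3) := fun p =>
    planar.hasFDerivAt.comp (p : E3) (hasFDerivAt_homExt Ψ.contMDiff (hp0 p))
  refine ⟨SignType.sign (e * jac Ψ p₀), fun p _ => (hder p).differentiableAt, ?_, ?_, ?_⟩
  · intro p hp q hq hpq
    simp only [homExt_coe] at hpq
    have h0 : (Ψ p : E3) 0 = (Ψ q : E3) 0 := by
      rw [← planar_re, ← planar_re, hpq]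
    have h1 : (Ψ p : E3) 1 = (Ψ q : E3) 1 := by
      rw [← planar_im, ← planar_im, hpq]
    have h2 : (Ψ p : E3) 2 = (Ψ q : E3) 2 := by
      have e1 := sphere_sq (Ψ p)
      have e2 := sphere_sq (Ψ q)
      rw [h0, h1] at e1
      have e3 : ((Ψ p : E3) 2 - (Ψ q : E3) 2) * ((Ψ p : E3) 2 + (Ψ q : E3) 2) = 0 := by
        linear_combination e1 - e2
      rcases mul_eq_zero.1 e3 with h | h
      · linarith
      · simp only [mem_ofPred_eq, height] at hp hq
        have e4 : e * ((Ψ p : E3) 2 + (Ψ q : E3) 2) = 0 := by rw [h, mul_zero]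
        rw [mul_add] at e4
        linarith
    apply Ψ.injective
    apply Subtype.ext
    ext i
    fin_cases i
    · exact h0
    · exact h1
    · exact h2
  · rw [Ne, sign_eq_zero_iff]
    exact mul_ne_zero hee (jac_ne_zero Ψ (hp0 p₀))
  · intro p hp v w hv hw
    rw [(hder p).fderiv, cross2_eq]
    simp only [ContinuousLinearMap.comp_apply, planar_re, planar_im]
    have hv' := (inner_fderiv_homExt Ψ.contMDiff p v).trans hv
    have hw' := (inner_fderiv_homExt Ψ.contMDiff p w).trans hw
    rw [(cross_tangent (Ψ p) hv' hw').2.2, det3_fderiv_homExt Ψ.contMDiff, sign_mul, sign_mul,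
      sign_jac_eq Ψ (hp0 p) (hp0 p₀), sign_mul]
    have : SignType.sign ((Ψ p : E3) 2) = SignType.sign e := by
      simp only [mem_ofPred_eq, height] at hp
      rcases he with rfl | rfl
      · rw [sign_pos (by linarith), sign_pos one_pos]
      · rw [sign_neg (by linarith), sign_neg (by norm_num)]
    rw [this]
    generalize SignType.sign e = a
    generalize SignType.sign (jac _ _) = b
    generalize SignType.sign (det3 _ _ _) = c
    decide +revert

/-- Stereographic projection from `(0, 0, 1)`. -/
def stereo (x : E3) : ℂ := ((1 - x 2)⁻¹ : ℝ) • planar x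

lemma hasFDerivAt_stereo {x : E3} (hx : x 2 ≠ 1) :
    HasFDerivAt stereo (((1 - x 2)⁻¹ : ℝ) • planar +
      (((1 - x 2)⁻¹ ^ 2 : ℝ) • (EuclideanSpace.proj 2 : E3 →L[ℝ] ℝ)).smulRight (planar x)) x := by
  have h1 : HasFDerivAt (fun x : E3 => 1 - x 2) (-(EuclideanSpace.proj 2 : E3 →L[ℝ] ℝ)) x :=
    (EuclideanSpace.proj 2 : E3 →L[ℝ] ℝ).hasFDerivAt.const_sub 1
  have h2 := (hasDerivAt_inv (sub_ne_zero.2 hx.symm)).comp_hasFDerivAt x h1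
  have h3 := h2.smul planar.hasFDerivAt
  convert! h3 using 1
  congr 2
  ext v
  simp

/-- A reflection of the space takes `N` to the pole, from which the sphere is projected. If `N` is
already the pole the reflection is the identity, so only the nonvanishing of its determinant is
used. -/
lemma isPlanarChart_stereo (N : S2) :
    ∃ π η, IsPlanarChart π {N}ᶜ η := by
  let n : E3 := EuclideanSpace.single 2 1
  have hn : ‖(N : E3)‖ = ‖n‖ := by simp [n]
  let A : E3 ≃ₗᵢ[ℝ] E3 := (ℝ ∙ ((N : E3) - n))ᗮ.reflection
  have hA : A N = n := Submodule.reflection_sub hn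
  let A' : E3 →L[ℝ] E3 := (A : E3 →L[ℝ] E3)
  have hAA : ∀ x, A' x = A x := fun x => rfl
  have hdet : A'.det ≠ 0 := (LinearEquiv.isUnit_det' A.toLinearEquiv).ne_zero
  have hAs : ∀ p : S2, A p ∈ Metric.sphere (0 : E3) 1 := fun p => by simp
  have h2 : ∀ p ∈ ({N}ᶜ : Set S2), (A (p : E3)) 2 < 1 := by
    intro p hp
    have hsq := sphere_sq ⟨A p, hAs p⟩
    simp only at hsq
    by_contra h
    have q0 := mul_self_nonneg ((A (p : E3)) 0)
    have q1 := mul_self_nonneg ((A (p : E3)) 1)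
    have h1 : (A (p : E3)) 2 = 1 := by nlinarith
    rw [h1] at hsq
    have e0 : (A (p : E3)) 0 = 0 := mul_self_eq_zero.1 (by linarith)
    have e1 : (A (p : E3)) 1 = 0 := mul_self_eq_zero.1 (by linarith)
    apply hp
    apply Subtype.ext
    apply A.injective
    rw [hA]
    ext i
    fin_cases i <;> simp [n, e0, e1, h1]
  have hder : ∀ p ∈ ({N}ᶜ : Set S2), HasFDerivAt (fun x => stereo (A x)) _ (p : E3) :=
    fun p hp => (hasFDerivAt_stereo (h2 p hp).ne).comp (p : E3) A'.hasFDerivAt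
  refine ⟨fun x => stereo (A x), SignType.sign (-A'.det), fun p hp => (hder p hp).differentiableAt,
    ?_, ?_, ?_⟩
  · intro p hp q hq hpq
    have k1 := h2 p hp
    have k2 := h2 q hq
    have s1 := sphere_sq ⟨A p, hAs p⟩
    have s2 := sphere_sq ⟨A q, hAs q⟩
    simp only at s1 s2
    have r := congrArg Complex.re hpq
    have i := congrArg Complex.im hpq
    simp only [stereo, Complex.smul_re, Complex.smul_im, planar_re, planar_im, smul_eq_mul] at r i
    set a := (1 - (A (p : E3)) 2)⁻¹ with ha
    set b := (1 - (A (q : E3)) 2)⁻¹ with hb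
    have ha0 : 0 < a := inv_pos.2 (by linarith)
    have hb0 : 0 < b := inv_pos.2 (by linarith)
    have ha' : (A (p : E3)) 2 = 1 - a⁻¹ := by rw [ha, inv_inv]; ring
    have hb' : (A (q : E3)) 2 = 1 - b⁻¹ := by rw [hb, inv_inv]; ring
    rw [ha'] at s1
    rw [hb'] at s2
    -- The squared modulus of the image is 2a - 1; it determines `a` and thereby the height.
    have m1 : a * a * ((A (p : E3)) 0 * (A (p : E3)) 0 + (A (p : E3)) 1 * (A (p : E3)) 1)
        = 2 * a - 1 := by
      have : (A (p : E3)) 0 * (A (p : E3)) 0 + (A (p : E3)) 1 * (A (p : E3)) 1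
        = 1 - (1 - a⁻¹) * (1 - a⁻¹) := by linarith
      rw [this]
      field_simp
      ring
    have m2 : b * b * ((A (q : E3)) 0 * (A (q : E3)) 0 + (A (q : E3)) 1 * (A (q : E3)) 1)
        = 2 * b - 1 := by
      have : (A (q : E3)) 0 * (A (q : E3)) 0 + (A (q : E3)) 1 * (A (q : E3)) 1
        = 1 - (1 - b⁻¹) * (1 - b⁻¹) := by linarith
      rw [this]
      field_simp
      ring
    have hab : a = b := by
      have : a * a * ((A (p : E3)) 0 * (A (p : E3)) 0 + (A (p : E3)) 1 * (A (p : E3)) 1)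
          = b * b * ((A (q : E3)) 0 * (A (q : E3)) 0 + (A (q : E3)) 1 * (A (q : E3)) 1) := by
        linear_combination (a * (A (p : E3)) 0 + b * (A (q : E3)) 0) * r
          + (a * (A (p : E3)) 1 + b * (A (q : E3)) 1) * i
      linarith
    rw [hab] at r i
    apply Subtype.ext
    apply A.injective
    ext j
    fin_cases j
    · exact mul_left_cancel₀ hb0.ne' r
    · exact mul_left_cancel₀ hb0.ne' i
    · change (A (p : E3)) 2 = (A (q : E3)) 2
      rw [ha', hb', hab]
  · rw [Ne, sign_eq_zero_iff, neg_eq_zero]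
    exact hdet
  · intro p hp v w hv hw
    rw [(hder p hp).fderiv, cross2_eq, ← sign_mul]
    have hv' : inner ℝ (A p) (A v) = 0 := by rw [A.inner_map_map]; exact hv
    have hw' : inner ℝ (A p) (A w) = 0 := by rw [A.inner_map_map]; exact hw
    obtain ⟨c0, c1, c2⟩ := cross_tangent ⟨A p, hAs p⟩ hv' hw'
    have s1 := sphere_sq ⟨A p, hAs p⟩
    have hd : det3 (A p) (A v) (A w) = A'.det * det3 p v w := det3_map A' p v w
    have k1 := h2 p hp
    simp only [hd] at c0 c1 c2 s1
    have hm : 0 < (1 - (A (p : E3)) 2)⁻¹ := inv_pos.2 (by linarith)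
    -- On tangent planes the projection is conformal and, seen from outside the sphere, reverses the
    -- orientation: it multiplies areas by minus the square of `(1 - (A p) 2)⁻¹`.
    have key : ∀ κ : ℝ, κ = (1 - (A (p : E3)) 2)⁻¹ ^ 2 * (-A'.det * det3 p v w) →
        SignType.sign κ = SignType.sign (-A'.det * det3 p v w) := by
      rintro κ rfl
      rw [sign_mul, sign_pos (by positivity), one_mul]
    apply key
    have hproj : ∀ x : E3, (EuclideanSpace.proj 2 : E3 →L[ℝ] ℝ) x = x 2 := fun _ => rfl
    have hmul : (1 - (A (p : E3)) 2)⁻¹ * (1 - (A (p : E3)) 2) = 1 :=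
      inv_mul_cancel₀ (by linarith)
    simp only [ContinuousLinearMap.comp_apply, _root_.add_apply,
      _root_.smul_apply, ContinuousLinearMap.smulRight_apply, Complex.add_re,
      Complex.add_im, Complex.smul_re, Complex.smul_im, planar_re, planar_im, hAA, smul_eq_mul,
      hproj]
    set m := (1 - (A (p : E3)) 2)⁻¹
    linear_combination m ^ 2 * c2 - m ^ 3 * (A (p : E3)) 0 * c0 - m ^ 3 * (A (p : E3)) 1 * c1
      - m ^ 3 * (A'.det * det3 p v w) * s1
      - m ^ 2 * (A'.det * det3 p v w) * (1 + (A (p : E3)) 2) * hmul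

lemma linearIndependent_of_det3 {p v w : E3} (h : det3 p v w ≠ 0) :
    LinearIndependent ℝ ![v, w] := by
  rw [LinearIndependent.pair_iff]
  intro a b hab
  have e1 : det3 p (a • v + b • w) w = a * det3 p v w := by
    rw [det3_eq, det3_eq]; simp; ring
  have e2 : det3 p v (a • v + b • w) = b * det3 p v w := by
    rw [det3_eq, det3_eq]; simp; ring
  have z1 : det3 p 0 w = 0 := by rw [det3_eq]; simp
  have z2 : det3 p v 0 = 0 := by rw [det3_eq]; simp
  rw [hab, z1] at e1
  rw [hab, z2] at e2
  exact ⟨(mul_eq_zero.1 e1.symm).resolve_right h, (mul_eq_zero.1 e2.symm).resolve_right h⟩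

/-! ### The reflection -/

/-- The reflection `(x, y, z) ↦ (-x, y, z)` of Euclidean space. -/
def mirrorL : E3 →L[ℝ] E3 :=
  LinearMap.toContinuousLinearMap
    { toFun := fun x => !₂[-x 0, x 1, x 2]
      map_add' := fun x y => by ext i; fin_cases i <;> simp; ring
      map_smul' := fun a x => by ext i; fin_cases i <;> simp }

lemma mirror_coe (p : S2) : (mirror p : E3) = mirrorL p := rfl

lemma det3_mirrorL (u v w : E3) : det3 (mirrorL u) (mirrorL v) (mirrorL w) = -det3 u v w := by
  rw [det3_eq, det3_eq]
  simp [mirrorL]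
  ring

lemma continuous_mirror : Continuous mirror :=
  continuous_induced_rng.2 (mirrorL.continuous.comp continuous_subtype_val)

lemma mirror_mirror (p : S2) : mirror (mirror p) = p := by
  apply Subtype.ext
  ext i
  fin_cases i <;> simp [mirror]

lemma continuous_reflect (Ψ : DiskChart) : Continuous (reflect Ψ) :=
  Ψ.symm.continuous.comp (continuous_mirror.comp Ψ.continuous)

lemma apply_reflect (Ψ : DiskChart) (p : S2) : Ψ (reflect Ψ p) = mirror (Ψ p) :=
  Ψ.apply_symm_apply _

lemma reflect_reflect (Ψ : DiskChart) (p : S2) : reflect Ψ (reflect Ψ p) = p := by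
  rw [reflect, apply_reflect, mirror_mirror]
  exact Ψ.symm_apply_apply p

lemma reflect_injective (Ψ : DiskChart) : Function.Injective (reflect Ψ) :=
  (show Function.Involutive (reflect Ψ) from reflect_reflect Ψ).injective

lemma height_reflect (Ψ : DiskChart) (p : S2) : height Ψ (reflect Ψ p) = height Ψ p := by
  rw [height, apply_reflect]
  simp [mirror, height]

lemma continuous_height (Ψ : DiskChart) : Continuous (height Ψ) :=
  (EuclideanSpace.proj 2 : E3 →L[ℝ] ℝ).continuous.comp
    (continuous_subtype_val.comp Ψ.continuous)

/-- The reflection is differentiable and reverses the orientation. -/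
lemma exists_reflect_deriv (Ψ : DiskChart) : ∃ D : S2 → E3 → E3,
    (∀ (f : ℝ → S2) (v : E3) (t : ℝ), HasDerivAt (fun t => (f t : E3)) v t →
      HasDerivAt (fun t => (reflect Ψ (f t) : E3)) (D (f t) v) t) ∧
    ∀ (p : S2) (v w : E3), SignType.sign (det3 (reflect Ψ p) (D p v) (D p w))
      = -SignType.sign (det3 p v w) := by
  refine ⟨fun p v => fderiv ℝ (homExt Ψ.symm) (mirror (Ψ p))
    (mirrorL (fderiv ℝ (homExt Ψ) p v)), fun f v t hf => ?_, fun p v w => ?_⟩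
  · have h1 := hasDerivAt_comp_sphere Ψ.contMDiff hf
    have h2 : HasDerivAt (fun t => (mirror (Ψ (f t)) : E3)) (mirrorL (fderiv ℝ (homExt Ψ) (f t) v))
        t := mirrorL.hasFDerivAt.comp_hasDerivAt t h1
    exact hasDerivAt_comp_sphere Ψ.symm.contMDiff h2
  · have hp : ∀ p : S2, (p : E3) ≠ 0 := fun p => ne_zero_of_mem_unit_sphere p
    rw [reflect, det3_fderiv_homExt Ψ.symm.contMDiff, mirror_coe, det3_mirrorL,
      det3_fderiv_homExt Ψ.contMDiff, ← mirror_coe, sign_mul, Left.sign_neg, sign_mul,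
      sign_jac_eq Ψ.symm (hp _) (hp (Ψ p))]
    -- The Jacobians of `Ψ` and of its inverse are taken at points that do not correspond, but their
    -- signs are constant and equal. They cancel and leave the sign of the mirror.
    have h := congrArg SignType.sign (jac_symm_mul Ψ (hp p))
    rw [homExt_coe, sign_mul, sign_one] at h
    rw [mul_neg, ← mul_assoc]
    erw [h]
    rw [one_mul]

/-! ### The chord diagram of a generic closed curve -/

/-- The times at which a closed curve passes through a vertex. -/
def vertexTimes (γ : UnitAddCircle → S2) : Set UnitAddCircle := {s | ∃ t, t ≠ s ∧ γ t = γ s}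

lemma IsGeneric.finite_vertexTimes {γ : UnitAddCircle → S2} (hγ : IsGeneric γ) :
    (vertexTimes γ).Finite := by
  refine (hγ.finite_vertices.preimage' fun x hx => ?_).subset
    (show vertexTimes γ ⊆ γ ⁻¹' vertices γ from fun s ⟨t, hts, h⟩ => ⟨t, s, hts, h, rfl⟩)
  obtain ⟨s, t, hst, hs, ht⟩ := hx
  refine (Set.toFinite {s, t}).subset fun r hr => ?_
  have hr' : γ r = x := hr
  rcases hγ.double r s t (hr'.trans hs.symm) (hs.trans ht.symm) with h | h | h
  · exact Or.inl h
  · exact absurd h hst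
  · exact Or.inr h

open Classical in
/-- The times at which a closed curve passes through a vertex, as a finite set. -/
def ends (γ : UnitAddCircle → S2) : Finset UnitAddCircle :=
  if h : (vertexTimes γ).Finite then h.toFinset else ∅

open Classical in
/-- The other time at which the curve passes through the same point. -/
def partner (γ : UnitAddCircle → S2) (s : UnitAddCircle) : UnitAddCircle :=
  if h : ∃ t, t ≠ s ∧ γ t = γ s then h.choose else s

lemma path_periodic (γ : UnitAddCircle → S2) : Function.Periodic (path γ) 1 := fun t => by
  simp [path]

lemma deriv_path_periodic (γ : UnitAddCircle → S2) : Function.Periodic (deriv (path γ)) 1 :=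
  fun t => by
    have : (fun t => path γ (t + 1)) = path γ := funext (path_periodic γ)
    conv_rhs => rw [← this]
    rw [deriv_comp_add_const]

/-- The velocity. -/
def velocity (γ : UnitAddCircle → S2) : UnitAddCircle → E3 := (deriv_path_periodic γ).lift

lemma velocity_coe (γ : UnitAddCircle → S2) (t : ℝ) : velocity γ t = deriv (path γ) t :=
  (deriv_path_periodic γ).lift_coe t

/-- The sign of a vertex when the passage at time `s` is considered as the first one. -/
def eps (γ : UnitAddCircle → S2) (s : UnitAddCircle) : ℤ :=
  SignType.sign (det3 (γ s) (velocity γ (partner γ s)) (velocity γ s))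

/-- The representative in `[0, 1)` of a time. -/
def pos (s : UnitAddCircle) : ℝ := AddCircle.equivIco 1 0 s

lemma coe_pos (s : UnitAddCircle) : ((pos s : ℝ) : UnitAddCircle) = s := AddCircle.coe_equivIco

lemma pos_nonneg (s : UnitAddCircle) : 0 ≤ pos s := (AddCircle.equivIco (1 : ℝ) 0 s).2.1

lemma pos_lt_one (s : UnitAddCircle) : pos s < 1 := by
  have := (AddCircle.equivIco (1 : ℝ) 0 s).2.2
  exact this.trans_eq (zero_add 1)

lemma pos_injective : Function.Injective pos := fun s t h => by
  rw [← coe_pos s, h, coe_pos]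

lemma pos_coe {u : ℝ} (h0 : 0 ≤ u) (h1 : u < 1) : pos (u : UnitAddCircle) = u :=
  AddCircle.equivIco_coe_of_mem ⟨h0, by simpa using h1⟩

lemma coe_eq_coe_of_abs_lt {u v : ℝ} (h : |u - v| < 1) (huv : (u : UnitAddCircle) = v) : u = v := by
  rw [abs_lt] at h
  refine (AddCircle.coe_eq_coe_iff_of_mem_Ico (p := (1 : ℝ)) (a := min u v) ?_ ?_).1 huv
  · refine ⟨min_le_left _ _, ?_⟩
    rcases min_choice u v with h' | h' <;> rw [h'] <;> linarith
  · refine ⟨min_le_right _ _, ?_⟩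
    rcases min_choice u v with h' | h' <;> rw [h'] <;> linarith

section

variable {γ : UnitAddCircle → S2}

lemma IsGeneric.mem_ends (hγ : IsGeneric γ) {s : UnitAddCircle} :
    s ∈ ends γ ↔ ∃ t, t ≠ s ∧ γ t = γ s := by
  rw [ends, dif_pos hγ.finite_vertexTimes, Set.Finite.mem_toFinset]
  rfl

lemma IsGeneric.partner_ne (hγ : IsGeneric γ) {s : UnitAddCircle} (hs : s ∈ ends γ) :
    partner γ s ≠ s := by
  have h := hγ.mem_ends.1 hs
  rw [partner, dif_pos h]
  exact h.choose_spec.1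

lemma apply_partner (γ : UnitAddCircle → S2) (s : UnitAddCircle) : γ (partner γ s) = γ s := by
  by_cases h : ∃ t, t ≠ s ∧ γ t = γ s
  · rw [partner, dif_pos h]
    exact h.choose_spec.2
  · rw [partner, dif_neg h]

lemma IsGeneric.partner_eq (hγ : IsGeneric γ) {s t : UnitAddCircle} (hts : t ≠ s)
    (h : γ t = γ s) : partner γ s = t := by
  have hs : s ∈ ends γ := hγ.mem_ends.2 ⟨t, hts, h⟩
  rcases hγ.double (partner γ s) s t (apply_partner γ s) h.symm with h' | h' | h'
  · exact absurd h' (hγ.partner_ne hs)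
  · exact absurd h'.symm hts
  · exact h'

lemma IsGeneric.mem_ends_of_eq (hγ : IsGeneric γ) {s t : UnitAddCircle} (hts : t ≠ s)
    (h : γ t = γ s) : s ∈ ends γ := hγ.mem_ends.2 ⟨t, hts, h⟩

lemma IsGeneric.partner_mem (hγ : IsGeneric γ) {s : UnitAddCircle} (hs : s ∈ ends γ) :
    partner γ s ∈ ends γ :=
  hγ.mem_ends_of_eq (hγ.partner_ne hs).symm (apply_partner γ s).symm

lemma IsGeneric.partner_partner (hγ : IsGeneric γ) {s : UnitAddCircle} (hs : s ∈ ends γ) :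
    partner γ (partner γ s) = s :=
  hγ.partner_eq (hγ.partner_ne hs).symm (apply_partner γ s).symm

lemma IsGeneric.isChordDiagram (hγ : IsGeneric γ) :
    IsChordDiagram (ends γ) (partner γ) (eps γ) where
  mem s hs := hγ.partner_mem hs
  invol s hs := hγ.partner_partner hs
  anti s hs := by
    rw [eps, eps, hγ.partner_partner hs, apply_partner γ, det3_swap, Left.sign_neg, SignType.coe_neg]

lemma IsGeneric.hasDerivAt (hγ : IsGeneric γ) {u : ℝ} (hu : (u : UnitAddCircle) ∈ ends γ) :
    HasDerivAt (fun t : ℝ => (γ t : E3)) (velocity γ u) u := by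
  obtain ⟨t, ht, h⟩ := hγ.mem_ends.1 hu
  rw [← coe_pos t] at ht h
  rw [velocity_coe]
  exact (hγ.transverse _ u ht h).2.1.hasDerivAt

lemma IsGeneric.inner_velocity (hγ : IsGeneric γ) {s : UnitAddCircle} (hs : s ∈ ends γ) :
    inner ℝ (γ s : E3) (velocity γ s) = 0 := by
  rw [← coe_pos s] at hs ⊢
  exact TangleFlip.inner_velocity (f := fun t : ℝ => γ t) (hγ.hasDerivAt hs)

lemma IsGeneric.det_ne_zero (hγ : IsGeneric γ) {s : UnitAddCircle} (hs : s ∈ ends γ) :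
    det3 (γ s) (velocity γ (partner γ s)) (velocity γ s) ≠ 0 := by
  refine det3_ne_zero _ ?_ (hγ.inner_velocity hs) ?_
  · rw [← apply_partner γ s]
    exact hγ.inner_velocity (hγ.partner_mem hs)
  · have h := (hγ.transverse (pos (partner γ s)) (pos s) (by
      rw [coe_pos, coe_pos]; exact hγ.partner_ne hs) (by
      rw [coe_pos, coe_pos]; exact apply_partner γ s)).2.2
    rwa [← velocity_coe, ← velocity_coe, coe_pos, coe_pos] at h

lemma IsGeneric.sgn_eq (hγ : IsGeneric γ) {s : UnitAddCircle} (hs : s ∈ ends γ) :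
    sgn γ (pos s, pos (partner γ s)) = eps γ s := by
  have h := hγ.det_ne_zero hs
  rw [sgn, eps, ← velocity_coe, ← velocity_coe, coe_pos, coe_pos, path, coe_pos]
  rcases lt_or_gt_of_ne h with h' | h'
  · rw [if_neg (not_lt.2 h'.le), sign_neg h']
    rfl
  · rw [if_pos h', sign_pos h']
    rfl

lemma IsGeneric.mem_crossings_iff (hγ : IsGeneric γ) {p : ℝ × ℝ} : p ∈ crossings γ ↔
    ∃ s ∈ ends γ, pos s < pos (partner γ s) ∧ p = (pos s, pos (partner γ s)) := by
  constructor
  · rintro ⟨h0, h1, h2, h3⟩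
    have e1 : pos (p.1 : UnitAddCircle) = p.1 := pos_coe h0 (h1.trans h2)
    have e2 : pos (p.2 : UnitAddCircle) = p.2 := pos_coe (h0.trans h1.le) h2
    have hne : (p.2 : UnitAddCircle) ≠ p.1 := fun h => by
      have := congrArg pos h
      rw [e1, e2] at this
      exact h1.ne' this
    have hp := hγ.partner_eq hne h3.symm
    refine ⟨(p.1 : UnitAddCircle), hγ.mem_ends_of_eq hne h3.symm, ?_, ?_⟩
    · rw [hp, e1, e2]; exact h1
    · rw [hp, e1, e2]
  · rintro ⟨s, hs, h1, rfl⟩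
    refine ⟨pos_nonneg _, h1, pos_lt_one _, ?_⟩
    rw [coe_pos, coe_pos, apply_partner γ]

/-- The inequalities force `s` and `t` to be first passages, so the sum over all ends meets every
interleaved pair once and `eps` agrees there with `sgn`. -/
lemma IsGeneric.defect_eq (hγ : IsGeneric γ) :
    defect γ = -2 * interSum (ends γ) (partner γ) (eps γ) pos := by
  classical
  rw [defect]
  congr 1
  let e : UnitAddCircle × UnitAddCircle → (ℝ × ℝ) × (ℝ × ℝ) := fun q =>
    ((pos q.1, pos (partner γ q.1)), (pos q.2, pos (partner γ q.2)))
  let I : Finset (UnitAddCircle × UnitAddCircle) := (ends γ ×ˢ ends γ).filter fun q =>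
    pos q.1 < pos q.2 ∧ pos q.2 < pos (partner γ q.1) ∧
      pos (partner γ q.1) < pos (partner γ q.2)
  have h1 : interleaved γ = e '' (I : Set (UnitAddCircle × UnitAddCircle)) := by
    ext q
    constructor
    · rintro ⟨h1, h2, h3, h4, h5⟩
      obtain ⟨s, hs, hs', e1⟩ := hγ.mem_crossings_iff.1 h1
      obtain ⟨t, ht, ht', e2⟩ := hγ.mem_crossings_iff.1 h2
      rw [e1, e2] at h4
      rw [e1, e2] at h5
      rw [e1, e2] at h3
      refine ⟨(s, t), ?_, Prod.ext e1.symm e2.symm⟩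
      simp only [I, Finset.coe_filter, Finset.mem_product]
      exact ⟨⟨hs, ht⟩, h3, h4, h5⟩
    · rintro ⟨⟨s, t⟩, hst, rfl⟩
      simp only [I, Finset.coe_filter, Finset.mem_product] at hst
      obtain ⟨⟨hs, ht⟩, h3, h4, h5⟩ := hst
      exact ⟨hγ.mem_crossings_iff.2 ⟨s, hs, h3.trans h4, rfl⟩,
        hγ.mem_crossings_iff.2 ⟨t, ht, h4.trans h5, rfl⟩, h3, h4, h5⟩
  have h2 : InjOn e I := fun q _ r _ h => by
    simp only [e, Prod.mk.injEq] at h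
    exact Prod.ext (pos_injective h.1.1) (pos_injective h.2.1)
  rw [h1, finsum_mem_image h2, finsum_mem_coe_finset, Finset.sum_filter, Finset.sum_product]
  refine Finset.sum_congr rfl fun s hs => Finset.sum_congr rfl fun t ht => ?_
  refine ite_zero_congr Iff.rfl ?_
  simp only [e]
  rw [hγ.sgn_eq hs, hγ.sgn_eq ht]

/-! ### Signed intersection numbers of subarcs -/

open Classical in
/-- The sum of the signs of the intersections of the open subarcs `(a, b)` and `(c, d)`. -/
def arcSum (γ : UnitAddCircle → S2) (a b c d : ℝ) : ℤ :=
  ∑ s ∈ ends γ, if (∃ u ∈ Ioo a b, (u : UnitAddCircle) = s) ∧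
    (∃ v ∈ Ioo c d, (v : UnitAddCircle) = partner γ s) then eps γ s else 0

/-- The partial derivatives of the difference are the image of the velocity at `u` and minus the
image of the velocity at `v`. Their determinant has the sign of `det3 (γ u) (velocity γ v) (velocity
γ u)`, up to the orientation of the chart, which is `eps` at `u`. -/
lemma IsGeneric.hasIndex_crossing (hγ : IsGeneric γ) {π : E3 → ℂ} {U : Set S2} {η : SignType}
    (hπ : IsPlanarChart π U η) {F : ℝ × ℝ → ℂ} {u v : ℝ} (huv : (u : UnitAddCircle) ≠ v)
    (h : γ u = γ v) (hU : γ u ∈ U) (hc : ∀ᶠ q in 𝓝 (u, v), ContinuousAt F q)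
    (hF : F =ᶠ[𝓝 (u, v)] fun q => π (γ (q.1 : UnitAddCircle)) - π (γ (q.2 : UnitAddCircle))) :
    HasIndex F (u, v) ((η : ℤ) * eps γ u) := by
  have hu : (u : UnitAddCircle) ∈ ends γ := hγ.mem_ends_of_eq huv.symm h.symm
  have hv : (v : UnitAddCircle) ∈ ends γ := hγ.mem_ends_of_eq huv h
  have hp : partner γ (u : UnitAddCircle) = v := hγ.partner_eq huv.symm h.symm
  set D := fderiv ℝ π (γ (u : UnitAddCircle)) with hD
  have h1 : HasDerivAt (fun t : ℝ => π (γ (t : UnitAddCircle))) (D (velocity γ u)) u :=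
    (hπ.diff _ hU).hasFDerivAt.comp_hasDerivAt u (hγ.hasDerivAt hu)
  have h2 : HasDerivAt (fun t : ℝ => π (γ (t : UnitAddCircle))) (D (velocity γ v)) v := by
    rw [hD, h]
    rw [h] at hU
    exact (hπ.diff _ hU).hasFDerivAt.comp_hasDerivAt v (hγ.hasDerivAt hv)
  have h3 := (HasFDerivAt.comp ((u, v) : ℝ × ℝ) h1.hasFDerivAt (hasFDerivAt_fst (𝕜 := ℝ))).sub
    (HasFDerivAt.comp ((u, v) : ℝ × ℝ) h2.hasFDerivAt (hasFDerivAt_snd (𝕜 := ℝ)))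
  have h4 := h3.congr_of_eventuallyEq hF
  have h0 : F (u, v) = 0 := by rw [hF.eq_of_nhds, h, sub_self]
  have key : SignType.sign (cross2 (D (velocity γ u)) (-D (velocity γ v)))
      = η * SignType.sign (det3 (γ u) (velocity γ v) (velocity γ u)) := by
    have e1 : cross2 (D (velocity γ u)) (-D (velocity γ v))
        = cross2 (D (velocity γ v)) (D (velocity γ u)) := by
      rw [cross2_eq, cross2_eq]
      simp
      ring
    rw [e1]
    refine hπ.cross _ hU _ _ ?_ (hγ.inner_velocity hu)
    rw [h]
    exact hγ.inner_velocity hv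
  have hne : SignType.sign (cross2 (D (velocity γ u)) (-D (velocity γ v))) ≠ 0 := by
    rw [key, mul_ne_zero_iff]
    refine ⟨hπ.ne_zero, ?_⟩
    rw [Ne, sign_eq_zero_iff, ← hp]
    exact hγ.det_ne_zero hu
  have h5 := hasIndex_of_hasFDerivAt hc h0 h4 (by
    rw [Ne, sign_eq_zero_iff] at hne
    simpa [cross2] using hne)
  convert! h5 using 1
  rw [eps, hp, ← SignType.coe_mul, ← key]
  simp [cross2]

/-- The argument principle for the difference of two subarcs of a generic curve. -/
theorem IsGeneric.boundaryChange_eq_arcSum (hγ : IsGeneric γ) {π : E3 → ℂ} {U : Set S2}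
    {η : SignType} (hπ : IsPlanarChart π U η) {F : ℝ × ℝ → ℂ} {a b c d : ℝ}
    (hab : a ≤ b) (hcd : c ≤ d) (hab1 : b - a ≤ 1) (hcd1 : d - c ≤ 1)
    (hne : ∀ u ∈ Ioo a b, ∀ v ∈ Ioo c d, (u : UnitAddCircle) ≠ v)
    (hF : ContinuousOn F (Icc a b ×ˢ Icc c d)) (hbd : ∀ p ∈ rectBoundary a b c d, F p ≠ 0)
    (hz : ∀ u ∈ Ioo a b, ∀ v ∈ Ioo c d,
      F (u, v) = 0 ↔ γ (u : UnitAddCircle) = γ (v : UnitAddCircle))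
    (hloc : ∀ u ∈ Ioo a b, ∀ v ∈ Ioo c d, γ (u : UnitAddCircle) = γ (v : UnitAddCircle) →
      γ (u : UnitAddCircle) ∈ U ∧
      F =ᶠ[𝓝 (u, v)] fun q => π (γ (q.1 : UnitAddCircle)) - π (γ (q.2 : UnitAddCircle))) :
    boundaryChange F a b c d = 2 * Real.pi * Complex.I * (((η : ℤ) * arcSum γ a b c d : ℤ) : ℂ) := by
  classical
  have inj1 : ∀ u ∈ Ioo a b, ∀ u' ∈ Ioo a b, (u : UnitAddCircle) = u' → u = u' :=
    fun u hu u' hu' h => coe_eq_coe_of_abs_lt (by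
      rw [abs_lt]; constructor <;> linarith [hu.1, hu.2, hu'.1, hu'.2]) h
  have inj2 : ∀ u ∈ Ioo c d, ∀ u' ∈ Ioo c d, (u : UnitAddCircle) = u' → u = u' :=
    fun u hu u' hu' h => coe_eq_coe_of_abs_lt (by
      rw [abs_lt]; constructor <;> linarith [hu.1, hu.2, hu'.1, hu'.2]) h
  -- The zeros. Neither interval is longer than a period, so a zero is determined by the class of
  -- its first time: the second time is the partner. This matches the zeros with the summands of
  -- `arcSum`.
  let S : Set (ℝ × ℝ) := {p | p ∈ Ioo a b ×ˢ Ioo c d ∧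
    γ (p.1 : UnitAddCircle) = γ (p.2 : UnitAddCircle)}
  have hpart : ∀ p ∈ S, partner γ (p.1 : UnitAddCircle) = p.2 := fun p hp =>
    hγ.partner_eq (hne _ hp.1.1 _ hp.1.2).symm hp.2.symm
  have hend : ∀ p ∈ S, (p.1 : UnitAddCircle) ∈ ends γ := fun p hp =>
    hγ.mem_ends_of_eq (hne _ hp.1.1 _ hp.1.2).symm hp.2.symm
  have hinj : InjOn (fun p : ℝ × ℝ => (p.1 : UnitAddCircle)) S := by
    intro p hp q hq hpq
    have h1 := inj1 _ hp.1.1 _ hq.1.1 hpq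
    refine Prod.ext h1 (inj2 _ hp.1.2 _ hq.1.2 ?_)
    rw [← hpart p hp, ← hpart q hq, h1]
  have hfin : S.Finite := Set.Finite.of_finite_image
    ((ends γ).finite_toSet.subset (by rintro _ ⟨p, hp, rfl⟩; exact hend p hp)) hinj
  have hmem : ∀ p, p ∈ hfin.toFinset ↔ p ∈ S := fun p => hfin.mem_toFinset
  rw [boundaryChange_eq_sum hab hcd hF hfin.toFinset ?_ ?_ ?_
    (fun p => (η : ℤ) * eps γ (p.1 : UnitAddCircle)) ?_]
  · congr 2
    rw [← Finset.mul_sum, arcSum, ← Finset.sum_filter]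
    congr 1
    refine Finset.sum_bij (fun p _ => (p.1 : UnitAddCircle)) ?_ ?_ ?_ ?_
    · intro p hp
      have hp := (hmem p).1 hp
      refine Finset.mem_filter.2 ⟨hend p hp, ⟨p.1, hp.1.1, rfl⟩, ⟨p.2, hp.1.2, (hpart p hp).symm⟩⟩
    · intro p hp q hq h
      exact hinj ((hmem p).1 hp) ((hmem q).1 hq) h
    · intro s hs
      obtain ⟨hs, ⟨u, hu, rfl⟩, ⟨v, hv, hv'⟩⟩ := Finset.mem_filter.1 hs
      refine ⟨(u, v), (hmem _).2 ⟨⟨hu, hv⟩, ?_⟩, rfl⟩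
      simp only
      rw [hv', apply_partner γ]
    · intro p _
      rfl
  · intro p hp h0
    have hpI : p ∈ Ioo a b ×ˢ Ioo c d := by
      by_contra hcon
      refine hbd p ⟨hp, ?_⟩ h0
      by_contra hcon'
      push Not at hcon'
      exact hcon ⟨⟨lt_of_le_of_ne hp.1.1 hcon'.1.symm, lt_of_le_of_ne hp.1.2 hcon'.2.1⟩,
        ⟨lt_of_le_of_ne hp.2.1 hcon'.2.2.1.symm, lt_of_le_of_ne hp.2.2 hcon'.2.2.2⟩⟩
    exact (hmem p).2 ⟨hpI, (hz _ hpI.1 _ hpI.2).1 h0⟩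
  · intro p hp
    exact ((hmem p).1 hp).1
  · intro p hp
    have hp := (hmem p).1 hp
    exact (hz _ hp.1.1 _ hp.1.2).2 hp.2
  · intro p hp
    have hp := (hmem p).1 hp
    obtain ⟨h1, h2⟩ := hloc _ hp.1.1 _ hp.1.2 hp.2
    refine hγ.hasIndex_crossing (u := p.1) (v := p.2) hπ (hne _ hp.1.1 _ hp.1.2) hp.2 h1 ?_ h2
    filter_upwards [(isOpen_Ioo.prod isOpen_Ioo).mem_nhds hp.1] with q hq
    exact hF.continuousAt (mem_of_superset ((isOpen_Ioo.prod isOpen_Ioo).mem_nhds hq)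
      (prod_mono Ioo_subset_Icc_self Ioo_subset_Icc_self))

lemma arcSum_eq_zero_of_boundaryChange {F : ℝ × ℝ → ℂ} {η : SignType} (hη : η ≠ 0) {a b c d : ℝ}
    (h : boundaryChange F a b c d
      = 2 * Real.pi * Complex.I * (((η : ℤ) * arcSum γ a b c d : ℤ) : ℂ))
    (h0 : boundaryChange F a b c d = 0) : arcSum γ a b c d = 0 := by
  rw [h0] at h
  have h1 := (mul_eq_zero.1 h.symm).resolve_left Complex.two_pi_I_ne_zero
  have h2 := (mul_eq_zero.1 (Int.cast_eq_zero.1 h1))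
  refine h2.resolve_left ?_
  rcases η with _ | _ | _
  · exact absurd rfl hη
  · decide
  · decide

end

/-! ### Tangent directions and missed points -/

/-- Two curves through a point with independent velocities do not meet arbitrarily close to this
point. -/
lemma not_linearIndependent_of_tendsto {ι : Type*} {l : Filter ι} [l.NeBot] {f g : ℝ → E3}
    {v w : E3} {s t : ℝ} {a b : ι → ℝ} (hf : HasDerivAt f v s) (hg : HasDerivAt g w t)
    (h0 : f s = g t) (ha : Tendsto a l (𝓝 s)) (hb : Tendsto b l (𝓝 t))
    (hab : ∀ᶠ i in l, f (a i) = g (b i)) (hne : ∀ᶠ i in l, a i ≠ s ∨ b i ≠ t) :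
    ¬ LinearIndependent ℝ ![v, w] := by
  intro hlin
  let L : ℝ × ℝ →ₗ[ℝ] E3 := (LinearMap.toSpanSingleton ℝ E3 v).coprod
    (LinearMap.toSpanSingleton ℝ E3 (-w))
  have hL : ∀ x y : ℝ, L (x, y) = x • v - y • w := fun x y => by
    simp [L, sub_eq_add_neg]
  have hker : LinearMap.ker L = ⊥ := by
    rw [LinearMap.ker_eq_bot']
    rintro ⟨x, y⟩ h
    rw [hL] at h
    have := LinearIndependent.pair_iff.1 hlin x (-y) (by rw [neg_smul, ← sub_eq_add_neg, h])
    ext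
    · exact this.1
    · simpa using this.2
  obtain ⟨K, hK, hanti⟩ := L.exists_antilipschitzWith hker
  have hbound : ∀ x y : ℝ, ‖((x, y) : ℝ × ℝ)‖ ≤ K * ‖x • v - y • w‖ := by
    intro x y
    have := hanti.le_mul_dist (x, y) 0
    rwa [dist_zero_right, map_zero, dist_zero_right, hL] at this
  -- Each curve deviates from its tangent by at most this fraction of the displacement `M`. Since x
  -- v - y w is bounded below by K⁻¹ times the displacement, M ≤ M / 2.
  have hc : (0 : ℝ) < (K : ℝ)⁻¹ / 4 := by positivity
  have e1 := ha.eventually (hf.isLittleO.def hc)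
  have e2 := hb.eventually (hg.isLittleO.def hc)
  obtain ⟨i, h1, h2, h3, h4⟩ := (e1.and (e2.and (hab.and hne))).exists
  have hi := hbound (a i - s) (b i - t)
  have hvw : (a i - s) • v - (b i - t) • w
      = (g (b i) - g t - (b i - t) • w) - (f (a i) - f s - (a i - s) • v) := by
    rw [h3, h0]; abel
  have hm1 : ‖a i - s‖ ≤ ‖((a i - s, b i - t) : ℝ × ℝ)‖ := le_max_left _ _
  have hm2 : ‖b i - t‖ ≤ ‖((a i - s, b i - t) : ℝ × ℝ)‖ := le_max_right _ _
  set M := ‖((a i - s, b i - t) : ℝ × ℝ)‖ with hM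
  have hn : ‖(a i - s) • v - (b i - t) • w‖ ≤ (K : ℝ)⁻¹ / 4 * M + (K : ℝ)⁻¹ / 4 * M := by
    rw [hvw]
    refine (norm_sub_le _ _).trans (add_le_add (h2.trans ?_) (h1.trans ?_))
    · exact mul_le_mul_of_nonneg_left hm2 hc.le
    · exact mul_le_mul_of_nonneg_left hm1 hc.le
  have hKpos : (0 : ℝ) < K := by exact_mod_cast hK
  have : M ≤ M / 2 := by
    refine hi.trans ((mul_le_mul_of_nonneg_left hn hKpos.le).trans_eq ?_)
    field_simp
    ring
  have hM0 : M = 0 := le_antisymm (by linarith) (norm_nonneg _)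
  rw [hM, norm_eq_zero, Prod.mk_eq_zero] at hM0
  rcases h4 with h4 | h4
  · exact h4 (sub_eq_zero.1 hM0.1)
  · exact h4 (sub_eq_zero.1 hM0.2)

/-- The representative of a time that is closest to `c`. -/
def liftNear (c : ℝ) (z : UnitAddCircle) : ℝ := AddCircle.equivIco 1 (c - 1 / 2) z

lemma coe_liftNear (c : ℝ) (z : UnitAddCircle) : ((liftNear c z : ℝ) : UnitAddCircle) = z :=
  AddCircle.coe_equivIco

lemma liftNear_coe {c u : ℝ} (h : |u - c| < 1 / 2) : liftNear c (u : UnitAddCircle) = u := by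
  rw [abs_lt] at h
  exact AddCircle.equivIco_coe_of_mem ⟨by linarith, by linarith⟩

lemma continuousAt_liftNear (c : ℝ) : ContinuousAt (liftNear c) (c : UnitAddCircle) := by
  refine continuousAt_subtype_val.comp (AddCircle.continuousAt_equivIco 1 (c - 1 / 2) ?_)
  intro h
  have := coe_eq_coe_of_abs_lt (by rw [sub_sub_cancel, abs_of_pos] <;> norm_num) h
  linarith

lemma liftNear_self (c : ℝ) : liftNear c (c : UnitAddCircle) = c := liftNear_coe (by simp)

lemma tendsto_liftNear {ι : Type*} {l : Filter ι} {z : ι → UnitAddCircle} {c : ℝ}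
    (h : Tendsto z l (𝓝 (c : UnitAddCircle))) : Tendsto (fun i => liftNear c (z i)) l (𝓝 c) := by
  have := (continuousAt_liftNear c).tendsto.comp h
  rwa [liftNear_self] at this

section

variable {γ : UnitAddCircle → S2}

lemma IsGeneric.linearIndependent (hγ : IsGeneric γ) {s : UnitAddCircle} (hs : s ∈ ends γ) :
    LinearIndependent ℝ ![velocity γ (partner γ s), velocity γ s] :=
  linearIndependent_of_det3 (hγ.det_ne_zero hs)

/-- A generic curve with a vertex does not fill the sphere. -/
lemma IsGeneric.exists_notMem_range (hγ : IsGeneric γ) {s : UnitAddCircle} (hs : s ∈ ends γ) :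
    ∃ N, N ∉ range γ := by
  by_contra hcon
  push Not at hcon
  set v := velocity γ (partner γ s) with hv
  set w := velocity γ s with hw
  have hlin := hγ.linearIndependent hs
  have hvt : inner ℝ (γ s : E3) v = 0 := by
    rw [← apply_partner γ s]; exact hγ.inner_velocity (hγ.partner_mem hs)
  have hwt : inner ℝ (γ s : E3) w = 0 := hγ.inner_velocity hs
  have hsum : v + w ≠ 0 := fun h => by
    have := LinearIndependent.pair_iff.1 hlin 1 1 (by simpa using h)
    exact one_ne_zero this.1
  -- A tangent direction between the two branches, parallel to neither. If the curve filled the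
  -- sphere it would meet the great circle in direction `u` at points tending to the vertex, and one
  -- of the branches would be tangent to `u`.
  set u : E3 := ‖v + w‖⁻¹ • (v + w) with hu
  have hun : ‖u‖ = 1 := by
    rw [hu, norm_smul, norm_inv, norm_norm, inv_mul_cancel₀ (norm_ne_zero_iff.2 hsum)]
  have hut : inner ℝ (γ s : E3) u = 0 := by
    rw [hu, inner_smul_right, inner_add_right, hvt, hwt]; simp
  let g : ℝ → E3 := fun r => Real.cos r • (γ s : E3) + Real.sin r • u
  have hgn : ∀ r, g r ∈ Metric.sphere (0 : E3) 1 := by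
    intro r
    rw [mem_sphere_zero_iff_norm, ← pow_left_inj₀ (norm_nonneg _) zero_le_one two_ne_zero,
      norm_add_sq_real, norm_smul, norm_smul, inner_smul_left, inner_smul_right, hut, hun,
      norm_eq_of_mem_sphere]
    simp
  have hg : HasDerivAt g u 0 := by
    have h1 := ((Real.hasDerivAt_cos 0).smul_const (γ s : E3)).add
      ((Real.hasDerivAt_sin 0).smul_const u)
    convert! h1 using 1
    simp
  have hg0 : g 0 = γ s := by simp [g]
  choose τ hτ using fun r : ℝ => hcon ⟨g r, hgn r⟩
  -- The chosen times `τ` need not depend continuously on `r`; along an ultrafilter they still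
  -- converge.
  let 𝒰 : Ultrafilter ℝ := Ultrafilter.of (𝓝[>] (0 : ℝ))
  have h𝒰 : (𝒰 : Filter ℝ) ≤ 𝓝[>] (0 : ℝ) := Ultrafilter.of_le _
  have h𝒰' : Tendsto id (𝒰 : Filter ℝ) (𝓝 (0 : ℝ)) := h𝒰.trans nhdsWithin_le_nhds
  obtain ⟨z, -, hz⟩ := isCompact_univ.ultrafilter_le_nhds (𝒰.map τ) (by simp)
  have hτz : Tendsto τ 𝒰 (𝓝 z) := hz
  have hγz : γ z = γ s := by
    have h1 : Tendsto (fun r => (γ (τ r) : E3)) 𝒰 (𝓝 (γ z)) :=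
      (continuous_subtype_val.comp hγ.continuous).continuousAt.tendsto.comp hτz
    have h2 : Tendsto (fun r => (γ (τ r) : E3)) 𝒰 (𝓝 (g 0)) := by
      simp only [hτ]
      exact hg.continuousAt.tendsto.comp h𝒰'
    rw [hg0] at h2
    exact Subtype.ext (tendsto_nhds_unique h1 h2)
  have hzend : z ∈ ends γ := by
    by_cases h : z = s
    · rwa [h]
    · exact hγ.mem_ends_of_eq (Ne.symm h) hγz.symm
  have key : ¬ LinearIndependent ℝ ![velocity γ z, u] := by
    rw [← coe_pos z] at hτz hzend ⊢
    refine not_linearIndependent_of_tendsto (l := 𝒰) (f := fun t : ℝ => (γ t : E3))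
      (a := fun r => liftNear (pos z) (τ r)) (b := id) (hγ.hasDerivAt hzend) hg ?_
      (tendsto_liftNear hτz) h𝒰' ?_ ?_
    · rw [coe_pos, hγz, hg0]
    · refine Eventually.of_forall fun r => ?_
      simp only [coe_liftNear, hτ, id]
    · filter_upwards [h𝒰 self_mem_nhdsWithin] with r hr
      exact Or.inr (ne_of_gt hr)
  have hindep : ∀ x y : ℝ, x • v + y • w = 0 → x = 0 ∧ y = 0 :=
    LinearIndependent.pair_iff.1 hlin
  have hc : ‖v + w‖⁻¹ ≠ 0 := inv_ne_zero (norm_ne_zero_iff.2 hsum)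
  apply key
  rw [LinearIndependent.pair_iff]
  intro x y hxy
  by_cases h : z = s
  · rw [h] at hxy
    have := hindep (y * ‖v + w‖⁻¹) (x + y * ‖v + w‖⁻¹) (by
      rw [← hxy, hu]; module)
    have hy : y = 0 := (mul_eq_zero.1 this.1).resolve_right hc
    exact ⟨by simpa [hy] using this.2, hy⟩
  · rw [← hγ.partner_eq h hγz] at hxy
    have := hindep (x + y * ‖v + w‖⁻¹) (y * ‖v + w‖⁻¹) (by
      rw [← hxy, hu]; module)
    have hy : y = 0 := (mul_eq_zero.1 this.2).resolve_right hc
    exact ⟨by simpa [hy] using this.1, hy⟩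

/-- A functional that separates the two branches at a crossing. -/
lemma exists_functional {A B : ℂ} (h : cross2 A B ≠ 0) : ∃ ℓ : ℂ →L[ℝ] ℝ, ℓ A = 1 ∧ ℓ B = -1 := by
  refine ⟨((B.im + A.im) / cross2 A B) • Complex.reCLM
    - ((B.re + A.re) / cross2 A B) • Complex.imCLM, ?_, ?_⟩
  · simp only [_root_.sub_apply, _root_.smul_apply, Complex.reCLM_apply, Complex.imCLM_apply,
      smul_eq_mul]
    field_simp
    rw [cross2_eq]
    ring
  · simp only [_root_.sub_apply, _root_.smul_apply, Complex.reCLM_apply, Complex.imCLM_apply,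
      smul_eq_mul]
    field_simp
    rw [cross2_eq]
    ring

lemma IsGeneric.eq_or_eq_of_apply_eq (hγ : IsGeneric γ) {s t v : ℝ} (hst : s < t) (hts : t < s + 1)
    (h : γ (s : UnitAddCircle) = γ (t : UnitAddCircle))
    (hv : γ (v : UnitAddCircle) = γ (s : UnitAddCircle)) (h1 : s ≤ v) (h2 : v ≤ s + 1) :
    v = s ∨ v = t ∨ v = s + 1 := by
  have hne : (s : UnitAddCircle) ≠ t := fun e =>
    hst.ne (coe_eq_coe_of_abs_lt (by rw [abs_lt]; constructor <;> linarith) e)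
  rcases hγ.double v s t hv h with e | e | e
  · rcases h2.eq_or_lt with h2 | h2
    · exact Or.inr (Or.inr h2)
    · exact Or.inl (coe_eq_coe_of_abs_lt (by rw [abs_lt]; constructor <;> linarith) e)
  · exact absurd e hne
  · exact Or.inr (Or.inl (coe_eq_coe_of_abs_lt (by rw [abs_lt]; constructor <;> linarith) e))

/-- The two loops into which a vertex divides a closed curve on the sphere cross each other with
total sign zero. -/
theorem IsGeneric.arcSum_loops (hγ : IsGeneric γ) {s t : ℝ} (hst : s < t) (hts : t < s + 1)
    (h : γ (s : UnitAddCircle) = γ (t : UnitAddCircle)) : arcSum γ s t t (s + 1) = 0 := by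
  have hne : (t : UnitAddCircle) ≠ s := fun e =>
    hst.ne' (coe_eq_coe_of_abs_lt (by rw [abs_lt]; constructor <;> linarith) e)
  have hs : (s : UnitAddCircle) ∈ ends γ := hγ.mem_ends_of_eq hne h.symm
  have ht : (t : UnitAddCircle) ∈ ends γ := hγ.mem_ends_of_eq hne.symm h
  have hpart : partner γ (s : UnitAddCircle) = t := hγ.partner_eq hne h.symm
  have hs1 : ((s + 1 : ℝ) : UnitAddCircle) = s := by simp
  obtain ⟨N, hN⟩ := hγ.exists_notMem_range hs
  obtain ⟨π, η, hπ⟩ := isPlanarChart_stereo N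
  have hU : ∀ z, γ z ∈ ({N}ᶜ : Set S2) := fun z hz => hN ⟨z, hz⟩
  let p : ℝ → ℂ := fun u => π (γ (u : UnitAddCircle))
  have hpc : Continuous p := by
    rw [continuous_iff_continuousAt]
    intro u
    have h1 : Continuous fun u : ℝ => (γ (u : UnitAddCircle) : E3) :=
      continuous_subtype_val.comp (hγ.continuous.comp (AddCircle.continuous_mk' 1))
    exact ContinuousAt.comp (f := fun u : ℝ => (γ (u : UnitAddCircle) : E3))
      (hπ.diff _ (hU u)).continuousAt h1.continuousAt
  have hp_iff : ∀ u v : ℝ, p u = p v ↔ γ (u : UnitAddCircle) = γ (v : UnitAddCircle) :=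
    fun u v => ⟨fun e => hπ.inj (hU _) (hU _) e, fun e => by simp only [p, e]⟩
  have hp1 : ∀ u, p (u + 1) = p u := fun u => by simp [p]
  set D := fderiv ℝ π (γ (s : UnitAddCircle)) with hD
  have hA : HasDerivAt p (D (velocity γ s)) s :=
    (hπ.diff _ (hU s)).hasFDerivAt.comp_hasDerivAt s (hγ.hasDerivAt hs)
  have hB : HasDerivAt p (D (velocity γ t)) t := by
    rw [hD, h]
    exact (hπ.diff _ (hU t)).hasFDerivAt.comp_hasDerivAt t (hγ.hasDerivAt ht)
  set A := D (velocity γ s)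
  set B := D (velocity γ t)
  have hcr : cross2 A B ≠ 0 := by
    have h1 := hπ.cross _ (hU s) (velocity γ s) (velocity γ t) (hγ.inner_velocity hs)
      (by rw [h]; exact hγ.inner_velocity ht)
    have h2 : SignType.sign (cross2 A B) ≠ 0 := by
      rw [h1, mul_ne_zero_iff]
      refine ⟨hπ.ne_zero, ?_⟩
      rw [Ne, sign_eq_zero_iff, det3_swap, neg_eq_zero, ← hpart]
      exact hγ.det_ne_zero hs
    rwa [Ne, sign_eq_zero_iff] at h2
  -- At the corners of the rectangle p(u) - p(v) vanishes and has to be perturbed. The values of `ℓ`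
  -- make `ψ` increase through zero at `s` and decrease through zero at `t`, so near the vertex the
  -- first loop has `ψ` positive and the second has `ψ` negative.
  obtain ⟨ℓ, hℓA, hℓB⟩ := exists_functional hcr
  let ψ : ℝ → ℝ := fun u => ℓ (p u - p s)
  have hpst : p s = p t := (hp_iff s t).2 h
  have hψs : HasDerivAt ψ 1 s := by
    rw [← hℓA]
    exact ℓ.hasFDerivAt.comp_hasDerivAt s (hA.sub_const _)
  have hψt : HasDerivAt ψ (-1) t := by
    rw [← hℓB]
    exact ℓ.hasFDerivAt.comp_hasDerivAt t (hB.sub_const _)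
  have sg1 := eventually_nhdsWithin_sign_eq_of_deriv_pos (f := ψ) (x₀ := s)
    (by rw [hψs.deriv]; exact one_pos) (by simp [ψ])
  have sg2 := eventually_nhdsWithin_sign_eq_of_deriv_neg (f := ψ) (x₀ := t)
    (by rw [hψt.deriv]; norm_num) (by simp [ψ, hpst])
  obtain ⟨δ₁, hδ₁, hs1'⟩ := Metric.eventually_nhds_iff.1 sg1
  obtain ⟨δ₂, hδ₂, hs2'⟩ := Metric.eventually_nhds_iff.1 sg2
  set δ := min δ₁ δ₂ / 2 with hδ
  have hδ0 : 0 < δ := by positivity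
  have hδ1 : δ < δ₁ := by have := min_le_left δ₁ δ₂; linarith
  have hδ2 : δ < δ₂ := by have := min_le_right δ₁ δ₂; linarith
  have near_s : ∀ u, |u - s| ≤ δ → SignType.sign (ψ u) = SignType.sign (u - s) := fun u hu =>
    hs1' (by rw [Real.dist_eq]; linarith)
  have near_t : ∀ u, |u - t| ≤ δ → SignType.sign (ψ u) = SignType.sign (t - u) := fun u hu =>
    hs2' (by rw [Real.dist_eq]; linarith)
  have near_s1 : ∀ u, |u - (s + 1)| ≤ δ → SignType.sign (ψ u) = SignType.sign (u - (s + 1)) := by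
    intro u hu
    have e1 : ψ (u - 1) = ψ u := by
      have := hp1 (u - 1)
      rw [sub_add_cancel] at this
      simp only [ψ, this]
    rw [← e1, near_s (u - 1) (by rwa [sub_sub, add_comm 1 s])]
    congr 1
    ring
  let m₁ : ℝ → ℝ := fun u => min |u - s| |u - t|
  let m₂ : ℝ → ℝ := fun v => min |v - t| |v - (s + 1)|
  have hm₁ : Continuous m₁ := by fun_prop
  have hm₂ : Continuous m₂ := by fun_prop
  have ψ_nonneg : ∀ u ∈ Icc s t, m₁ u ≤ δ → u = s ∨ u = t ∨ 0 < ψ u := by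
    intro u hu hm
    rcases hu.1.eq_or_lt with h1 | h1
    · exact Or.inl h1.symm
    rcases hu.2.eq_or_lt with h2 | h2
    · exact Or.inr (Or.inl h2)
    right; right
    rcases min_le_iff.1 hm with h' | h'
    · have := near_s u h'
      rw [sign_pos (sub_pos.2 h1)] at this
      exact sign_eq_one_iff.1 this
    · have := near_t u h'
      rw [sign_pos (sub_pos.2 h2)] at this
      exact sign_eq_one_iff.1 this
  have ψ_nonpos : ∀ v ∈ Icc t (s + 1), m₂ v ≤ δ → v = t ∨ v = s + 1 ∨ ψ v < 0 := by
    intro u hu hm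
    rcases hu.1.eq_or_lt with h1 | h1
    · exact Or.inl h1.symm
    rcases hu.2.eq_or_lt with h2 | h2
    · exact Or.inr (Or.inl h2)
    right; right
    rcases min_le_iff.1 hm with h' | h'
    · have := near_t u h'
      rw [sign_neg (sub_neg.2 h1)] at this
      exact sign_eq_neg_one_iff.1 this
    · have := near_s1 u h'
      rw [sign_neg (sub_neg.2 h2)] at this
      exact sign_eq_neg_one_iff.1 this
  have ψs : ψ s = 0 := by simp [ψ]
  have ψt : ψ t = 0 := by simp [ψ, hpst]
  have ψs1 : ψ (s + 1) = 0 := by simp [ψ, hp1]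
  have m₁s : m₁ s = 0 := by simp [m₁]
  have m₁t : m₁ t = 0 := by simp [m₁]
  have m₂t : m₂ t = 0 := by simp [m₂]
  have m₂s : m₂ (s + 1) = 0 := by simp [m₂]
  -- A bump supported near the four corners. It depends only on the distances from the ends of the
  -- two intervals, so it agrees on opposite edges.
  let ρ : ℝ × ℝ → ℝ := fun q => max 0 (δ - m₁ q.1) * max 0 (δ - m₂ q.2)
  have hρ0 : ∀ q, 0 ≤ ρ q := fun q => mul_nonneg (le_max_left _ _) (le_max_left _ _)
  let F : ℝ × ℝ → ℂ := fun q => p q.1 - p q.2 + (ρ q : ℝ) • A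
  have hFc : Continuous F := by
    have : Continuous ρ := by fun_prop
    fun_prop
  have hℓF : ∀ q, ℓ (F q) = ψ q.1 - ψ q.2 + ρ q := by
    intro q
    simp only [F, ψ, map_add, map_sub, map_smul, hℓA, smul_eq_mul]
    ring
  -- Near a corner `ψ` is nonnegative at `u` and nonpositive at `v`. Either one of these
  -- inequalities is strict or the point is the corner itself, where `ρ` is positive; so `ℓ (F (u,
  -- v))` is positive.
  have corner : ∀ u ∈ Icc s t, ∀ v ∈ Icc t (s + 1), m₁ u ≤ δ → m₂ v ≤ δ → F (u, v) ≠ 0 := by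
    intro u hu v hv hmu hmv h0
    have h1 := hℓF (u, v)
    rw [h0, map_zero] at h1
    have h2 := hρ0 (u, v)
    simp only at h1
    have d : ∀ x y : ℝ, x = 0 → y = 0 → 0 < max 0 (δ - x) * max 0 (δ - y) := by
      rintro x y rfl rfl
      rw [sub_zero, max_eq_right hδ0.le]
      positivity
    rcases ψ_nonneg u hu hmu with h3 | h3 | h3 <;> rcases ψ_nonpos v hv hmv with h4 | h4 | h4
    · have := d _ _ (h3 ▸ m₁s) (h4 ▸ m₂t)
      rw [h3, h4, ψs, ψt] at h1
      rw [h3, h4] at this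
      simp only [ρ] at h1
      linarith
    · have := d _ _ (h3 ▸ m₁s) (h4 ▸ m₂s)
      rw [h3, h4, ψs, ψs1] at h1
      rw [h3, h4] at this
      simp only [ρ] at h1
      linarith
    · rw [h3, ψs] at h1
      rw [h3] at h2
      linarith
    · have := d _ _ (h3 ▸ m₁t) (h4 ▸ m₂t)
      rw [h3, h4, ψt] at h1
      rw [h3, h4] at this
      simp only [ρ] at h1
      linarith
    · have := d _ _ (h3 ▸ m₁t) (h4 ▸ m₂s)
      rw [h3, h4, ψt, ψs1] at h1
      rw [h3, h4] at this
      simp only [ρ] at h1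
      linarith
    · rw [h3, ψt] at h1
      rw [h3] at h2
      linarith
    · rw [h4, ψt] at h1
      rw [h4] at h2
      linarith
    · rw [h4, ψs1] at h1
      rw [h4] at h2
      linarith
    · linarith
  have off : ∀ q : ℝ × ℝ, δ < m₁ q.1 ∨ δ < m₂ q.2 → F q = p q.1 - p q.2 := by
    intro q hq
    have : ρ q = 0 := by
      rcases hq with hq | hq
      · simp only [ρ]; rw [max_eq_left (by linarith), zero_mul]
      · simp only [ρ]; rw [max_eq_left (a := (0 : ℝ)) (b := δ - m₂ q.2) (by linarith), mul_zero]
    simp only [F, this, zero_smul, add_zero]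
  have offpt : ∀ u ∈ Icc s t, ∀ v ∈ Icc t (s + 1), F (u, v) = 0 →
      (δ < m₁ u ∨ δ < m₂ v) ∧ γ (u : UnitAddCircle) = γ (v : UnitAddCircle) := by
    intro u hu v hv h0
    have h1 : δ < m₁ u ∨ δ < m₂ v := by
      by_contra hcon
      push Not at hcon
      exact corner u hu v hv hcon.1 hcon.2 h0
    refine ⟨h1, (hp_iff u v).1 ?_⟩
    rw [off (u, v) h1] at h0
    exact sub_eq_zero.1 h0
  have offpt' : ∀ u ∈ Ioo s t, ∀ v ∈ Ioo t (s + 1),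
      γ (u : UnitAddCircle) = γ (v : UnitAddCircle) → δ < m₁ u ∨ δ < m₂ v := by
    intro u hu v hv huv
    by_contra hcon
    push Not at hcon
    have e := (hp_iff u v).2 huv
    rcases ψ_nonneg u ⟨hu.1.le, hu.2.le⟩ hcon.1 with h3 | h3 | h3
    · exact hu.1.ne' h3
    · exact hu.2.ne h3
    rcases ψ_nonpos v ⟨hv.1.le, hv.2.le⟩ hcon.2 with h4 | h4 | h4
    · exact hv.1.ne' h4
    · exact hv.2.ne h4
    simp only [ψ, e] at h3 h4
    linarith
  refine arcSum_eq_zero_of_boundaryChange hπ.ne_zero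
    (hγ.boundaryChange_eq_arcSum hπ (F := F) hst.le hts.le (by linarith) (by linarith) ?_
      hFc.continuousOn ?_ ?_ ?_) ?_
  · intro u hu v hv e
    have := coe_eq_coe_of_abs_lt (by rw [abs_lt]; constructor <;> linarith [hu.1, hu.2, hv.1, hv.2]) e
    linarith [hu.2, hv.1]
  · rintro ⟨u, v⟩ ⟨⟨hu, hv⟩, hb⟩ h0
    simp only at hu hv hb
    obtain ⟨h1, h2⟩ := offpt u hu v hv h0
    have hus : u = s ∨ u = t → v = t ∨ v = s + 1 := by
      intro hu'
      have e : γ (v : UnitAddCircle) = γ (s : UnitAddCircle) := by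
        rcases hu' with rfl | rfl
        · exact h2.symm
        · exact h2.symm.trans h.symm
      rcases hγ.eq_or_eq_of_apply_eq hst hts h e (hst.le.trans hv.1) hv.2 with h' | h' | h'
      · linarith [hv.1]
      · exact Or.inl h'
      · exact Or.inr h'
    have hvs : v = t ∨ v = s + 1 → u = s ∨ u = t := by
      intro hv'
      have e : γ (u : UnitAddCircle) = γ (s : UnitAddCircle) := by
        rcases hv' with rfl | rfl
        · exact h2.trans h.symm
        · rw [h2, hs1]
      rcases hγ.eq_or_eq_of_apply_eq hst hts h e hu.1 (hu.2.trans hts.le) with h' | h' | h'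
      · exact Or.inl h'
      · exact Or.inr h'
      · linarith [hu.2]
    have hboth : (u = s ∨ u = t) ∧ (v = t ∨ v = s + 1) := by
      rcases hb with hb | hb | hb | hb
      · exact ⟨Or.inl hb, hus (Or.inl hb)⟩
      · exact ⟨Or.inr hb, hus (Or.inr hb)⟩
      · exact ⟨hvs (Or.inl hb), Or.inl hb⟩
      · exact ⟨hvs (Or.inr hb), Or.inr hb⟩
    have mu : m₁ u = 0 := by rcases hboth.1 with rfl | rfl; exacts [m₁s, m₁t]
    have mv : m₂ v = 0 := by rcases hboth.2 with rfl | rfl; exacts [m₂t, m₂s]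
    rcases h1 with h1 | h1 <;> linarith
  · intro u hu v hv
    refine ⟨fun h0 => (offpt u ⟨hu.1.le, hu.2.le⟩ v ⟨hv.1.le, hv.2.le⟩ h0).2, fun e => ?_⟩
    rw [off (u, v) (offpt' u hu v hv e)]
    exact sub_eq_zero.2 ((hp_iff u v).2 e)
  · intro u hu v hv e
    refine ⟨hU _, ?_⟩
    have hev : ∀ᶠ q : ℝ × ℝ in 𝓝 (u, v), δ < m₁ q.1 ∨ δ < m₂ q.2 := by
      rcases offpt' u hu v hv e with h1 | h1
      · have : ContinuousAt (fun q : ℝ × ℝ => m₁ q.1) (u, v) := by fun_prop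
        exact (this.eventually (lt_mem_nhds h1)).mono fun q hq => Or.inl hq
      · have : ContinuousAt (fun q : ℝ × ℝ => m₂ q.2) (u, v) := by fun_prop
        exact (this.eventually (lt_mem_nhds h1)).mono fun q hq => Or.inr hq
    exact hev.mono fun q hq => off q hq
  -- Both subarcs are closed loops, so `F` agrees on opposite edges and their contributions cancel.
  · have e1 : (fun u => F (u, s + 1)) = fun u => F (u, t) := by
      funext u
      simp only [F, ρ, hp1, m₂s, m₂t, hpst]
    have e2 : (fun v => F (t, v)) = fun v => F (s, v) := by
      funext v
      simp only [F, ρ, m₁s, m₁t, hpst]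
    rw [boundaryChange, e1, e2]
    ring

end

/-! ### Independence of the basepoint -/

lemma exists_mem_Ioo_iff {a b : ℝ} (ha : 0 ≤ a) (hb : b ≤ 1) (z : UnitAddCircle) :
    (∃ u ∈ Ioo a b, (u : UnitAddCircle) = z) ↔ a < pos z ∧ pos z < b := by
  constructor
  · rintro ⟨u, hu, rfl⟩
    rwa [pos_coe (ha.trans hu.1.le) (hu.2.trans_le hb)]
  · intro h
    exact ⟨pos z, h, coe_pos z⟩

lemma exists_mem_Ioo_add_one_iff {a b : ℝ} (ha : 0 ≤ a) (hab : a < b) (hb : b < 1)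
    (z : UnitAddCircle) :
    (∃ u ∈ Ioo b (a + 1), (u : UnitAddCircle) = z) ↔ pos z < a ∨ b < pos z := by
  constructor
  · rintro ⟨u, hu, rfl⟩
    rcases lt_or_ge u 1 with h | h
    · right
      rw [pos_coe (by linarith [hu.1]) h]
      exact hu.1
    · left
      have e : ((u - 1 : ℝ) : UnitAddCircle) = u := by simp
      rw [← e, pos_coe (by linarith) (by linarith [hu.2])]
      linarith [hu.2]
  · rintro (h | h)
    · refine ⟨pos z + 1, ⟨?_, by linarith⟩, ?_⟩
      · linarith [pos_nonneg z]
      · rw [AddCircle.coe_add_period, coe_pos]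
    · exact ⟨pos z, ⟨h, by linarith [pos_lt_one z]⟩, coe_pos z⟩

/-- The same closed curve, with basepoint at time `c`. -/
def rotate (c : UnitAddCircle) (γ : UnitAddCircle → S2) : UnitAddCircle → S2 := fun t => γ (t + c)

lemma range_rotate (c : UnitAddCircle) (γ : UnitAddCircle → S2) :
    range (rotate c γ) = range γ :=
  (Equiv.addRight c).surjective.range_comp γ

lemma path_rotate (c : ℝ) (γ : UnitAddCircle → S2) :
    path (rotate c γ) = fun t => path γ (t + c) := by
  funext t
  simp [path, rotate]

lemma velocity_rotate (c : UnitAddCircle) (γ : UnitAddCircle → S2) (t : UnitAddCircle) :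
    velocity (rotate c γ) t = velocity γ (t + c) := by
  rw [← coe_pos t, ← coe_pos c, velocity_coe, path_rotate, deriv_comp_add_const, ← AddCircle.coe_add,
    velocity_coe]

section

variable {γ : UnitAddCircle → S2}

lemma IsGeneric.rotate (hγ : IsGeneric γ) (c : UnitAddCircle) : IsGeneric (rotate c γ) where
  continuous := hγ.continuous.comp (continuous_add_const c)
  finite_vertices := by
    refine hγ.finite_vertices.subset ?_
    rintro x ⟨s, t, hst, hs, ht⟩
    exact ⟨s + c, t + c, fun h => hst (add_right_cancel h), hs, ht⟩
  double r s t h1 h2 := by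
    simpa using hγ.double (r + c) (s + c) (t + c) h1 h2
  transverse s t hst h := by
    obtain ⟨c, rfl⟩ : ∃ c' : ℝ, (c' : UnitAddCircle) = c := ⟨pos c, coe_pos c⟩
    have := hγ.transverse (s + c) (t + c) (by simpa using hst) (by simpa [TangleFlip.rotate] using h)
    rw [path_rotate]
    rw [deriv_comp_add_const, deriv_comp_add_const]
    exact ⟨differentiableAt_comp_add_const.2 this.1, differentiableAt_comp_add_const.2 this.2.1,
      this.2.2⟩

lemma IsGeneric.mem_ends_rotate (hγ : IsGeneric γ) {c s : UnitAddCircle} :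
    s ∈ ends (TangleFlip.rotate c γ) ↔ s + c ∈ ends γ := by
  rw [(hγ.rotate c).mem_ends, hγ.mem_ends]
  constructor
  · rintro ⟨t, h1, h2⟩
    exact ⟨t + c, fun h => h1 (add_right_cancel h), h2⟩
  · rintro ⟨t, h1, h2⟩
    refine ⟨t - c, fun h => h1 (by rw [← h, sub_add_cancel]), ?_⟩
    simpa [TangleFlip.rotate] using h2

lemma IsGeneric.partner_rotate (hγ : IsGeneric γ) {c s : UnitAddCircle} (hs : s + c ∈ ends γ) :
    partner (TangleFlip.rotate c γ) s + c = partner γ (s + c) := by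
  have hs' := hγ.mem_ends_rotate.2 hs
  symm
  refine hγ.partner_eq (fun h => (hγ.rotate c).partner_ne hs' (add_right_cancel h)) ?_
  exact apply_partner (TangleFlip.rotate c γ) s

lemma IsGeneric.eps_rotate (hγ : IsGeneric γ) {c s : UnitAddCircle} (hs : s + c ∈ ends γ) :
    eps (TangleFlip.rotate c γ) s = eps γ (s + c) := by
  rw [eps, eps, velocity_rotate, velocity_rotate, hγ.partner_rotate hs]
  rfl

lemma pos_sub_of_le {s c : UnitAddCircle} (h : pos c ≤ pos s) : pos (s - c) = pos s - pos c := by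
  conv_lhs => rw [← coe_pos s, ← coe_pos c, ← AddCircle.coe_sub]
  exact pos_coe (by linarith) (by linarith [pos_lt_one s, pos_nonneg c])

lemma pos_sub_of_lt {s c : UnitAddCircle} (h : pos s < pos c) :
    pos (s - c) = pos s - pos c + 1 := by
  conv_lhs => rw [← coe_pos s, ← coe_pos c, ← AddCircle.coe_sub, ← AddCircle.coe_add_period]
  exact pos_coe (by linarith [pos_lt_one c, pos_nonneg s]) (by linarith)

-- This is `IsGeneric.arcSum_loops` in terms of positions in `[0, 1)`, where the loop through the
-- basepoint consists of two intervals. It supplies the hypothesis of `exitSum_eq_zero`.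
open Classical in
lemma IsGeneric.loop_sum_eq_zero (hγ : IsGeneric γ) {s : UnitAddCircle}
    (h : pos s < pos (partner γ s)) :
    ∑ t ∈ ends γ, (if pos s < pos t ∧ pos t < pos (partner γ s) ∧
      (pos (partner γ t) < pos s ∨ pos (partner γ s) < pos (partner γ t)) then eps γ t else 0)
      = 0 := by
  have h0 := pos_nonneg s
  have h1 := pos_lt_one (partner γ s)
  refine Eq.trans ?_ (hγ.arcSum_loops (s := pos s) (t := pos (partner γ s)) h (by linarith) (by
    rw [coe_pos, coe_pos, apply_partner γ]))
  refine Finset.sum_congr rfl fun t _ => ite_zero_congr ?_ rfl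
  rw [exists_mem_Ioo_iff h0 h1.le, exists_mem_Ioo_add_one_iff h0 h h1]
  tauto

/-- The defect does not depend on the basepoint. -/
theorem IsGeneric.defect_rotate (hγ : IsGeneric γ) (c : UnitAddCircle) :
    defect (TangleFlip.rotate c γ) = defect γ := by
  rw [(hγ.rotate c).defect_eq, hγ.defect_eq]
  congr 1
  have h1 := interSum_transfer (T := ends γ) (τ := partner γ) (ε := eps γ)
    (T' := ends (TangleFlip.rotate c γ)) (τ' := partner (TangleFlip.rotate c γ))
    (ε' := eps (TangleFlip.rotate c γ)) (k := fun s => s + c)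
    (fun s hs => hγ.mem_ends_rotate.1 hs) (fun s _ t _ h => add_right_cancel h)
    (fun s hs => ⟨s - c, hγ.mem_ends_rotate.2 (by simpa using hs), by simp⟩)
    (fun s hs => hγ.partner_rotate (hγ.mem_ends_rotate.1 hs))
    (fun s hs t ht => by
      rw [hγ.eps_rotate (hγ.mem_ends_rotate.1 hs), hγ.eps_rotate (hγ.mem_ends_rotate.1 ht)])
    (fun s => pos (s - c))
  simp only [add_sub_cancel_right] at h1
  rw [h1]
  symm
  -- With basepoint `c`, the block of ends before `c` is moved behind the others.
  refine interSum_swap (A := fun s => pos s < pos c) hγ.isChordDiagram ?_ ?_ ?_ ?_ ?_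
  · intro s _ t _ hs ht
    exact hs.trans_le (not_lt.1 ht)
  · intro s _ t _ hs ht
    rw [pos_sub_of_lt hs, pos_sub_of_le (not_lt.1 ht)]
    linarith [pos_lt_one t, pos_nonneg s]
  · intro s _ t _ hst
    by_cases hs : pos s < pos c
    · rw [pos_sub_of_lt hs, pos_sub_of_lt (hst.1 hs)]
      simp
    · rw [pos_sub_of_le (not_lt.1 hs), pos_sub_of_le (not_lt.1 fun h => hs (hst.2 h))]
      simp
  · exact exitSum_eq_zero hγ.isChordDiagram (fun s _ t _ u _ _ hu _ h => h.trans hu)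
      pos_injective.injOn fun s _ h => hγ.loop_sum_eq_zero h
  · exact exitSum_eq_zero hγ.isChordDiagram
      (fun s _ t _ u _ hs _ h _ => fun h' => hs (h.trans h'))
      pos_injective.injOn fun s _ h => hγ.loop_sum_eq_zero h

end

/-! ### Curves with the same image -/

/-- In a compact space every ultrafilter has a limit, so it suffices to identify the possible
limits. This yields continuity for arbitrary selections of preimages. -/
lemma tendsto_of_forall_ultrafilter {ι X : Type*} [TopologicalSpace X] [CompactSpace X]
    {l : Filter ι} {j : ι → X} {τ : X}
    (h : ∀ 𝒰 : Ultrafilter ι, (𝒰 : Filter ι) ≤ l → ∀ z, Tendsto j 𝒰 (𝓝 z) → z = τ) :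
    Tendsto j l (𝓝 τ) := by
  rw [tendsto_iff_ultrafilter]
  intro 𝒰 h𝒰
  obtain ⟨z, -, hz⟩ := isCompact_univ.ultrafilter_le_nhds (𝒰.map j) (by simp)
  have hz' : Tendsto j 𝒰 (𝓝 z) := hz
  exact h 𝒰 h𝒰 z hz' ▸ hz'

/-- A selection of preimages is continuous where the preimage is unique. -/
lemma tendsto_of_unique_fibre {ι X Y : Type*} [TopologicalSpace X] [CompactSpace X]
    [TopologicalSpace Y] [T2Space Y] {l : Filter ι} {β : X → Y} (hβ : Continuous β) {j : ι → X}
    {τ : X} (hτ : ∀ z, β z = β τ → z = τ) (h : Tendsto (fun i => β (j i)) l (𝓝 (β τ))) :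
    Tendsto j l (𝓝 τ) :=
  tendsto_of_forall_ultrafilter fun _ h𝒰 z hz =>
    hτ z (tendsto_nhds_unique (hβ.continuousAt.tendsto.comp hz) (h.mono_left h𝒰))

lemma liftNear_injective (c : ℝ) : Function.Injective (liftNear c) := fun s t h => by
  rw [← coe_liftNear c s, h, coe_liftNear]

lemma continuousAt_liftNear_of_ne {c : ℝ} {z : UnitAddCircle}
    (hz : z ≠ ((c - 1 / 2 : ℝ) : UnitAddCircle)) : ContinuousAt (liftNear c) z :=
  continuousAt_subtype_val.comp (AddCircle.continuousAt_equivIco 1 (c - 1 / 2) hz)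

lemma coe_ne_coe_sub_half (c : ℝ) : (c : UnitAddCircle) ≠ ((c - 1 / 2 : ℝ) : UnitAddCircle) := by
  intro h
  have := coe_eq_coe_of_abs_lt (by rw [sub_sub_cancel, abs_of_pos] <;> norm_num) h
  linarith

lemma neBot_nhdsNE (z : UnitAddCircle) : (𝓝[≠] z).NeBot := by
  rw [← coe_pos z]
  have h : Tendsto (fun u : ℝ => (u : UnitAddCircle)) (𝓝[≠] pos z) (𝓝[≠] (pos z : UnitAddCircle)) := by
    refine tendsto_nhdsWithin_iff.2
      ⟨(AddCircle.continuous_mk' 1).continuousAt.tendsto.mono_left nhdsWithin_le_nhds, ?_⟩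
    have h1 : ∀ᶠ u : ℝ in 𝓝 (pos z), |u - pos z| < 1 := by
      have : ContinuousAt (fun u : ℝ => |u - pos z|) (pos z) := by fun_prop
      exact this.eventually (gt_mem_nhds (by simp))
    filter_upwards [nhdsWithin_le_nhds h1, self_mem_nhdsWithin] with u hu hne e
    exact hne (coe_eq_coe_of_abs_lt hu e)
  exact h.neBot

/-- A continuous injective selection covers a neighbourhood. -/
lemma eventually_mem_image {j : UnitAddCircle → UnitAddCircle} {p : UnitAddCircle}
    {W : Set UnitAddCircle} (hW : W ∈ 𝓝 p) (hc : ∀ u ∈ W, ContinuousAt j u) (hinj : InjOn j W) :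
    ∀ᶠ t in 𝓝 (j p), t ∈ j '' W := by
  obtain ⟨p, rfl⟩ : ∃ p' : ℝ, (p' : UnitAddCircle) = p := ⟨pos p, coe_pos p⟩
  obtain ⟨c, hjc⟩ : ∃ c : ℝ, (c : UnitAddCircle) = j p := ⟨pos (j p), coe_pos _⟩
  have hpW := mem_of_mem_nhds hW
  have h1 : ∀ᶠ u : ℝ in 𝓝 p, (u : UnitAddCircle) ∈ W ∧
      j u ≠ ((c - 1 / 2 : ℝ) : UnitAddCircle) ∧ |u - p| < 1 / 2 := by
    have e1 : ContinuousAt (fun u : ℝ => (u : UnitAddCircle)) p :=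
      (AddCircle.continuous_mk' 1).continuousAt
    have e2 : ContinuousAt (fun u : ℝ => j u) p := ContinuousAt.comp (hc _ hpW) e1
    refine (e1.eventually hW).and ((e2.eventually_ne ?_).and ?_)
    · rw [← hjc]
      exact coe_ne_coe_sub_half c
    · have : ContinuousAt (fun u : ℝ => |u - p|) p := by fun_prop
      exact this.eventually (gt_mem_nhds (by simp))
  obtain ⟨δ, hδ, h2⟩ := Metric.eventually_nhds_iff.1 h1
  have h3 : ∀ u ∈ Icc (p - δ / 2) (p + δ / 2), (u : UnitAddCircle) ∈ W ∧
      j u ≠ ((c - 1 / 2 : ℝ) : UnitAddCircle) ∧ |u - p| < 1 / 2 := fun u hu => h2 (by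
    rw [Real.dist_eq, abs_lt]; constructor <;> linarith [hu.1, hu.2])
  -- A continuous injective real function on an interval is strictly monotone, so its values cover a
  -- neighbourhood of the value at an interior point.
  let f : ℝ → ℝ := fun u => liftNear c (j u)
  have hf : ContinuousOn f (Icc (p - δ / 2) (p + δ / 2)) := fun u hu =>
    (ContinuousAt.comp (f := fun u : ℝ => j u) (continuousAt_liftNear_of_ne (h3 u hu).2.1)
      (ContinuousAt.comp (hc _ (h3 u hu).1) (AddCircle.continuous_mk' 1).continuousAt)).continuousWithinAt
  have hfi : InjOn f (Icc (p - δ / 2) (p + δ / 2)) := fun u hu v hv h => by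
    refine coe_eq_coe_of_abs_lt ?_ (hinj (h3 u hu).1 (h3 v hv).1 (liftNear_injective c h))
    have a := abs_lt.1 (h3 u hu).2.2
    have b := abs_lt.1 (h3 v hv).2.2
    rw [abs_lt]
    constructor <;> linarith [a.1, a.2, b.1, b.2]
  have hfp : f p = c := by
    simp only [f]
    rw [← hjc, liftNear_self]
  have hle : p - δ / 2 ≤ p + δ / 2 := by linarith
  have m1 : p - δ / 2 ∈ Icc (p - δ / 2) (p + δ / 2) := ⟨le_refl _, hle⟩
  have m2 : p + δ / 2 ∈ Icc (p - δ / 2) (p + δ / 2) := ⟨hle, le_refl _⟩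
  have m0 : p ∈ Icc (p - δ / 2) (p + δ / 2) := ⟨by linarith, by linarith⟩
  have key : uIcc (f (p - δ / 2)) (f (p + δ / 2)) ∈ 𝓝 c := by
    rw [← hfp]
    rcases hf.strictMonoOn_of_injOn_Icc' hle hfi with hm | hm
    · rw [uIcc_of_le (hm m1 m2 (by linarith)).le]
      exact Icc_mem_nhds (hm m1 m0 (by linarith)) (hm m0 m2 (by linarith))
    · rw [uIcc_of_ge (hm m1 m2 (by linarith)).le]
      exact Icc_mem_nhds (hm m0 m2 (by linarith)) (hm m1 m0 (by linarith))
  rw [← hjc]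
  have h4 : ∀ᶠ t in 𝓝 (c : UnitAddCircle), liftNear c t ∈ uIcc (f (p - δ / 2)) (f (p + δ / 2)) := by
    refine (continuousAt_liftNear c).eventually ?_
    rw [liftNear_self]
    exact key
  filter_upwards [h4] with t ht
  obtain ⟨u, hu, hut⟩ := intermediate_value_uIcc (by rwa [uIcc_of_le hle]) ht
  rw [uIcc_of_le hle] at hu
  exact ⟨u, (h3 u hu).1, liftNear_injective c hut⟩

section

variable {α β : UnitAddCircle → S2}

lemma IsGeneric.finite_preimage (hγ : IsGeneric α) {X : Set S2} (hX : X.Finite) :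
    (α ⁻¹' X).Finite := by
  refine hX.preimage' fun x _ => ?_
  by_cases h : ∃ s, α s = x
  · obtain ⟨s, rfl⟩ := h
    refine (Set.toFinite {s, partner α s}).subset fun r hr => ?_
    by_cases hrs : r = s
    · exact Or.inl hrs
    · exact Or.inr (hγ.partner_eq hrs hr).symm
  · refine Set.finite_empty.subset fun r hr => h ⟨r, hr⟩

lemma eventually_notMem_sdiff (t : UnitAddCircle) {X : Set UnitAddCircle} (hX : X.Finite) :
    ∀ᶠ u in 𝓝 t, u ∉ X \ {t} :=
  (hX.subset sdiff_subset).isClosed.isOpen_compl.mem_nhds fun h => h.2 rfl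

/-- Near a point of the image at which `β` is injective, every passage of `α` covers the image of
`β`. -/
lemma IsGeneric.eventually_covered (hα : IsGeneric α) (hβ : IsGeneric β)
    (hr : range α = range β) {p τ : UnitAddCircle} (hpτ : α p = β τ) (hτ : τ ∉ ends β)
    {W : Set UnitAddCircle} (hW : W ∈ 𝓝 p) : ∀ᶠ t in 𝓝 τ, ∃ u ∈ W, α u = β t := by
  have hex : ∀ u, ∃ t, β t = α u := fun u => by
    have : α u ∈ range β := hr ▸ mem_range_self u
    exact this
  -- The selection sends a time of `α` to a time of `β` at the same point. Near `p` the fibre of `β`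
  -- is a single time, which gives continuity, and `α` meets no vertex except possibly at `p`, which
  -- gives injectivity; so the values of `j` cover a neighbourhood of `τ`.
  choose j hj using hex
  have uniq : ∀ t, t ∉ ends β → ∀ z, β z = β t → z = t := fun t ht z hz => by
    by_contra hne
    exact ht (hβ.mem_ends_of_eq hne hz)
  have hjp : j p = τ := uniq τ hτ _ ((hj p).trans hpτ)
  have h1 := eventually_notMem_sdiff p (hα.finite_preimage
    ((ends β).finite_toSet.image β))
  have h2 := eventually_notMem_sdiff p (ends α).finite_toSet
  have hj' : ∀ u, u ∉ α ⁻¹' (β '' ends β) \ {p} → j u ∉ ends β := by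
    intro u hu hju
    by_cases hup : u = p
    · rw [hup, hjp] at hju
      exact hτ hju
    · exact hu ⟨⟨j u, hju, hj u⟩, hup⟩
  have hc : ∀ u, u ∉ α ⁻¹' (β '' ends β) \ {p} → ContinuousAt j u := fun u hu =>
    tendsto_of_unique_fibre hβ.continuous (uniq _ (hj' u hu)) (by
      simp only [hj]
      exact hα.continuous.continuousAt)
  have h3 := eventually_mem_image (j := j) (p := p) (inter_mem hW (inter_mem h1 h2))
    (fun u hu => hc u hu.2.1) (by
      rintro u ⟨-, -, hu⟩ v ⟨-, -, hv⟩ huv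
      by_contra hne
      have e : α u = α v := by rw [← hj u, huv, hj v]
      have hu' : u = p := by
        by_contra hup
        exact hu ⟨hα.mem_ends_of_eq (Ne.symm hne) e.symm, hup⟩
      have hv' : v = p := by
        by_contra hup
        exact hv ⟨hα.mem_ends_of_eq hne e, hup⟩
      exact hne (hu'.trans hv'.symm))
  rw [hjp] at h3
  filter_upwards [h3] with t ht
  obtain ⟨u, hu, rfl⟩ := ht
  exact ⟨u, hu.1, (hj u).symm⟩

/-- Generic curves with the same image have the same vertices. -/
lemma IsGeneric.mem_ends_of_range_eq (hα : IsGeneric α) (hβ : IsGeneric β)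
    (hr : range α = range β) {p τ : UnitAddCircle} (hpτ : α p = β τ) (hp : p ∈ ends α) :
    τ ∈ ends β := by
  by_contra hτ
  have hne := hα.partner_ne hp
  -- If `β` passed only once, both passages of `α` would cover `β` near `τ`. Then all points `β t`
  -- near `β τ` would be vertices of `α`, of which there are finitely many.
  obtain ⟨U, V, hU, hV, hpU, hqV, hUV⟩ := t2_separation hne.symm
  have h1 := hα.eventually_covered hβ hr hpτ hτ (hU.mem_nhds hpU)
  have h2 := hα.eventually_covered hβ hr ((apply_partner α p).trans hpτ) hτ (hV.mem_nhds hqV)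
  have h3 := eventually_notMem_sdiff τ (hβ.finite_preimage ((ends α).finite_toSet.image α))
  have h4 : ∀ᶠ t in 𝓝[≠] τ, False := by
    filter_upwards [nhdsWithin_le_nhds h1, nhdsWithin_le_nhds h2, nhdsWithin_le_nhds h3,
      self_mem_nhdsWithin] with t ⟨u, hu, hut⟩ ⟨v, hv, hvt⟩ h3 htτ
    have hne : v ≠ u := fun h => disjoint_left.1 hUV hu (h ▸ hv)
    exact h3 ⟨⟨u, hα.mem_ends_of_eq hne (hvt.trans hut.symm), hut⟩, htτ⟩
  have := neBot_nhdsNE τ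
  exact h4.exists.elim fun _ h => h

/-- The passages of two curves through the same point along the same branch. -/
def SameBranch (α β : UnitAddCircle → S2) (t u : UnitAddCircle) : Prop :=
  α u = β t ∧ (t ∈ ends β → ¬ LinearIndependent ℝ ![velocity α u, velocity β t])

lemma IsGeneric.velocity_ne_zero (hα : IsGeneric α) {u : UnitAddCircle} (hu : u ∈ ends α) :
    velocity α u ≠ 0 :=
  (hα.linearIndependent hu).ne_zero 1

lemma not_linearIndependent_trans {v v' w : E3} (hw : w ≠ 0)
    (h : ¬ LinearIndependent ℝ ![v, w]) (h' : ¬ LinearIndependent ℝ ![v', w]) :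
    ¬ LinearIndependent ℝ ![v, v'] := by
  have key : ∀ x : E3, ¬ LinearIndependent ℝ ![x, w] → ∃ a : ℝ, a • w = x := fun x hx => by
    rw [LinearIndependent.pair_symm_iff, LinearIndependent.pair_iff' hw] at hx
    push Not at hx
    exact hx
  obtain ⟨a, rfl⟩ := key v h
  obtain ⟨b, rfl⟩ := key v' h'
  intro hl
  have := LinearIndependent.pair_iff.1 hl
  by_cases ha : a = 0
  · have := (this 1 0 (by simp [ha])).1
    exact one_ne_zero this
  · exact ha (by simpa using (this b (-a) (by module)).2)

/-- Two different passages of `α` through the point would have independent velocities, and cannot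
both be parallel to the velocity of `β`. -/
lemma IsGeneric.sameBranch_unique (hα : IsGeneric α) (hβ : IsGeneric β) (hr : range α = range β)
    {t u u' : UnitAddCircle} (h : SameBranch α β t u) (h' : SameBranch α β t u') : u = u' := by
  by_contra hne
  have hu : u' ∈ ends α := hα.mem_ends_of_eq hne (h.1.trans h'.1.symm)
  have ht : t ∈ ends β := hα.mem_ends_of_range_eq hβ hr h'.1 hu
  refine not_linearIndependent_trans (hβ.velocity_ne_zero ht) (h.2 ht) (h'.2 ht) ?_
  rw [← hα.partner_eq hne (h.1.trans h'.1.symm)]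
  exact hα.linearIndependent hu

lemma IsGeneric.sameBranch_symm (hα : IsGeneric α) (hβ : IsGeneric β) (hr : range α = range β)
    {t u : UnitAddCircle} (h : SameBranch α β t u) : SameBranch β α u t :=
  ⟨h.1.symm, fun hu => by
    rw [LinearIndependent.pair_symm_iff]
    exact h.2 (hα.mem_ends_of_range_eq hβ hr h.1 hu)⟩

/-- Limits of passages through the same points are passages along the same branch. -/
lemma IsGeneric.sameBranch_of_tendsto (hα : IsGeneric α) (hβ : IsGeneric β)
    (hr : range α = range β) {t z : UnitAddCircle} {l : Filter UnitAddCircle} [l.NeBot]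
    {j : UnitAddCircle → UnitAddCircle} (hl : l ≤ 𝓝[≠] t) (hj : ∀ t, α (j t) = β t)
    (hz : Tendsto j l (𝓝 z)) : SameBranch α β t z := by
  have hl' : Tendsto id l (𝓝 t) := hl.trans nhdsWithin_le_nhds
  have h0 : α z = β t := by
    have h1 := hα.continuous.continuousAt.tendsto.comp hz
    have h2 := hβ.continuous.continuousAt.tendsto.comp hl'
    refine tendsto_nhds_unique h1 (h2.congr fun i => ?_)
    simp [hj]
  refine ⟨h0, fun ht => ?_⟩
  have hz' : z ∈ ends α := hβ.mem_ends_of_range_eq hα hr.symm h0.symm ht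
  obtain ⟨z, rfl⟩ : ∃ z' : ℝ, (z' : UnitAddCircle) = z := ⟨pos z, coe_pos z⟩
  obtain ⟨t, rfl⟩ : ∃ t' : ℝ, (t' : UnitAddCircle) = t := ⟨pos t, coe_pos t⟩
  refine not_linearIndependent_of_tendsto (l := l) (hα.hasDerivAt hz') (hβ.hasDerivAt ht)
    (by rw [h0]) (tendsto_liftNear hz) (tendsto_liftNear hl') ?_ ?_
  · refine Eventually.of_forall fun i => ?_
    simp only [coe_liftNear, hj, id]
  · filter_upwards [hl self_mem_nhdsWithin] with i hi
    right
    intro e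
    apply hi
    rw [← coe_liftNear t i]
    exact congrArg _ e

/-- An arbitrary selection may take the wrong branch at `t` itself, but its limit along an
ultrafilter of punctured neighbourhoods lies on the right one. -/
lemma IsGeneric.exists_sameBranch (hα : IsGeneric α) (hβ : IsGeneric β) (hr : range α = range β)
    (t : UnitAddCircle) : ∃ u, SameBranch α β t u := by
  have hex : ∀ t, ∃ u, α u = β t := fun t => by
    have : β t ∈ range α := hr ▸ mem_range_self t
    exact this
  choose j hj using hex
  have := neBot_nhdsNE t
  let 𝒰 : Ultrafilter UnitAddCircle := Ultrafilter.of (𝓝[≠] t)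
  obtain ⟨z, -, hz⟩ := isCompact_univ.ultrafilter_le_nhds (𝒰.map j) (by simp)
  exact ⟨z, hα.sameBranch_of_tendsto hβ hr (l := 𝒰) (Ultrafilter.of_le _) hj hz⟩

/-- Two generic curves with the same image differ by a homeomorphism of the circle. -/
lemma IsGeneric.exists_reparam (hα : IsGeneric α) (hβ : IsGeneric β) (hr : range α = range β) :
    ∃ k : UnitAddCircle → UnitAddCircle, Continuous k ∧ Function.Bijective k ∧
      ∀ t, SameBranch α β t (k t) := by
  choose k hk using hα.exists_sameBranch hβ hr
  refine ⟨k, ?_, ⟨fun t t' h => ?_, fun u => ?_⟩, hk⟩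
  · rw [continuous_iff_continuousAt]
    intro t
    -- The branch is identified by nearby points different from `t`, hence punctured neighbourhoods.
    rw [continuousAt_iff_punctured_nhds]
    exact tendsto_of_forall_ultrafilter fun 𝒰 h𝒰 z hz => hα.sameBranch_unique hβ hr
      (hα.sameBranch_of_tendsto hβ hr h𝒰 (fun t => (hk t).1) hz) (hk t)
  · exact hβ.sameBranch_unique hα hr.symm (hα.sameBranch_symm hβ hr (hk t))
      (hα.sameBranch_symm hβ hr (h ▸ hk t'))
  · obtain ⟨t, ht⟩ := hβ.exists_sameBranch hα hr.symm u
    exact ⟨t, hα.sameBranch_unique hβ hr (hk t) (hβ.sameBranch_symm hα hr.symm ht)⟩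

/-- A reparametrization with increasing (`σ = 1`) or decreasing (`σ = -1`) parameter preserves or
reverses velocities. -/
lemma inner_nonneg_of_reparam {f : ℝ → ℝ} {g h : ℝ → E3} {v w : E3} {t σ : ℝ}
    (hg : HasDerivAt g v (f t)) (hh : HasDerivAt h w t) (hf : ContinuousAt f t)
    (hgh : ∀ᶠ s in 𝓝 t, g (f s) = h s) (hσ : ∀ᶠ s in 𝓝[>] t, 0 < σ * (f s - f t)) :
    0 ≤ σ * inner ℝ v w := by
  have hl : 𝓝[>] t ≤ 𝓝[≠] t := nhdsWithin_mono _ fun s (hs : t < s) => hs.ne'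
  have h1 : Tendsto (slope h t) (𝓝[>] t) (𝓝 w) := hh.tendsto_slope.mono_left hl
  have h2 : Tendsto (fun s => slope g (f t) (f s)) (𝓝[>] t) (𝓝 v) := by
    refine hg.tendsto_slope.comp (tendsto_nhdsWithin_iff.2
      ⟨hf.tendsto.mono_left nhdsWithin_le_nhds, ?_⟩)
    filter_upwards [hσ] with s hs e
    rw [mem_singleton_iff.1 e] at hs
    simp at hs
  have h3 := (h2.inner h1 (𝕜 := ℝ)).const_mul σ
  -- The slope of `h` is (f s - f t) / (s - t) times that of `g`. Before the limit the product is
  -- therefore a positive multiple of a squared norm.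
  refine ge_of_tendsto h3 ?_
  filter_upwards [hσ, nhdsWithin_le_nhds hgh, self_mem_nhdsWithin] with s h4 h5 h6
  have h7 : f s - f t ≠ 0 := fun e => by rw [e] at h4; simp at h4
  have h8 : (0 : ℝ) < s - t := sub_pos.2 h6
  have e : slope h t s = ((f s - f t) / (s - t)) • slope g (f t) (f s) := by
    rw [slope_def_module, slope_def_module, h5, hgh.self_of_nhds, smul_smul]
    congr 1
    field_simp
  rw [e, inner_smul_right]
  have : σ * ((f s - f t) / (s - t) * inner ℝ (slope g (f t) (f s)) (slope g (f t) (f s)))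
      = σ * (f s - f t) / (s - t) * inner ℝ (slope g (f t) (f s)) (slope g (f t) (f s)) := by ring
  rw [this]
  exact mul_nonneg (div_pos h4 h8).le real_inner_self_nonneg

lemma continuousAt_pos {z : UnitAddCircle} (hz : z ≠ 0) : ContinuousAt pos z :=
  continuousAt_subtype_val.comp (AddCircle.continuousAt_equivIco 1 0 (by simpa using hz))

lemma pos_pos {z : UnitAddCircle} (hz : z ≠ 0) : 0 < pos z := by
  refine lt_of_le_of_ne (pos_nonneg z) fun h => hz ?_
  rw [← coe_pos z, ← h]
  simp

/-- The reparametrization fixes the basepoint, which is not a vertex, and so is monotone on `(0,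
1)`. All velocities at vertices are rescaled by factors of one common sign, which leaves `eps`
unchanged, and the order of the ends is either preserved or reversed as a whole (`interSum_neg`). -/
lemma IsGeneric.defect_eq_of_range_eq_of_apply_zero (hα : IsGeneric α) (hβ : IsGeneric β)
    (hr : range α = range β) (h0 : α 0 = β 0) (hn : (0 : UnitAddCircle) ∉ ends β) :
    defect α = defect β := by
  obtain ⟨k, hkc, hkb, hk⟩ := hα.exists_reparam hβ hr
  have hends : ∀ t, t ∈ ends β ↔ k t ∈ ends α := fun t =>
    ⟨hβ.mem_ends_of_range_eq hα hr.symm (hk t).1.symm, hα.mem_ends_of_range_eq hβ hr (hk t).1⟩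
  have hk0 : k 0 = 0 := hα.sameBranch_unique hβ hr (hk 0) ⟨h0, fun h => absurd h hn⟩
  have hkne : ∀ t, t ≠ 0 → k t ≠ 0 := fun t ht h => ht (hkb.1 (h.trans hk0.symm))
  have hne0 : ∀ u ∈ Ioo (0 : ℝ) 1, (u : UnitAddCircle) ≠ 0 := fun u hu e => by
    have := pos_coe hu.1.le hu.2
    rw [e, ← AddCircle.coe_zero, pos_coe le_rfl one_pos] at this
    exact hu.1.ne this
  let f : ℝ → ℝ := fun u => pos (k u)
  have hfc : ∀ u ∈ Ioo (0 : ℝ) 1, ContinuousAt f u := fun u hu =>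
    ContinuousAt.comp (f := fun u : ℝ => k u) (continuousAt_pos (hkne _ (hne0 u hu)))
      (hkc.comp (AddCircle.continuous_mk' 1)).continuousAt
  have hfi : InjOn f (Ioo (0 : ℝ) 1) := fun u hu v hv h => by
    have h1 := hkb.1 (pos_injective h)
    rw [← pos_coe hu.1.le hu.2, h1, pos_coe hv.1.le hv.2]
  obtain ⟨σ, hσ, hmono⟩ : ∃ σ : ℝ, (σ = 1 ∨ σ = -1) ∧
      ∀ u ∈ Ioo (0 : ℝ) 1, ∀ v ∈ Ioo (0 : ℝ) 1, u < v → 0 < σ * (f v - f u) := by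
    rcases ContinuousOn.strictMonoOn_of_injOn_Ioo one_pos
      (fun u hu => (hfc u hu).continuousWithinAt) hfi with h | h
    · exact ⟨1, Or.inl rfl, fun u hu v hv huv => by linarith [h hu hv huv]⟩
    · exact ⟨-1, Or.inr rfl, fun u hu v hv huv => by linarith [h hu hv huv]⟩
  have hσ2 : σ * σ = 1 := by rcases hσ with rfl | rfl <;> norm_num
  have hmem : ∀ t ∈ ends β, pos t ∈ Ioo (0 : ℝ) 1 := fun t ht =>
    ⟨pos_pos fun h => hn (h ▸ ht), pos_lt_one t⟩
  have hvel : ∀ t ∈ ends β, ∃ c : ℝ, 0 < σ * c ∧ velocity β t = c • velocity α (k t) := by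
    intro t ht
    have hkt := (hends t).1 ht
    have hv := hα.velocity_ne_zero hkt
    have h1 := (hk t).2 ht
    rw [LinearIndependent.pair_iff' hv] at h1
    push Not at h1
    obtain ⟨c, hc⟩ := h1
    refine ⟨c, ?_, hc.symm⟩
    have hm := hmem t ht
    have e : ((f (pos t) : ℝ) : UnitAddCircle) = k t := by simp only [f, coe_pos]
    have h2 := inner_nonneg_of_reparam (f := f) (g := fun u : ℝ => (α u : E3))
      (h := fun u : ℝ => (β u : E3)) (v := velocity α (k t)) (w := velocity β t) (t := pos t)
      (σ := σ) (by rw [← e]; exact hα.hasDerivAt (by rwa [e]))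
      (by have := hβ.hasDerivAt (u := pos t) (by rwa [coe_pos]); rwa [coe_pos] at this)
      (hfc _ hm)
      (Eventually.of_forall fun s => by simp only [f, coe_pos]; rw [(hk s).1]) (by
        filter_upwards [self_mem_nhdsWithin, nhdsWithin_le_nhds (isOpen_Ioo.mem_nhds hm)]
          with s h1 h2
        exact hmono _ hm _ h2 h1)
    rw [← hc, inner_smul_right, real_inner_self_eq_norm_sq, ← mul_assoc] at h2
    have h3 : 0 < ‖velocity α (k t)‖ ^ 2 := by positivity
    have h4 : 0 ≤ σ * c := nonneg_of_mul_nonneg_left h2 h3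
    refine lt_of_le_of_ne h4 fun h5 => ?_
    have hc0 : c = 0 := by
      rcases mul_eq_zero.1 h5.symm with h | h
      · rw [h] at hσ2; norm_num at hσ2
      · exact h
    rw [hc0, zero_smul] at hc
    exact hβ.velocity_ne_zero ht hc.symm
  have hpart : ∀ t ∈ ends β, k (partner β t) = partner α (k t) := fun t ht => by
    refine (hα.partner_eq (fun h => hβ.partner_ne ht (hkb.1 h)) ?_).symm
    rw [(hk _).1, (hk t).1, apply_partner β]
  have heps : ∀ t ∈ ends β, eps β t = eps α (k t) := fun t ht => by
    obtain ⟨c, hc, e1⟩ := hvel t ht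
    obtain ⟨d, hd, e2⟩ := hvel _ (hβ.partner_mem ht)
    rw [eps, eps, e1, e2, det3_smul_smul, hpart t ht, (hk t).1, sign_mul, sign_pos, one_mul]
    have := mul_pos hd hc
    have e : σ * d * (σ * c) = σ * σ * (d * c) := by ring
    rwa [e, hσ2, one_mul] at this
  have htr := interSum_transfer (T := ends α) (τ := partner α) (ε := eps α)
    (T' := ends β) (τ' := partner β) (ε' := eps β) (k := k)
    (fun t ht => (hends t).1 ht) hkb.1.injOn (fun u hu => by
      obtain ⟨t, rfl⟩ := hkb.2 u
      exact ⟨t, (hends t).2 hu, rfl⟩) hpart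
    (fun s hs t ht => by rw [heps s hs, heps t ht]) pos
  rw [hα.defect_eq, hβ.defect_eq, ← htr]
  congr 1
  have hlt : ∀ s ∈ ends β, ∀ t ∈ ends β, pos s < pos t → 0 < σ * (pos (k t) - pos (k s)) := by
    intro s hs t ht h
    have := hmono _ (hmem s hs) _ (hmem t ht) h
    simpa only [f, coe_pos] using this
  have hiff : ∀ s ∈ ends β, ∀ t ∈ ends β, pos s < pos t ↔ 0 < σ * (pos (k t) - pos (k s)) := by
    intro s hs t ht
    refine ⟨hlt s hs t ht, fun h => ?_⟩
    rcases lt_trichotomy (pos s) (pos t) with h' | h' | h'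
    · exact h'
    · rw [pos_injective h'] at h
      simp at h
    · linarith [hlt t ht s hs h']
  rcases hσ with rfl | rfl
  · exact interSum_congr hβ.isChordDiagram fun s hs t ht => by
      rw [hiff s hs t ht]
      constructor <;> intro <;> linarith
  · rw [← interSum_neg hβ.isChordDiagram]
    exact interSum_congr hβ.isChordDiagram fun s hs t ht => by
      rw [hiff s hs t ht]
      constructor <;> intro <;> linarith

/-- The defect depends only on the image of the curve. -/
theorem IsGeneric.defect_eq_of_range_eq (hα : IsGeneric α) (hβ : IsGeneric β)
    (hr : range α = range β) : defect α = defect β := by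
  have hfin : ∃ t, t ∉ ends β := by
    have := neBot_nhdsNE 0
    have h := eventually_notMem_sdiff 0 (ends β).finite_toSet
    obtain ⟨t, h1, h2⟩ := ((h.filter_mono (nhdsWithin_le_nhds (s := {0}ᶜ))).and
      self_mem_nhdsWithin).exists
    exact ⟨t, fun h => h1 ⟨h, h2⟩⟩
  obtain ⟨t, ht⟩ := hfin
  obtain ⟨u, hu⟩ : β t ∈ range α := hr ▸ mem_range_self t
  -- Both basepoints are moved to a common point that is not a vertex.
  rw [← hα.defect_rotate u, ← hβ.defect_rotate t]
  refine (hα.rotate u).defect_eq_of_range_eq_of_apply_zero (hβ.rotate t) ?_ ?_ ?_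
  · rw [range_rotate, range_rotate, hr]
  · simp [TangleFlip.rotate, hu]
  · rw [hβ.mem_ends_rotate]
    simpa using ht

end

/-! ### Arcs in the disk -/

/-- Two numbers in a common open half-plane bounded by a line through 0 are not negative multiples
of each other. -/
lemma div_mem_slitPlane {w z₁ z₂ : ℂ} (h₁ : 0 < (w * z₁).re) (h₂ : 0 < (w * z₂).re) :
    z₁ / z₂ ∈ Complex.slitPlane := by
  have hz : z₂ ≠ 0 := by rintro rfl; simp at h₂
  by_contra h
  rw [Complex.mem_slitPlane_iff, not_or, not_lt, not_not] at h
  have e : z₁ = ((z₁ / z₂).re : ℂ) * z₂ := by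
    have : z₁ / z₂ = ((z₁ / z₂).re : ℂ) := Complex.ext rfl (by simp [h.2])
    rw [← this, div_mul_cancel₀ _ hz]
  rw [e, mul_left_comm, Complex.re_ofReal_mul] at h₁
  nlinarith [h.1]

/-- The image of a point of the sphere in the unit disk, by normalization and orthogonal
projection. -/
def diskPoint (Ψ : DiskChart) (x : S2) : ℂ := planar (Ψ x : E3)

lemma continuous_diskPoint (Ψ : DiskChart) : Continuous (diskPoint Ψ) :=
  planar.continuous.comp (continuous_subtype_val.comp Ψ.continuous)

lemma normSq_diskPoint (Ψ : DiskChart) (x : S2) :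
    Complex.normSq (diskPoint Ψ x) = 1 - height Ψ x ^ 2 := by
  rw [Complex.normSq_apply, diskPoint, planar_re, planar_im, height]
  linarith [sphere_sq (Ψ x)]

lemma diskPoint_injOn (Ψ : DiskChart) {e : ℝ} :
    InjOn (diskPoint Ψ) {x | 0 ≤ e * height Ψ x ∧ e ≠ 0} := by
  rintro x ⟨hx, he⟩ y ⟨hy, -⟩ h
  have h1 := normSq_diskPoint Ψ x
  rw [h, normSq_diskPoint] at h1
  have h2 : (e * height Ψ x) ^ 2 = (e * height Ψ y) ^ 2 := by
    rw [mul_pow, mul_pow]; linear_combination e ^ 2 * h1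
  have h3 : height Ψ x = height Ψ y :=
    mul_left_cancel₀ he ((pow_left_inj₀ hx hy two_ne_zero).1 h2)
  refine Ψ.injective (Subtype.ext (PiLp.ext fun i => ?_))
  fin_cases i
  · simpa [diskPoint, planar_re] using congrArg Complex.re h
  · simpa [diskPoint, planar_im] using congrArg Complex.im h
  · exact h3

/-- A point of the closed unit disk lies on the inner side of the tangent at another point of the
unit circle. -/
lemma tangent_lt {P z : ℂ} (hP : Complex.normSq P = 1) (hz : Complex.normSq z ≤ 1) (h : z ≠ P) :
    0 < (starRingEnd ℂ P * (P - z)).re := by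
  have h1 : 0 < Complex.normSq (P - z) := Complex.normSq_pos.2 (sub_ne_zero.2 h.symm)
  rw [Complex.normSq_apply] at h1 hP hz
  simp only [Complex.mul_re, Complex.conj_re, Complex.conj_im, Complex.sub_re, Complex.sub_im] at h1 ⊢
  nlinarith

section

variable {γ : UnitAddCircle → S2} {Ψ : DiskChart}

/-- Two arcs in a hemisphere do not cross, up to signs, if their difference can be compared with a
function without zeros. -/
lemma IsGeneric.arcSum_eq_zero_of_compare (hγ : IsGeneric γ) {e : ℝ} (he : e = 1 ∨ e = -1)
    {a b c d : ℝ} (hab : a ≤ b) (hcd : c ≤ d) (hdisj : (b ≤ c ∧ d ≤ a + 1) ∨ (d ≤ a ∧ b ≤ c + 1))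
    (h1 : ∀ u ∈ Ioo a b, 0 < e * height Ψ (γ (u : UnitAddCircle)))
    (h2 : ∀ u ∈ Ioo c d, 0 < e * height Ψ (γ (u : UnitAddCircle)))
    {G : ℝ × ℝ → ℂ} (hG : Continuous G) (hG0 : ∀ q ∈ Icc a b ×ˢ Icc c d, G q ≠ 0)
    (hFG : ∀ q ∈ rectBoundary a b c d, (diskPoint Ψ (γ (q.1 : UnitAddCircle))
      - diskPoint Ψ (γ (q.2 : UnitAddCircle))) / G q ∈ Complex.slitPlane) :
    arcSum γ a b c d = 0 := by
  obtain ⟨η, hη⟩ := isPlanarChart_hemisphere Ψ he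
  let F : ℝ × ℝ → ℂ := fun q => diskPoint Ψ (γ (q.1 : UnitAddCircle))
    - diskPoint Ψ (γ (q.2 : UnitAddCircle))
  have hp : Continuous fun u : ℝ => diskPoint Ψ (γ (u : UnitAddCircle)) :=
    (continuous_diskPoint Ψ).comp (hγ.continuous.comp (AddCircle.continuous_mk' 1))
  have hF : Continuous F := (hp.comp continuous_fst).sub (hp.comp continuous_snd)
  have he0 : e ≠ 0 := by rcases he with rfl | rfl <;> norm_num
  refine arcSum_eq_zero_of_boundaryChange hη.ne_zero (hγ.boundaryChange_eq_arcSum hη (F := F) hab hcd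
    (by rcases hdisj with h | h <;> linarith) (by rcases hdisj with h | h <;> linarith) ?_
    hF.continuousOn ?_ ?_ ?_) ?_
  · intro u hu v hv h
    have h' : u = v := coe_eq_coe_of_abs_lt (by
      rw [abs_lt]
      rcases hdisj with h | h <;> constructor <;> linarith [hu.1, hu.2, hv.1, hv.2]) h
    rcases hdisj with h | h <;> linarith [hu.1, hu.2, hv.1, hv.2]
  · intro q hq h0
    have := hFG q hq
    rw [show diskPoint Ψ (γ (q.1 : UnitAddCircle)) - diskPoint Ψ (γ (q.2 : UnitAddCircle)) = 0
      from h0, zero_div] at this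
    exact Complex.zero_notMem_slitPlane this
  · intro u hu v hv
    refine ⟨fun h => diskPoint_injOn Ψ (e := e) ⟨(h1 u hu).le, he0⟩ ⟨(h2 v hv).le, he0⟩
      (sub_eq_zero.1 h), fun h => ?_⟩
    simp only [F, h, sub_self]
  · intro u hu v hv _
    refine ⟨h1 u hu, Eventually.of_forall fun q => ?_⟩
    simp only [F, diskPoint, homExt_coe]
  · rw [boundaryChange_of_div hab hcd hF.continuousOn hG.continuousOn (fun q hq => hG0 q hq.1) hFG]
    exact boundaryChange_eq_zero hab hcd hG.continuousOn hG0

/-- A loop in the disk and an arc that joins two points of the boundary cross with total sign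
zero. -/
lemma IsGeneric.arcSum_loop_arc (hγ : IsGeneric γ) {e : ℝ} (he : e = 1 ∨ e = -1)
    {s t c d : ℝ} (hst : s < t) (hcd : c ≤ d) (hdisj : (t ≤ c ∧ d ≤ s + 1) ∨ (d ≤ s ∧ t ≤ c + 1))
    (hloop : γ (s : UnitAddCircle) = γ (t : UnitAddCircle))
    (h1 : ∀ u ∈ Icc s t, 0 < e * height Ψ (γ (u : UnitAddCircle)))
    (h2 : ∀ u ∈ Ioo c d, 0 < e * height Ψ (γ (u : UnitAddCircle)))
    (hc : height Ψ (γ (c : UnitAddCircle)) = 0) (hd : height Ψ (γ (d : UnitAddCircle)) = 0) :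
    arcSum γ s t c d = 0 := by
  have he0 : e ≠ 0 := by rcases he with rfl | rfl <;> norm_num
  have hp : Continuous fun u : ℝ => diskPoint Ψ (γ (u : UnitAddCircle)) :=
    (continuous_diskPoint Ψ).comp (hγ.continuous.comp (AddCircle.continuous_mk' 1))
  have hs0 := h1 s ⟨le_rfl, hst.le⟩
  have ht0 := h1 t ⟨hst.le, le_rfl⟩
  have hv0 : ∀ v ∈ Icc c d, 0 ≤ e * height Ψ (γ (v : UnitAddCircle)) := by
    intro v hv
    rcases hv.1.eq_or_lt with h | h
    · rw [← h, hc, mul_zero]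
    rcases hv.2.eq_or_lt with h' | h'
    · rw [h', hd, mul_zero]
    exact (h2 v ⟨h, h'⟩).le
  -- The arc avoids the base of the loop, because the curve passes through a double point only at
  -- the times `s` and `t`.
  have hG0 : ∀ v ∈ Icc c d, diskPoint Ψ (γ (s : UnitAddCircle)) ≠ diskPoint Ψ (γ (v : UnitAddCircle)) := by
    intro v hv h
    have h3 : γ (s : UnitAddCircle) = γ (v : UnitAddCircle) :=
      diskPoint_injOn Ψ (e := e) ⟨hs0.le, he0⟩ ⟨hv0 v hv, he0⟩ h
    have hvc : v ≠ c := by rintro rfl; rw [h3, hc, mul_zero] at hs0; exact hs0.false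
    have hvd : v ≠ d := by rintro rfl; rw [h3, hd, mul_zero] at hs0; exact hs0.false
    have l1 := lt_of_le_of_ne hv.1 hvc.symm
    have l2 := lt_of_le_of_ne hv.2 hvd
    rcases hγ.double v s t h3.symm hloop with h | h | h
    · have : v = s := coe_eq_coe_of_abs_lt (by
        rw [abs_lt]; rcases hdisj with h | h <;> constructor <;> linarith) h
      rcases hdisj with h | h <;> linarith
    · have : s = t := coe_eq_coe_of_abs_lt (by
        rw [abs_lt]; rcases hdisj with h | h <;> constructor <;> linarith) h
      linarith
    · have : v = t := coe_eq_coe_of_abs_lt (by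
        rw [abs_lt]; rcases hdisj with h | h <;> constructor <;> linarith) h
      rcases hdisj with h | h <;> linarith
  have hedge : ∀ u ∈ Icc s t, ∀ v : ℝ, height Ψ (γ (v : UnitAddCircle)) = 0 →
      0 < (-starRingEnd ℂ (diskPoint Ψ (γ (v : UnitAddCircle))) * (diskPoint Ψ (γ (u : UnitAddCircle))
        - diskPoint Ψ (γ (v : UnitAddCircle)))).re := by
    intro u hu v hv
    rw [neg_mul, ← mul_neg, neg_sub]
    have hu0 := h1 u hu
    refine tangent_lt (by rw [normSq_diskPoint, hv]; norm_num) ?_ fun h => ?_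
    · rw [normSq_diskPoint]; nlinarith [sq_nonneg (height Ψ (γ (u : UnitAddCircle)))]
    · have := diskPoint_injOn Ψ (e := e) ⟨hu0.le, he0⟩
        ⟨(by rw [hv, mul_zero]), he0⟩ h
      rw [this, hv, mul_zero] at hu0
      exact hu0.false
  -- The loop is compared with the constant loop at its base. For `u` an end of the loop the two
  -- differences agree. For `v` an end of the arc, the whole loop lies on the inner side of the
  -- tangent of the unit circle at that end.
  refine hγ.arcSum_eq_zero_of_compare he hst.le hcd hdisj
    (fun u hu => h1 u (Ioo_subset_Icc_self hu)) h2 (Ψ := Ψ)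
    (G := fun q => diskPoint Ψ (γ (s : UnitAddCircle)) - diskPoint Ψ (γ (q.2 : UnitAddCircle)))
    (continuous_const.sub (hp.comp continuous_snd))
    (fun q hq => sub_ne_zero.2 (hG0 q.2 hq.2)) ?_
  rintro ⟨u, v⟩ ⟨⟨hu, hv⟩, hb⟩
  simp only at hu hv hb ⊢
  have hss : s ∈ Icc s t := ⟨le_rfl, hst.le⟩
  rcases hb with rfl | rfl | rfl | rfl
  · rw [div_self (sub_ne_zero.2 (hG0 v hv))]
    exact Complex.one_mem_slitPlane
  · rw [← hloop, div_self (sub_ne_zero.2 (hG0 v hv))]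
    exact Complex.one_mem_slitPlane
  · exact div_mem_slitPlane (hedge u hu v hc) (hedge s hss v hc)
  · exact div_mem_slitPlane (hedge u hu v hd) (hedge s hss v hd)

/-- Twice the signed area of a triangle. -/
def orient (P Q R : ℂ) : ℝ := cross2 (Q - P) (R - P)

lemma orient_eq (P Q R : ℂ) : orient P Q R
    = (Q.re - P.re) * (R.im - P.im) - (Q.im - P.im) * (R.re - P.re) := by
  rw [orient, cross2_eq]
  simp

/-- Three points of a circle are not collinear. -/
lemma orient_ne_zero {P Q R : ℂ} (hP : Complex.normSq P = 1) (hQ : Complex.normSq Q = 1)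
    (hR : Complex.normSq R = 1) (hPQ : P ≠ Q) (hPR : P ≠ R) (hQR : Q ≠ R) : orient P Q R ≠ 0 := by
  rw [orient_eq]
  intro h
  rw [Complex.normSq_apply] at hP hQ hR
  have hd : 0 < (Q.re - P.re) ^ 2 + (Q.im - P.im) ^ 2 := by
    have := Complex.normSq_pos.2 (sub_ne_zero.2 hPQ.symm)
    rw [Complex.normSq_apply] at this
    simp only [Complex.sub_re, Complex.sub_im] at this
    linarith
  set dx := Q.re - P.re with hdx
  set dy := Q.im - P.im with hdy
  set fx := R.re - P.re with hfx
  set fy := R.im - P.im with hfy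
  -- If the points were collinear then R = P + m (Q - P), and a line meets the circle only where m
  -- (m - 1) = 0.
  set m := (dx * fx + dy * fy) / (dx ^ 2 + dy ^ 2) with hm
  have e1 : fx = m * dx := by
    rw [hm, div_mul_eq_mul_div, eq_div_iff hd.ne']
    linear_combination (-dy) * h
  have e2 : fy = m * dy := by
    rw [hm, div_mul_eq_mul_div, eq_div_iff hd.ne']
    linear_combination dx * h
  have q1 : 2 * (P.re * dx + P.im * dy) + (dx ^ 2 + dy ^ 2) = 0 := by
    rw [hdx, hdy]; linear_combination hQ - hP
  have q2 : 2 * (P.re * fx + P.im * fy) + (fx ^ 2 + fy ^ 2) = 0 := by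
    rw [hfx, hfy]; linear_combination hR - hP
  have q3 : (dx ^ 2 + dy ^ 2) * (m * (m - 1)) = 0 := by
    rw [e1, e2] at q2
    linear_combination q2 - m * q1
  rcases mul_eq_zero.1 ((mul_eq_zero.1 q3).resolve_left hd.ne') with h0 | h0
  · apply hPR
    rw [h0, zero_mul] at e1 e2
    exact Complex.ext (by linarith) (by linarith)
  · apply hQR
    rw [sub_eq_zero.1 h0, one_mul] at e1 e2
    exact Complex.ext (by linarith) (by linarith)

/-- The affine parametrization of a segment on `[a, b]`. -/
def segmentMap (a b : ℝ) (P Q : ℂ) (u : ℝ) : ℂ := P + (((u - a) / (b - a) : ℝ) : ℂ) * (Q - P)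

lemma continuous_segmentMap (a b : ℝ) (P Q : ℂ) : Continuous (segmentMap a b P Q) := by
  unfold segmentMap
  fun_prop

lemma orient_segmentMap (a b : ℝ) (P Q R S : ℂ) (u : ℝ) : orient R S (segmentMap a b P Q u)
    = (1 - (u - a) / (b - a)) * orient R S P + (u - a) / (b - a) * orient R S Q := by
  simp only [orient_eq, segmentMap, Complex.add_re, Complex.add_im, Complex.re_ofReal_mul,
    Complex.im_ofReal_mul, Complex.sub_re, Complex.sub_im]
  ring

lemma segmentMap_left (a b : ℝ) (P Q : ℂ) : segmentMap a b P Q a = P := by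
  simp [segmentMap]

lemma segmentMap_right {a b : ℝ} (hab : a < b) (P Q : ℂ) : segmentMap a b P Q b = Q := by
  have : b - a ≠ 0 := (sub_pos.2 hab).ne'
  simp [segmentMap, div_self this]

lemma tangent_segmentMap {a b u : ℝ} (hab : a < b) (hu : u ∈ Icc a b) {P Q R : ℂ}
    (hP : 0 < (starRingEnd ℂ R * (R - P)).re) (hQ : 0 < (starRingEnd ℂ R * (R - Q)).re) :
    0 < (starRingEnd ℂ R * (R - segmentMap a b P Q u)).re := by
  have hm0 : 0 ≤ (u - a) / (b - a) := div_nonneg (sub_nonneg.2 hu.1) (sub_pos.2 hab).le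
  have hm1 : (u - a) / (b - a) ≤ 1 := (div_le_one (sub_pos.2 hab)).2 (by linarith [hu.2])
  set m := (u - a) / (b - a) with hm
  have e : (starRingEnd ℂ R * (R - segmentMap a b P Q u)).re
      = (1 - m) * (starRingEnd ℂ R * (R - P)).re + m * (starRingEnd ℂ R * (R - Q)).re := by
    simp only [segmentMap, ← hm, Complex.mul_re, Complex.sub_re, Complex.sub_im, Complex.add_re,
      Complex.add_im, Complex.mul_im, Complex.ofReal_re, Complex.ofReal_im]
    ring
  rw [e]
  rcases hm0.eq_or_lt with h | h
  · rw [← h]; linarith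
  · have := mul_pos h hQ
    have := mul_nonneg (sub_nonneg.2 hm1) hP.le
    linarith

lemma affine_ne_zero {x y m : ℝ} (h : 0 < x * y) (hm0 : 0 ≤ m) (hm1 : m ≤ 1) :
    (1 - m) * x + m * y ≠ 0 := by
  intro h0
  have hx : x ≠ 0 := by rintro rfl; simp at h
  have : (1 - m) * (x * x) + m * (x * y) = 0 := by linear_combination x * h0
  have h1 : 0 < x * x := mul_self_pos.2 hx
  nlinarith [mul_nonneg (sub_nonneg.2 hm1) h1.le, mul_nonneg hm0 h.le]

/-- Two arcs in the disk whose ends do not separate each other on the boundary cross with total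
sign zero. -/
lemma IsGeneric.arcSum_of_chords (hγ : IsGeneric γ) {e : ℝ} (he : e = 1 ∨ e = -1)
    {a b c d : ℝ} {P Q R S : ℂ} (hab : a < b) (hcd : c < d) (hbc : b ≤ c) (hda : d ≤ a + 1)
    (h1 : ∀ u ∈ Ioo a b, 0 < e * height Ψ (γ (u : UnitAddCircle)))
    (h2 : ∀ u ∈ Ioo c d, 0 < e * height Ψ (γ (u : UnitAddCircle)))
    (hP : diskPoint Ψ (γ (a : UnitAddCircle)) = P) (hQ : diskPoint Ψ (γ (b : UnitAddCircle)) = Q)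
    (hR : diskPoint Ψ (γ (c : UnitAddCircle)) = R) (hS : diskPoint Ψ (γ (d : UnitAddCircle)) = S)
    (nP : Complex.normSq P = 1) (nQ : Complex.normSq Q = 1) (nR : Complex.normSq R = 1)
    (nS : Complex.normSq S = 1) (hPR : P ≠ R) (hPS : P ≠ S) (hQR : Q ≠ R) (hQS : Q ≠ S)
    (hor : 0 < orient P Q R * orient P Q S ∨ 0 < orient R S P * orient R S Q) :
    arcSum γ a b c d = 0 := by
  have he2 : e ^ 2 = 1 := by rcases he with rfl | rfl <;> norm_num
  let p : ℝ → ℂ := fun u => diskPoint Ψ (γ (u : UnitAddCircle))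
  let A := segmentMap a b P Q
  let B := segmentMap c d R S
  have hle : ∀ u, Complex.normSq (p u) ≤ 1 := fun u => by
    rw [normSq_diskPoint]
    nlinarith [sq_nonneg (height Ψ (γ (u : UnitAddCircle)))]
  have hlt : ∀ u : ℝ, 0 < e * height Ψ (γ (u : UnitAddCircle)) → Complex.normSq (p u) < 1 := fun u hu => by
    rw [normSq_diskPoint]
    have := pow_pos hu 2
    rw [mul_pow, he2, one_mul] at this
    linarith
  have ne1 : ∀ u ∈ Icc a b, ∀ Z, Complex.normSq Z = 1 → P ≠ Z → Q ≠ Z → p u ≠ Z := by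
    intro u hu Z hZ h3 h4 h5
    rcases hu.1.eq_or_lt with h | h
    · subst h; exact h3 (hP.symm.trans h5)
    rcases hu.2.eq_or_lt with h' | h'
    · subst h'; exact h4 (hQ.symm.trans h5)
    have := hlt u (h1 u ⟨h, h'⟩)
    rw [h5, hZ] at this
    exact this.false
  have ne2 : ∀ u ∈ Icc c d, ∀ Z, Complex.normSq Z = 1 → R ≠ Z → S ≠ Z → p u ≠ Z := by
    intro u hu Z hZ h3 h4 h5
    rcases hu.1.eq_or_lt with h | h
    · subst h; exact h3 (hR.symm.trans h5)
    rcases hu.2.eq_or_lt with h' | h'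
    · subst h'; exact h4 (hS.symm.trans h5)
    have := hlt u (h2 u ⟨h, h'⟩)
    rw [h5, hZ] at this
    exact this.false
  have tg1 : ∀ v ∈ Icc c d, ∀ Z, Complex.normSq Z = 1 → R ≠ Z → S ≠ Z →
      (Z - p v) / (Z - B v) ∈ Complex.slitPlane := fun v hv Z hZ h3 h4 =>
    div_mem_slitPlane (tangent_lt hZ (hle v) (ne2 v hv Z hZ h3 h4))
      (tangent_segmentMap hcd hv (tangent_lt hZ nR.le h3) (tangent_lt hZ nS.le h4))
  have tg2 : ∀ u ∈ Icc a b, ∀ Z, Complex.normSq Z = 1 → P ≠ Z → Q ≠ Z →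
      (p u - Z) / (A u - Z) ∈ Complex.slitPlane := fun u hu Z hZ h3 h4 => by
    rw [← neg_sub Z (p u), ← neg_sub Z (A u), neg_div_neg_eq]
    exact div_mem_slitPlane (tangent_lt hZ (hle u) (ne1 u hu Z hZ h3 h4))
      (tangent_segmentMap hab hu (tangent_lt hZ nP.le h3) (tangent_lt hZ nQ.le h4))
  -- The arcs are compared with their chords, which are disjoint because by `hor` the ends of one
  -- lie strictly on the same side of the line through the other. On every edge of the rectangle one
  -- of the two points is an end on the unit circle, and arc and chord of the other both lie on the
  -- inner side of the tangent there.
  refine hγ.arcSum_eq_zero_of_compare he hab.le hcd.le (Or.inl ⟨hbc, hda⟩) h1 h2 (Ψ := Ψ)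
    (G := fun q => A q.1 - B q.2)
    (((continuous_segmentMap _ _ _ _).comp continuous_fst).sub
      ((continuous_segmentMap _ _ _ _).comp continuous_snd)) ?_ ?_
  · rintro ⟨u, v⟩ ⟨hu, hv⟩ h0
    simp only at hu hv
    have hAB : A u = B v := sub_eq_zero.1 h0
    have hm0 : 0 ≤ (u - a) / (b - a) := div_nonneg (sub_nonneg.2 hu.1) (sub_pos.2 hab).le
    have hm1 : (u - a) / (b - a) ≤ 1 := (div_le_one (sub_pos.2 hab)).2 (by linarith [hu.2])
    have hn0 : 0 ≤ (v - c) / (d - c) := div_nonneg (sub_nonneg.2 hv.1) (sub_pos.2 hcd).le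
    have hn1 : (v - c) / (d - c) ≤ 1 := (div_le_one (sub_pos.2 hcd)).2 (by linarith [hv.2])
    have z1 : orient P Q (A u) = 0 := by
      simp only [A]
      rw [orient_segmentMap, orient_eq, orient_eq]
      ring
    have z2 : orient R S (B v) = 0 := by
      simp only [B]
      rw [orient_segmentMap, orient_eq, orient_eq]
      ring
    rcases hor with h | h
    · rw [hAB] at z1
      simp only [B] at z1
      rw [orient_segmentMap] at z1
      exact affine_ne_zero h hn0 hn1 z1
    · rw [← hAB] at z2
      simp only [A] at z2
      rw [orient_segmentMap] at z2
      exact affine_ne_zero h hm0 hm1 z2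
  · rintro ⟨u, v⟩ ⟨⟨hu, hv⟩, hb⟩
    simp only at hu hv hb ⊢
    rcases hb with rfl | rfl | rfl | rfl
    · rw [hP]
      simp only [A, segmentMap_left]
      exact tg1 v hv P nP hPR.symm hPS.symm
    · rw [hQ]
      simp only [A, segmentMap_right hab]
      exact tg1 v hv Q nQ hQR.symm hQS.symm
    · rw [hR]
      simp only [B, segmentMap_left]
      exact tg2 u hu R nR hPR hQR
    · rw [hS]
      simp only [B, segmentMap_right hcd]
      exact tg2 u hu S nS hPS hQS

/-- A closed curve that meets `σ` exactly at the times `0 < b < c < d < 1`, off its vertices, and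
is inside the disk on `(0, b)` and `(c, d)`, outside on `(b, c)` and `(d, 1)`. -/
structure IsNormalTangle (γ : UnitAddCircle → S2) (Ψ : DiskChart) (b c d : ℝ) : Prop where
  b_pos : 0 < b
  b_lt : b < c
  c_lt : c < d
  d_lt : d < 1
  height_zero : height Ψ (γ ((0 : ℝ) : UnitAddCircle)) = 0
  height_b : height Ψ (γ (b : UnitAddCircle)) = 0
  height_c : height Ψ (γ (c : UnitAddCircle)) = 0
  height_d : height Ψ (γ (d : UnitAddCircle)) = 0
  inside₁ : ∀ u ∈ Ioo 0 b, 0 < height Ψ (γ (u : UnitAddCircle))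
  outside₁ : ∀ u ∈ Ioo b c, height Ψ (γ (u : UnitAddCircle)) < 0
  inside₂ : ∀ u ∈ Ioo c d, 0 < height Ψ (γ (u : UnitAddCircle))
  outside₂ : ∀ u ∈ Ioo d 1, height Ψ (γ (u : UnitAddCircle)) < 0
  off : ∀ s ∈ ends γ, height Ψ (γ s) ≠ 0

section

variable {b c d : ℝ}

lemma IsNormalTangle.inside_outside_iff (h : IsNormalTangle γ Ψ b c d) (s : UnitAddCircle) :
    (0 < height Ψ (γ s) ↔ (0 < pos s ∧ pos s < b) ∨ (c < pos s ∧ pos s < d)) ∧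
      (height Ψ (γ s) < 0 ↔ (b < pos s ∧ pos s < c) ∨ d < pos s) := by
  have h0 := pos_nonneg s
  have h1 := pos_lt_one s
  have hb := h.b_pos
  have hbc := h.b_lt
  have hcd := h.c_lt
  have hd := h.d_lt
  obtain ⟨u, hu⟩ : ∃ u, u = pos s := ⟨_, rfl⟩
  rw [← coe_pos s, ← hu]
  rw [← hu] at h0 h1
  have k1 := h.inside₁ u
  have k2 := h.outside₁ u
  have k3 := h.inside₂ u
  have k4 := h.outside₂ u
  have z0 : u = 0 → height Ψ (γ (u : UnitAddCircle)) = 0 := by rintro rfl; exact h.height_zero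
  have z1 : u = b → height Ψ (γ (u : UnitAddCircle)) = 0 := by rintro rfl; exact h.height_b
  have z2 : u = c → height Ψ (γ (u : UnitAddCircle)) = 0 := by rintro rfl; exact h.height_c
  have z3 : u = d → height Ψ (γ (u : UnitAddCircle)) = 0 := by rintro rfl; exact h.height_d
  simp only [mem_Ioo] at k1 k2 k3 k4
  have l1 := lt_trichotomy u b
  have l2 := lt_trichotomy u c
  have l3 := lt_trichotomy u d
  have l0 := lt_trichotomy u 0
  rw [pos_coe h0 h1]
  constructor <;> grind

lemma IsNormalTangle.inside_iff (h : IsNormalTangle γ Ψ b c d) (s : UnitAddCircle) :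
    0 < height Ψ (γ s) ↔ (0 < pos s ∧ pos s < b) ∨ (c < pos s ∧ pos s < d) :=
  (h.inside_outside_iff s).1

lemma IsNormalTangle.outside_iff (h : IsNormalTangle γ Ψ b c d) (s : UnitAddCircle) :
    height Ψ (γ s) < 0 ↔ (b < pos s ∧ pos s < c) ∨ d < pos s :=
  (h.inside_outside_iff s).2

/-- Points of `σ` at different times project to different points of the unit circle. -/
lemma IsGeneric.diskPoint_ne (hγ : IsGeneric γ) (hoff : ∀ s ∈ ends γ, height Ψ (γ s) ≠ 0)
    {u v : ℝ} (hu : height Ψ (γ (u : UnitAddCircle)) = 0)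
    (hv : height Ψ (γ (v : UnitAddCircle)) = 0) (huv : u < v) (h1 : v < u + 1) :
    diskPoint Ψ (γ (u : UnitAddCircle)) ≠ diskPoint Ψ (γ (v : UnitAddCircle)) := by
  intro h
  have h2 : γ (u : UnitAddCircle) = γ (v : UnitAddCircle) :=
    diskPoint_injOn Ψ (e := 1) ⟨by rw [hu, mul_zero], one_ne_zero⟩ ⟨by rw [hv, mul_zero], one_ne_zero⟩ h
  have hne : (v : UnitAddCircle) ≠ u := fun e => by
    have := coe_eq_coe_of_abs_lt (by rw [abs_lt]; constructor <;> linarith) e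
    linarith
  exact hoff _ (hγ.mem_ends_of_eq hne h2.symm) hu

/-- The strands inside cross each other, or the strands outside do, with total sign zero. -/
lemma IsNormalTangle.arcSum_mul_arcSum (h : IsNormalTangle γ Ψ b c d) (hγ : IsGeneric γ) :
    arcSum γ 0 b c d * arcSum γ b c d 1 = 0 := by
  have hb := h.b_pos
  have hbc := h.b_lt
  have hcd := h.c_lt
  have hd := h.d_lt
  have e1 : γ ((1 : ℝ) : UnitAddCircle) = γ ((0 : ℝ) : UnitAddCircle) := by
    rw [AddCircle.coe_period, AddCircle.coe_zero]
  have nn : ∀ u : ℝ, height Ψ (γ (u : UnitAddCircle)) = 0 →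
      Complex.normSq (diskPoint Ψ (γ (u : UnitAddCircle))) = 1 := fun u hu => by
    rw [normSq_diskPoint, hu]; norm_num
  obtain ⟨P, hP⟩ : ∃ P, diskPoint Ψ (γ ((0 : ℝ) : UnitAddCircle)) = P := ⟨_, rfl⟩
  obtain ⟨Q, hQ⟩ : ∃ P, diskPoint Ψ (γ (b : UnitAddCircle)) = P := ⟨_, rfl⟩
  obtain ⟨R, hR⟩ : ∃ P, diskPoint Ψ (γ (c : UnitAddCircle)) = P := ⟨_, rfl⟩
  obtain ⟨S, hS⟩ : ∃ P, diskPoint Ψ (γ (d : UnitAddCircle)) = P := ⟨_, rfl⟩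
  have nP := nn 0 h.height_zero
  have nQ := nn b h.height_b
  have nR := nn c h.height_c
  have nS := nn d h.height_d
  have hPQ := hγ.diskPoint_ne h.off h.height_zero h.height_b hb (by linarith)
  have hPR := hγ.diskPoint_ne h.off h.height_zero h.height_c (by linarith) (by linarith)
  have hPS := hγ.diskPoint_ne h.off h.height_zero h.height_d (by linarith) (by linarith)
  have hQR := hγ.diskPoint_ne h.off h.height_b h.height_c hbc (by linarith)
  have hQS := hγ.diskPoint_ne h.off h.height_b h.height_d (by linarith) (by linarith)
  have hRS := hγ.diskPoint_ne h.off h.height_c h.height_d hcd (by linarith)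
  rw [hP] at nP hPQ hPR hPS
  rw [hQ] at nQ hPQ hQR hQS
  rw [hR] at nR hPR hQR hRS
  rw [hS] at nS hPS hQS hRS
  have hP1 : diskPoint Ψ (γ ((1 : ℝ) : UnitAddCircle)) = P := by rw [e1, hP]
  have o1 := orient_ne_zero nP nQ nR hPQ hPR hQR
  have o2 := orient_ne_zero nP nQ nS hPQ hPS hQS
  have o3 := orient_ne_zero nR nS nP hRS hPR.symm hPS.symm
  have o4 := orient_ne_zero nR nS nQ hRS hQR.symm hQS.symm
  -- Twice the signed area of the quadrilateral PQRS, cut along either diagonal.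
  have o5 : orient P Q R + orient R S P = orient P Q S + orient R S Q := by
    simp only [orient_eq]; ring
  have o6 : orient Q R P = orient P Q R := by simp only [orient_eq]; ring
  have o7 : orient Q R S = orient R S Q := by simp only [orient_eq]; ring
  -- If the chords PQ and RS do not separate each other's ends, the strands inside have crossing
  -- number zero. Otherwise `o5` fixes the signs: P and S lie on the same side of QR, and the
  -- strands outside have crossing number zero.
  by_cases hor : 0 < orient P Q R * orient P Q S ∨ 0 < orient R S P * orient R S Q
  · rw [hγ.arcSum_of_chords (e := 1) (Or.inl rfl) hb hcd hbc.le (by linarith)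
      (fun u hu => by rw [one_mul]; exact h.inside₁ u hu)
      (fun u hu => by rw [one_mul]; exact h.inside₂ u hu) hP hQ hR hS nP nQ nR nS hPR hPS hQR hQS
      hor, zero_mul]
  · push Not at hor
    have k1 := lt_of_le_of_ne hor.1 (mul_ne_zero o1 o2)
    have k2 := lt_of_le_of_ne hor.2 (mul_ne_zero o3 o4)
    have k3 : 0 < orient Q R S * orient Q R P := by
      rw [o6, o7]
      rcases mul_neg_iff.1 k1 with ⟨x, y⟩ | ⟨x, y⟩ <;> rcases mul_neg_iff.1 k2 with ⟨z, w⟩ | ⟨z, w⟩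
      · linarith
      · exact mul_pos w x
      · exact mul_pos_of_neg_of_neg w x
      · linarith
    rw [hγ.arcSum_of_chords (e := -1) (Or.inr rfl) hbc hd hcd.le (by linarith)
      (fun u hu => by linarith [h.outside₁ u hu])
      (fun u hu => by linarith [h.outside₂ u hu]) hQ hR hS hP1 nQ nR nS nP hQS hPQ.symm hRS hPR.symm
      (Or.inl k3), mul_zero]

end

end

/-! ### Separating the inside from the outside -/

section ChordDiagram

variable {ι : Type*} {T : Finset ι} {τ : ι → ι} {ε : ι → ℤ}

open Classical in
lemma pairSum_filter (I : ι → Prop) (P : ι → ι → Prop) :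
    pairSum (T.filter I) ε P = pairSum T ε fun s t => I s ∧ I t ∧ P s t := by
  unfold pairSum
  rw [Finset.sum_filter]
  refine Finset.sum_congr rfl fun s _ => ?_
  by_cases hs : I s
  · rw [if_pos hs, Finset.sum_filter]
    refine Finset.sum_congr rfl fun t _ => ?_
    by_cases ht : I t <;> simp [hs, ht]
  · simp [hs]

open Classical in
lemma pairSum_mul (P Q : ι → Prop) : pairSum T ε (fun s t => P s ∧ Q t)
    = (∑ s ∈ T, if P s then ε s else 0) * ∑ t ∈ T, if Q t then ε t else 0 := by
  unfold pairSum
  rw [Finset.sum_mul_sum]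
  refine Finset.sum_congr rfl fun s _ => Finset.sum_congr rfl fun t _ => ?_
  by_cases hs : P s <;> by_cases ht : Q t <;> simp [hs, ht]

open Classical in
lemma IsChordDiagram.filter (h : IsChordDiagram T τ ε) {I : ι → Prop}
    (hI : ∀ s ∈ T, I s → I (τ s)) : IsChordDiagram (T.filter I) τ ε where
  mem s hs := by
    rw [Finset.mem_filter] at hs ⊢
    exact ⟨h.mem s hs.1, hI s hs.1 hs.2⟩
  invol s hs := h.invol s (Finset.mem_filter.1 hs).1
  anti s hs := h.anti s (Finset.mem_filter.1 hs).1

end ChordDiagram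

section

variable {γ : UnitAddCircle → S2} {Ψ : DiskChart} {b c d : ℝ}

open Classical in
/-- The vertex times inside the disk. -/
def insideEnds (γ : UnitAddCircle → S2) (Ψ : DiskChart) : Finset UnitAddCircle :=
  (ends γ).filter fun s => 0 < height Ψ (γ s)

open Classical in
/-- The vertex times outside the disk. -/
def outsideEnds (γ : UnitAddCircle → S2) (Ψ : DiskChart) : Finset UnitAddCircle :=
  (ends γ).filter fun s => height Ψ (γ s) < 0

lemma mem_insideEnds {s : UnitAddCircle} :
    s ∈ insideEnds γ Ψ ↔ s ∈ ends γ ∧ 0 < height Ψ (γ s) := by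
  simp [insideEnds]

lemma mem_outsideEnds {s : UnitAddCircle} :
    s ∈ outsideEnds γ Ψ ↔ s ∈ ends γ ∧ height Ψ (γ s) < 0 := by
  simp [outsideEnds]

lemma IsGeneric.isChordDiagram_inside (hγ : IsGeneric γ) (Ψ : DiskChart) :
    IsChordDiagram (insideEnds γ Ψ) (partner γ) (eps γ) :=
  hγ.isChordDiagram.filter fun s _ h => by rwa [apply_partner γ]

/-- The pairs of a vertex inside and a vertex outside do not contribute. -/
theorem IsNormalTangle.interSum_eq (h : IsNormalTangle γ Ψ b c d) (hγ : IsGeneric γ) :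
    interSum (ends γ) (partner γ) (eps γ) pos
      = interSum (insideEnds γ Ψ) (partner γ) (eps γ) pos
        + interSum (outsideEnds γ Ψ) (partner γ) (eps γ) pos := by
  classical
  have hb := h.b_pos
  have hbc := h.b_lt
  have hcd := h.c_lt
  have hd := h.d_lt
  have key := h.arcSum_mul_arcSum hγ
  -- The only order in which an inside chord `s` and an outside chord `t` interleave: their four
  -- ends fall, in turn, into the four intervals between 0, b, c, d, 1. These conditions on `s` and
  -- `t` are independent, so the sum is a product of two crossing numbers.
  have e : pairSum (ends γ) (eps γ) (fun s t => ((0 < pos s ∧ pos s < b) ∧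
      (c < pos (partner γ s) ∧ pos (partner γ s) < d)) ∧ (b < pos t ∧ pos t < c) ∧
      (d < pos (partner γ t) ∧ pos (partner γ t) < 1)) = 0 := by
    rw [pairSum_mul]
    refine Eq.trans (congrArg₂ _ (Finset.sum_congr rfl fun s _ => ite_zero_congr ?_ rfl)
      (Finset.sum_congr rfl fun s _ => ite_zero_congr ?_ rfl)) key
    · rw [exists_mem_Ioo_iff le_rfl (by linarith), exists_mem_Ioo_iff (by linarith) hd.le]
    · rw [exists_mem_Ioo_iff (by linarith) (by linarith),
        exists_mem_Ioo_iff (by linarith) le_rfl]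
  rw [← add_zero (_ + _), ← e]
  simp only [interSum, insideEnds, outsideEnds]
  rw [pairSum_filter, pairSum_filter, ← pairSum_or, ← pairSum_or]
  · refine pairSum_congr fun s hs t ht => ?_
    have i1 := h.inside_iff s
    have i2 := h.inside_iff (partner γ s)
    have i3 := h.inside_iff t
    have i4 := h.inside_iff (partner γ t)
    have o1 := h.outside_iff s
    have o2 := h.outside_iff (partner γ s)
    have o3 := h.outside_iff t
    have o4 := h.outside_iff (partner γ t)
    rw [apply_partner γ] at i2 i4 o2 o4
    have k1 := lt_or_gt_of_ne (h.off s hs)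
    have k2 := lt_or_gt_of_ne (h.off t ht)
    have p1 := pos_lt_one (partner γ t)
    have p2 := pos_lt_one (partner γ s)
    have p3 := pos_nonneg s
    rw [i1, i3, o1, o3]
    rw [i1, o1] at k1
    rw [i3, o3] at k2
    rw [i1] at i2
    rw [i3] at i4
    rw [o1] at o2
    rw [o3] at o4
    clear i1 i3 o1 o3 key e
    generalize pos s = x at *
    generalize pos t = y at *
    generalize pos (partner γ s) = x' at *
    generalize pos (partner γ t) = y' at *
    constructor
    · rintro ⟨q1, q2, q3⟩
      grind
    · grind
  · intro s _ t _
    have i1 := h.inside_iff s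
    have o1 := h.outside_iff s
    have o3 := h.outside_iff t
    grind
  · intro s _ t _
    grind

open Classical in
/-- The pairs of a vertex on one strand and a vertex on both strands, exited from that strand,
do not contribute. -/
lemma IsNormalTangle.exitSum_inside (h : IsNormalTangle γ Ψ b c d) (hγ : IsGeneric γ)
    {A : UnitAddCircle → Prop} {p q p' q' : ℝ}
    (hpq : (p = 0 ∧ q = b ∧ p' = c ∧ q' = d) ∨ (p = c ∧ q = d ∧ p' = 0 ∧ q' = b))
    (hA : ∀ s ∈ insideEnds γ Ψ, A s ↔ p < pos s ∧ pos s < q)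
    (hA' : ∀ s ∈ insideEnds γ Ψ, ¬ A s ↔ p' < pos s ∧ pos s < q') :
    exitSum (insideEnds γ Ψ) (partner γ) (eps γ) pos A = 0 := by
  have hb := h.b_pos
  have hbc := h.b_lt
  have hcd := h.c_lt
  have hd := h.d_lt
  have hI := hγ.isChordDiagram_inside Ψ
  refine Finset.sum_eq_zero fun s hs => ?_
  by_cases hc : A s ∧ A (partner γ s) ∧ pos s < pos (partner γ s)
  · obtain ⟨c1, c2, c3⟩ := hc
    have a1 := (hA s hs).1 c1
    have a2 := (hA _ (hI.mem s hs)).1 c2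
    have hp : 0 ≤ p ∧ q ≤ 1 ∧ 0 ≤ p' ∧ q' ≤ 1 := by
      rcases hpq with ⟨rfl, rfl, rfl, rfl⟩ | ⟨rfl, rfl, rfl, rfl⟩ <;>
        refine ⟨?_, ?_, ?_, ?_⟩ <;> linarith
    -- The strand on which `s` has both its times closes up to a loop between them, and the chords
    -- that leave the loop for the other strand are the crossings of the loop with that strand.
    have harc : arcSum γ (pos s) (pos (partner γ s)) p' q' = 0 := by
      refine hγ.arcSum_loop_arc (Ψ := Ψ) (e := 1) (Or.inl rfl) c3 ?_ ?_ ?_ ?_ ?_ ?_ ?_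
      · rcases hpq with ⟨rfl, rfl, rfl, rfl⟩ | ⟨rfl, rfl, rfl, rfl⟩ <;> linarith
      · rcases hpq with ⟨rfl, rfl, rfl, rfl⟩ | ⟨rfl, rfl, rfl, rfl⟩
        · left; constructor <;> linarith
        · right; constructor <;> linarith
      · rw [coe_pos, coe_pos, apply_partner γ]
      · intro u hu
        rw [one_mul]
        rcases hpq with ⟨rfl, rfl, rfl, rfl⟩ | ⟨rfl, rfl, rfl, rfl⟩
        · exact h.inside₁ u ⟨by linarith [hu.1], by linarith [hu.2]⟩
        · exact h.inside₂ u ⟨by linarith [hu.1], by linarith [hu.2]⟩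
      · intro u hu
        rw [one_mul]
        rcases hpq with ⟨rfl, rfl, rfl, rfl⟩ | ⟨rfl, rfl, rfl, rfl⟩
        · exact h.inside₂ u hu
        · exact h.inside₁ u hu
      · rcases hpq with ⟨rfl, rfl, rfl, rfl⟩ | ⟨rfl, rfl, rfl, rfl⟩
        · exact h.height_c
        · exact h.height_zero
      · rcases hpq with ⟨rfl, rfl, rfl, rfl⟩ | ⟨rfl, rfl, rfl, rfl⟩
        · exact h.height_d
        · exact h.height_b
    have := congrArg (eps γ s * ·) harc
    simp only [mul_zero, arcSum] at this
    refine Eq.trans ?_ this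
    rw [Finset.mul_sum, insideEnds, Finset.sum_filter]
    refine Finset.sum_congr rfl fun t ht => ?_
    rw [mul_ite, mul_zero, ← ite_and]
    refine ite_zero_congr ?_ rfl
    rw [exists_mem_Ioo_iff (by linarith [hp.1, a1.1]) (by linarith [hp.2.1, a2.2]),
      exists_mem_Ioo_iff hp.2.2.1 hp.2.2.2]
    have i1 := h.inside_iff t
    have k1 := fun ht' => hA t (mem_insideEnds.2 ⟨ht, ht'⟩)
    have k2 := fun ht' => hA' (partner γ t) (hI.mem t (mem_insideEnds.2 ⟨ht, ht'⟩))
    have k3 : p < pos t → pos t < q → 0 < height Ψ (γ t) := by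
      rw [i1]
      rcases hpq with ⟨rfl, rfl, rfl, rfl⟩ | ⟨rfl, rfl, rfl, rfl⟩
      · exact fun x y => Or.inl ⟨x, y⟩
      · exact fun x y => Or.inr ⟨x, y⟩
    constructor
    · rintro ⟨l1, -, -, -, l2, l3, l4⟩
      exact ⟨⟨l3, l4⟩, (k2 l1).1 l2⟩
    · rintro ⟨⟨l3, l4⟩, l5⟩
      have l1 := k3 (a1.1.trans l3) (l4.trans a2.2)
      exact ⟨l1, c1, c2, (k1 l1).2 ⟨a1.1.trans l3, l4.trans a2.2⟩, (k2 l1).2 l5, l3, l4⟩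
  · refine Finset.sum_eq_zero fun t ht => if_neg ?_
    rintro ⟨l1, l2, -, -, l3, l4⟩
    exact hc ⟨l1, l2, l3.trans l4⟩

/-- Exchanging the two strands does not change the contribution of the inside. -/
lemma IsNormalTangle.interSum_inside_swap (h : IsNormalTangle γ Ψ b c d) (hγ : IsGeneric γ)
    {y : UnitAddCircle → ℝ}
    (hy : ∀ s t, 0 < pos s → pos s < b → c < pos t → pos t < d → y t < y s)
    (hy₁ : ∀ s t, 0 < pos s → pos s < b → 0 < pos t → pos t < b → (pos s < pos t ↔ y s < y t))
    (hy₂ : ∀ s t, c < pos s → pos s < d → c < pos t → pos t < d → (pos s < pos t ↔ y s < y t)) :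
    interSum (insideEnds γ Ψ) (partner γ) (eps γ) pos
      = interSum (insideEnds γ Ψ) (partner γ) (eps γ) y := by
  have hb := h.b_pos
  have hbc := h.b_lt
  have hA : ∀ s ∈ insideEnds γ Ψ, pos s < b ↔ 0 < pos s ∧ pos s < b := fun s hs => by
    have := (h.inside_iff s).1 (mem_insideEnds.1 hs).2
    grind
  have hA' : ∀ s ∈ insideEnds γ Ψ, ¬ pos s < b ↔ c < pos s ∧ pos s < d := fun s hs => by
    have := (h.inside_iff s).1 (mem_insideEnds.1 hs).2
    grind
  refine interSum_swap (A := fun s => pos s < b) (hγ.isChordDiagram_inside Ψ) ?_ ?_ ?_ ?_ ?_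
  · intro s _ t _ h1 h2
    exact h1.trans_le (not_lt.1 h2)
  · intro s hs t ht h1 h2
    have h1 := (hA s hs).1 h1
    have h2 := (hA' t ht).1 h2
    exact hy s t h1.1 h1.2 h2.1 h2.2
  · intro s hs t ht hst
    by_cases h1 : pos s < b
    · have h2 := (hA t ht).1 (hst.1 h1)
      have h1 := (hA s hs).1 h1
      exact hy₁ s t h1.1 h1.2 h2.1 h2.2
    · have h2 := (hA' t ht).1 fun h => h1 (hst.2 h)
      have h1 := (hA' s hs).1 h1
      exact hy₂ s t h1.1 h1.2 h2.1 h2.2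
  · exact h.exitSum_inside hγ (Or.inl ⟨rfl, rfl, rfl, rfl⟩) hA hA'
  · exact h.exitSum_inside hγ (Or.inr ⟨rfl, rfl, rfl, rfl⟩) hA' fun s hs => by
      rw [not_not]; exact hA s hs

end

/-! ### The flipped curve -/

lemma hasDerivAt_path_of_pos {γ : UnitAddCircle → S2} {v : E3} {s : ℝ}
    (h : HasDerivAt (path γ) v (pos s)) : HasDerivAt (path γ) v s := by
  have h1 : ((s : ℝ) : UnitAddCircle) = (pos s : ℝ) := (coe_pos _).symm
  obtain ⟨n, hn⟩ := AddSubgroup.mem_zmultiples_iff.1 (QuotientAddGroup.eq_iff_sub_mem.1 h1)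
  have h2 : s - n • (1 : ℝ) = pos s := by rw [hn]; ring
  have h3 := HasDerivAt.comp_sub_const s (n • (1 : ℝ)) (f := path γ) (f' := v) (by rwa [h2])
  have h4 : (fun x => path γ (x - n • (1 : ℝ))) = path γ :=
    funext fun x => (path_periodic γ).sub_zsmul_eq n
  rwa [h4] at h3

section

/-- The two closed intervals of times inside the disk. -/
def strands (b c d : ℝ) : Set ℝ := Icc 0 b ∪ Icc c d

/-- The permutation of the times that replaces `u` by `ρ₁ u` or `ρ₂ u` on the two strands. -/
def strandMap (b c d : ℝ) (ρ₁ ρ₂ : ℝ → ℝ) (z : UnitAddCircle) : UnitAddCircle :=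
  if pos z ≤ b then (ρ₁ (pos z) : ℝ) else if pos z < c then z else
    if pos z ≤ d then (ρ₂ (pos z) : ℝ) else z

/-- The flipped curve, as a function on `[0, 1]`. -/
def flipPath (γ : UnitAddCircle → S2) (Ψ : DiskChart) (b c d : ℝ) (ρ₁ ρ₂ : ℝ → ℝ) (u : ℝ) : S2 :=
  if u ≤ b then reflect Ψ (γ (ρ₁ u : ℝ)) else if u ≤ c then γ u else
    if u ≤ d then reflect Ψ (γ (ρ₂ u : ℝ)) else γ u

/-- The flipped curve. -/
def flipCurve (γ : UnitAddCircle → S2) (Ψ : DiskChart) (b c d : ℝ) (ρ₁ ρ₂ : ℝ → ℝ)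
    (z : UnitAddCircle) : S2 := flipPath γ Ψ b c d ρ₁ ρ₂ (pos z)

/-- Reparametrizations of the two strands that fit together with the reflection at the ends. -/
structure IsStrandFlip (γ : UnitAddCircle → S2) (Ψ : DiskChart) (b c d : ℝ) (ρ₁ ρ₂ : ℝ → ℝ)
    (κ₁ κ₂ : ℝ) : Prop where
  deriv₁ : ∀ u, HasDerivAt ρ₁ κ₁ u
  deriv₂ : ∀ u, HasDerivAt ρ₂ κ₂ u
  -- Both strands keep their direction or both are reversed, so reparametrization does not affect
  -- signs of crossings.
  slopes : 0 < κ₁ * κ₂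
  maps₁ : ∀ u ∈ Icc 0 b, ρ₁ u ∈ strands b c d
  maps₂ : ∀ u ∈ Icc c d, ρ₂ u ∈ strands b c d
  invol : ∀ z, strandMap b c d ρ₁ ρ₂ (strandMap b c d ρ₁ ρ₂ z) = z
  at_zero : reflect Ψ (γ (ρ₁ 0 : ℝ)) = γ ((0 : ℝ) : UnitAddCircle)
  at_b : reflect Ψ (γ (ρ₁ b : ℝ)) = γ (b : UnitAddCircle)
  at_c : reflect Ψ (γ (ρ₂ c : ℝ)) = γ (c : UnitAddCircle)
  at_d : reflect Ψ (γ (ρ₂ d : ℝ)) = γ (d : UnitAddCircle)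

variable {γ : UnitAddCircle → S2} {Ψ : DiskChart} {b c d κ₁ κ₂ : ℝ} {ρ₁ ρ₂ : ℝ → ℝ}

lemma IsNormalTangle.mem_strands_iff (h : IsNormalTangle γ Ψ b c d) (z : UnitAddCircle) :
    0 ≤ height Ψ (γ z) ↔ pos z ∈ strands b c d := by
  have h1 := h.outside_iff z
  have h2 := pos_nonneg z
  have hb := h.b_lt
  have hc := h.c_lt
  rw [← not_lt, h1]
  simp only [strands, mem_union, mem_Icc]
  grind

lemma IsNormalTangle.pos_mem_of_height_eq_zero (h : IsNormalTangle γ Ψ b c d) {z : UnitAddCircle}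
    (hz : height Ψ (γ z) = 0) : pos z = 0 ∨ pos z = b ∨ pos z = c ∨ pos z = d := by
  have h1 := h.outside_iff z
  have h2 := h.inside_iff z
  have h3 := pos_nonneg z
  rw [hz] at h1 h2
  simp only [lt_self_iff_false, false_iff] at h1 h2
  grind

lemma strandMap_of_outside (h : IsNormalTangle γ Ψ b c d) {z : UnitAddCircle}
    (hz : height Ψ (γ z) < 0) : strandMap b c d ρ₁ ρ₂ z = z := by
  have h1 := (h.outside_iff z).1 hz
  have hb := h.b_lt
  have hc := h.c_lt
  unfold strandMap
  split_ifs with h2 h3 h4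
  · exfalso; grind
  · rfl
  · exfalso; grind
  · rfl

lemma flipCurve_of_outside (h : IsNormalTangle γ Ψ b c d) {z : UnitAddCircle}
    (hz : height Ψ (γ z) < 0) : flipCurve γ Ψ b c d ρ₁ ρ₂ z = γ z := by
  have h1 := (h.outside_iff z).1 hz
  have hb := h.b_lt
  have hc := h.c_lt
  unfold flipCurve flipPath
  split_ifs with h2 h3 h4
  · exfalso; grind
  · rw [coe_pos]
  · exfalso; grind
  · rw [coe_pos]

lemma IsStrandFlip.pos_strandMap (hf : IsStrandFlip γ Ψ b c d ρ₁ ρ₂ κ₁ κ₂)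
    (h : IsNormalTangle γ Ψ b c d) {z : UnitAddCircle} (hz : 0 ≤ height Ψ (γ z)) :
    pos (strandMap b c d ρ₁ ρ₂ z) ∈ strands b c d := by
  have hb := h.b_lt
  have hc := h.c_lt
  have hd := h.d_lt
  have hb0 := h.b_pos
  have h1 := (h.mem_strands_iff z).1 hz
  have key : ∀ u ∈ strands b c d, pos (u : UnitAddCircle) ∈ strands b c d := fun u hu => by
    have : 0 ≤ u ∧ u < 1 := by
      rcases hu with hu | hu <;> constructor <;> linarith [hu.1, hu.2]
    rwa [pos_coe this.1 this.2]
  unfold strandMap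
  rcases h1 with h1 | h1
  · rw [if_pos h1.2]
    exact key _ (hf.maps₁ _ h1)
  · rw [if_neg (by linarith [h1.1]), if_neg (by linarith [h1.1]), if_pos h1.2]
    exact key _ (hf.maps₂ _ h1)

lemma IsStrandFlip.height_strandMap_nonneg (hf : IsStrandFlip γ Ψ b c d ρ₁ ρ₂ κ₁ κ₂)
    (h : IsNormalTangle γ Ψ b c d) {z : UnitAddCircle} (hz : 0 ≤ height Ψ (γ z)) :
    0 ≤ height Ψ (γ (strandMap b c d ρ₁ ρ₂ z)) :=
  (h.mem_strands_iff _).2 (hf.pos_strandMap h hz)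

lemma IsStrandFlip.flipCurve_of_inside (hf : IsStrandFlip γ Ψ b c d ρ₁ ρ₂ κ₁ κ₂)
    (h : IsNormalTangle γ Ψ b c d) {z : UnitAddCircle} (hz : 0 ≤ height Ψ (γ z)) :
    flipCurve γ Ψ b c d ρ₁ ρ₂ z = reflect Ψ (γ (strandMap b c d ρ₁ ρ₂ z)) := by
  have hb := h.b_lt
  have hc := h.c_lt
  unfold flipCurve flipPath strandMap
  rcases (h.mem_strands_iff z).1 hz with h1 | h1
  · rw [if_pos h1.2, if_pos h1.2]
  · have h2 : ¬ pos z ≤ b := by linarith [h1.1]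
    have h3 : ¬ pos z < c := not_lt.2 h1.1
    simp only [if_neg h2, if_neg h3, if_pos h1.2]
    -- At the time `c` itself, `flipPath` follows the strand outside and `strandMap` the strand
    -- inside; they agree by `at_c`.
    split_ifs with h4
    · have : pos z = c := le_antisymm h4 h1.1
      rw [this, hf.at_c]
    · rfl

lemma IsStrandFlip.reflect_strandMap (hf : IsStrandFlip γ Ψ b c d ρ₁ ρ₂ κ₁ κ₂)
    (h : IsNormalTangle γ Ψ b c d) {z : UnitAddCircle} (hz : height Ψ (γ z) = 0) :
    reflect Ψ (γ (strandMap b c d ρ₁ ρ₂ z)) = γ z := by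
  have hb := h.b_lt
  have hc := h.c_lt
  have hb0 := h.b_pos
  conv_rhs => rw [← coe_pos z]
  unfold strandMap
  rcases h.pos_mem_of_height_eq_zero hz with h1 | h1 | h1 | h1 <;> rw [h1]
  · rw [if_pos hb0.le, hf.at_zero]
  · rw [if_pos le_rfl, hf.at_b]
  · rw [if_neg (by linarith), if_neg (by linarith), if_pos hc.le, hf.at_c]
  · rw [if_neg (by linarith), if_neg (by linarith), if_pos le_rfl, hf.at_d]

lemma IsStrandFlip.height_strandMap_eq_zero_iff (hf : IsStrandFlip γ Ψ b c d ρ₁ ρ₂ κ₁ κ₂)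
    (h : IsNormalTangle γ Ψ b c d) {z : UnitAddCircle} :
    height Ψ (γ (strandMap b c d ρ₁ ρ₂ z)) = 0 ↔ height Ψ (γ z) = 0 := by
  have key : ∀ z, height Ψ (γ z) = 0 → height Ψ (γ (strandMap b c d ρ₁ ρ₂ z)) = 0 := fun z hz => by
    rw [← height_reflect, hf.reflect_strandMap h hz, hz]
  refine ⟨fun hz => ?_, key z⟩
  have := key _ hz
  rwa [hf.invol] at this

/-- The strand map preserves the inside, the outside, and `σ`. -/
lemma IsStrandFlip.sign_height_strandMap (hf : IsStrandFlip γ Ψ b c d ρ₁ ρ₂ κ₁ κ₂)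
    (h : IsNormalTangle γ Ψ b c d) (z : UnitAddCircle) :
    SignType.sign (height Ψ (γ (strandMap b c d ρ₁ ρ₂ z))) = SignType.sign (height Ψ (γ z)) := by
  rcases lt_trichotomy (height Ψ (γ z)) 0 with hz | hz | hz
  · rw [strandMap_of_outside h hz]
  · rw [hz, (hf.height_strandMap_eq_zero_iff h).2 hz]
  · rw [sign_pos hz, sign_pos]
    exact lt_of_le_of_ne (hf.height_strandMap_nonneg h hz.le)
      fun e => hz.ne' ((hf.height_strandMap_eq_zero_iff h).1 e.symm)

lemma IsStrandFlip.height_flipCurve (hf : IsStrandFlip γ Ψ b c d ρ₁ ρ₂ κ₁ κ₂)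
    (h : IsNormalTangle γ Ψ b c d) (z : UnitAddCircle) :
    height Ψ (flipCurve γ Ψ b c d ρ₁ ρ₂ z) = height Ψ (γ (strandMap b c d ρ₁ ρ₂ z)) := by
  rcases lt_or_ge (height Ψ (γ z)) 0 with hz | hz
  · rw [flipCurve_of_outside h hz, strandMap_of_outside h hz]
  · rw [hf.flipCurve_of_inside h hz, height_reflect]

lemma IsStrandFlip.sign_height_flipCurve (hf : IsStrandFlip γ Ψ b c d ρ₁ ρ₂ κ₁ κ₂)
    (h : IsNormalTangle γ Ψ b c d) (z : UnitAddCircle) :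
    SignType.sign (height Ψ (flipCurve γ Ψ b c d ρ₁ ρ₂ z)) = SignType.sign (height Ψ (γ z)) := by
  rw [hf.height_flipCurve h, hf.sign_height_strandMap h]

/-- Either equation forces `s` and `t` to be on the same side of `σ`, where the flipped curve is `γ`
after `strandMap`, followed inside by an injective reflection. Hence `strandMap` carries the chords
of the flipped curve to those of `γ`. -/
lemma IsStrandFlip.flipCurve_eq_iff (hf : IsStrandFlip γ Ψ b c d ρ₁ ρ₂ κ₁ κ₂)
    (h : IsNormalTangle γ Ψ b c d) {s t : UnitAddCircle} :
    flipCurve γ Ψ b c d ρ₁ ρ₂ s = flipCurve γ Ψ b c d ρ₁ ρ₂ t ↔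
      γ (strandMap b c d ρ₁ ρ₂ s) = γ (strandMap b c d ρ₁ ρ₂ t) := by
  have key : SignType.sign (height Ψ (γ s)) = SignType.sign (height Ψ (γ t)) →
      (flipCurve γ Ψ b c d ρ₁ ρ₂ s = flipCurve γ Ψ b c d ρ₁ ρ₂ t ↔
        γ (strandMap b c d ρ₁ ρ₂ s) = γ (strandMap b c d ρ₁ ρ₂ t)) := by
    intro hst
    rcases lt_or_ge (height Ψ (γ s)) 0 with hs | hs
    · have ht : height Ψ (γ t) < 0 := by
        rw [sign_neg hs] at hst
        exact sign_eq_neg_one_iff.1 hst.symm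
      rw [flipCurve_of_outside h hs, strandMap_of_outside h hs, flipCurve_of_outside h ht,
        strandMap_of_outside h ht]
    · have ht : 0 ≤ height Ψ (γ t) := by
        by_contra ht
        rw [sign_neg (not_le.1 ht)] at hst
        exact hs.not_gt (sign_eq_neg_one_iff.1 hst)
      rw [hf.flipCurve_of_inside h hs, hf.flipCurve_of_inside h ht, (reflect_injective Ψ).eq_iff]
  constructor
  · intro e
    refine (key ?_).1 e
    rw [← hf.sign_height_flipCurve h, e, hf.sign_height_flipCurve h]
  · intro e
    refine (key ?_).2 e
    rw [← hf.sign_height_strandMap h, e, hf.sign_height_strandMap h]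

lemma IsStrandFlip.continuous_flipCurve (hf : IsStrandFlip γ Ψ b c d ρ₁ ρ₂ κ₁ κ₂)
    (h : IsNormalTangle γ Ψ b c d) (hγ : IsGeneric γ) :
    Continuous (flipCurve γ Ψ b c d ρ₁ ρ₂) := by
  have hb := h.b_lt
  have hc := h.c_lt
  have hd := h.d_lt
  have hb0 := h.b_pos
  have c0 : Continuous fun u : ℝ => γ (u : UnitAddCircle) :=
    hγ.continuous.comp (AddCircle.continuous_mk' 1)
  have cρ₁ : Continuous ρ₁ := continuous_iff_continuousAt.2 fun u => (hf.deriv₁ u).continuousAt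
  have cρ₂ : Continuous ρ₂ := continuous_iff_continuousAt.2 fun u => (hf.deriv₂ u).continuousAt
  have c1 : Continuous fun u : ℝ => reflect Ψ (γ (ρ₁ u : ℝ)) :=
    (continuous_reflect Ψ).comp (c0.comp cρ₁)
  have c2 : Continuous fun u : ℝ => reflect Ψ (γ (ρ₂ u : ℝ)) :=
    (continuous_reflect Ψ).comp (c0.comp cρ₂)
  have hcont : Continuous (flipPath γ Ψ b c d ρ₁ ρ₂) := by
    refine c1.if_le (c0.if_le (c2.if_le c0 continuous_id continuous_const ?_) continuous_id
      continuous_const ?_) continuous_id continuous_const ?_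
    · rintro u rfl
      exact hf.at_d
    · rintro u rfl
      rw [if_pos hc.le]
      exact hf.at_c.symm
    · rintro u rfl
      rw [if_pos hb.le]
      exact hf.at_b
  refine AddCircle.liftIco_zero_continuous (f := flipPath γ Ψ b c d ρ₁ ρ₂) ?_ hcont.continuousOn
  -- The path closes up: its value at 1 is on the strand outside, and `at_zero` matches it with the
  -- reflected value at 0.
  rw [flipPath, flipPath, if_pos hb0.le, if_neg (by linarith), if_neg (by linarith),
    if_neg (by linarith), hf.at_zero, AddCircle.coe_period, AddCircle.coe_zero]

/-- The derivatives of the flipped curve at its vertices. -/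
lemma IsStrandFlip.exists_hasDerivAt (hf : IsStrandFlip γ Ψ b c d ρ₁ ρ₂ κ₁ κ₂)
    (h : IsNormalTangle γ Ψ b c d) (hγ : IsGeneric γ) :
    ∃ V : UnitAddCircle → E3,
      (∀ s : ℝ, strandMap b c d ρ₁ ρ₂ s ∈ ends γ →
        HasDerivAt (path (flipCurve γ Ψ b c d ρ₁ ρ₂)) (V s) s) ∧
      ∀ s t, strandMap b c d ρ₁ ρ₂ s ∈ ends γ → strandMap b c d ρ₁ ρ₂ t
          = partner γ (strandMap b c d ρ₁ ρ₂ s) →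
        SignType.sign (det3 (flipCurve γ Ψ b c d ρ₁ ρ₂ s) (V t) (V s))
          = (if 0 < height Ψ (γ s) then -1 else 1) * SignType.sign
            (det3 (γ (strandMap b c d ρ₁ ρ₂ s)) (velocity γ (partner γ (strandMap b c d ρ₁ ρ₂ s)))
              (velocity γ (strandMap b c d ρ₁ ρ₂ s))) := by
  have hb := h.b_lt
  have hc := h.c_lt
  have hd := h.d_lt
  have hb0 := h.b_pos
  obtain ⟨D, hD, hD'⟩ := exists_reflect_deriv Ψ
  set k := strandMap b c d ρ₁ ρ₂ with hk
  -- The slope of the reparametrization at a time inside. Products of two slopes are positive, so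
  -- only the reflection changes the sign of a crossing.
  let κ : UnitAddCircle → ℝ := fun z => if pos z < b then κ₁ else κ₂
  have hκ : ∀ s t, 0 < κ s * κ t := fun s t => by
    have h0 := hf.slopes
    have h1 : κ₁ ≠ 0 := by rintro rfl; simp at h0
    have h2 : κ₂ ≠ 0 := by rintro rfl; simp at h0
    simp only [κ]
    split_ifs
    · exact mul_self_pos.2 h1
    · exact h0
    · rwa [mul_comm]
    · exact mul_self_pos.2 h2
  let V : UnitAddCircle → E3 := fun z =>
    if 0 < height Ψ (γ z) then D (γ (k z)) (κ z • velocity γ (k z)) else velocity γ z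
  have hnz : ∀ z, k z ∈ ends γ → height Ψ (γ z) ≠ 0 := fun z hz e =>
    h.off _ hz ((hf.height_strandMap_eq_zero_iff h).2 e)
  refine ⟨V, fun s hs => hasDerivAt_path_of_pos ?_, fun s t hs hst => ?_⟩
  · generalize (s : UnitAddCircle) = z at hs ⊢
    rcases lt_or_gt_of_ne (hnz z hs) with hz | hz
    · simp only [V, if_neg hz.le.not_gt]
      rw [hk, strandMap_of_outside h hz] at hs
      have h1 := hγ.hasDerivAt (u := pos z) (by rwa [coe_pos])
      rw [coe_pos] at h1
      refine h1.congr_of_eventuallyEq ?_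
      have h2 : ∀ᶠ u : ℝ in 𝓝 (pos z), height Ψ (γ (u : UnitAddCircle)) < 0 := by
        have : ContinuousAt (fun u : ℝ => height Ψ (γ (u : UnitAddCircle))) (pos z) :=
          ((continuous_height Ψ).comp (hγ.continuous.comp (AddCircle.continuous_mk' 1))).continuousAt
        exact this.eventually (gt_mem_nhds (by simpa only [coe_pos] using hz))
      filter_upwards [h2] with u hu
      rw [path, flipCurve_of_outside h hu]
    · simp only [V, if_pos hz]
      have gen : ∀ (ρ : ℝ → ℝ) (m : ℝ), HasDerivAt ρ m (pos z) → (ρ (pos z) : UnitAddCircle) = k z →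
          (∀ᶠ u : ℝ in 𝓝 (pos z), flipCurve γ Ψ b c d ρ₁ ρ₂ u = reflect Ψ (γ (ρ u : ℝ))) →
          HasDerivAt (path (flipCurve γ Ψ b c d ρ₁ ρ₂)) (D (γ (k z)) (m • velocity γ (k z)))
            (pos z) := by
        intro ρ m h1 h2 h3
        have h4 := hγ.hasDerivAt (u := ρ (pos z)) (by rwa [h2])
        have h5 := hD (fun u => γ (ρ u : ℝ)) _ (pos z) (h4.scomp (pos z) h1)
        rw [h2] at h5
        refine h5.congr_of_eventuallyEq ?_
        filter_upwards [h3] with u hu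
        rw [path, hu]
      rcases (h.inside_iff z).1 hz with h1 | h1
      · have hκz : κ z = κ₁ := if_pos h1.2
        rw [hκz]
        refine gen ρ₁ κ₁ (hf.deriv₁ _) ?_ ?_
        · rw [hk, strandMap, if_pos h1.2.le]
        · filter_upwards [isOpen_Ioo.mem_nhds (show pos z ∈ Ioo 0 b from h1)] with u hu
          rw [flipCurve, pos_coe hu.1.le (by linarith [hu.2]), flipPath, if_pos hu.2.le]
      · have hκz : κ z = κ₂ := if_neg (by linarith [h1.1])
        rw [hκz]
        refine gen ρ₂ κ₂ (hf.deriv₂ _) ?_ ?_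
        · rw [hk, strandMap, if_neg (by linarith [h1.1]), if_neg (by linarith [h1.1]), if_pos h1.2.le]
        · filter_upwards [isOpen_Ioo.mem_nhds (show pos z ∈ Ioo c d from h1)] with u hu
          rw [flipCurve, pos_coe (by linarith [hu.1]) (by linarith [hu.2]), flipPath,
            if_neg (by linarith [hu.1]), if_neg (by linarith [hu.1]), if_pos hu.2.le]
  · have hsgn : SignType.sign (height Ψ (γ s)) = SignType.sign (height Ψ (γ t)) := by
      rw [← hf.sign_height_strandMap h s, ← hf.sign_height_strandMap h t, ← hk, hst,
        apply_partner γ]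
    rcases lt_or_gt_of_ne (hnz s hs) with hz | hz
    · have ht : height Ψ (γ t) < 0 := by
        rw [sign_neg hz] at hsgn
        exact sign_eq_neg_one_iff.1 hsgn.symm
      have e1 : k s = s := strandMap_of_outside h hz
      have e2 : k t = t := strandMap_of_outside h ht
      rw [e1, e2] at hst
      rw [if_neg hz.le.not_gt, one_mul, flipCurve_of_outside h hz, e1, ← hst]
      simp only [V, if_neg hz.le.not_gt, if_neg ht.le.not_gt]
    · have ht : 0 < height Ψ (γ t) := by
        rw [sign_pos hz] at hsgn
        exact sign_eq_one_iff.1 hsgn.symm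
      rw [if_pos hz, hf.flipCurve_of_inside h hz.le]
      simp only [V, if_pos hz, if_pos ht]
      rw [← hk, hst, apply_partner γ, hD', det3_smul_smul, sign_mul, sign_pos (hκ t s), one_mul,
        neg_one_mul]

lemma IsStrandFlip.strandMap_injective (hf : IsStrandFlip γ Ψ b c d ρ₁ ρ₂ κ₁ κ₂) :
    Function.Injective (strandMap b c d ρ₁ ρ₂) := Function.Involutive.injective hf.invol

theorem IsStrandFlip.isGeneric (hf : IsStrandFlip γ Ψ b c d ρ₁ ρ₂ κ₁ κ₂)
    (h : IsNormalTangle γ Ψ b c d) (hγ : IsGeneric γ) :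
    IsGeneric (flipCurve γ Ψ b c d ρ₁ ρ₂) where
  continuous := hf.continuous_flipCurve h hγ
  finite_vertices := by
    refine ((ends γ).finite_toSet.image fun s => flipCurve γ Ψ b c d ρ₁ ρ₂
      (strandMap b c d ρ₁ ρ₂ s)).subset ?_
    rintro x ⟨s, t, hst, rfl, ht⟩
    refine ⟨strandMap b c d ρ₁ ρ₂ s, ?_, by simp only [hf.invol]⟩
    exact hγ.mem_ends_of_eq (hf.strandMap_injective.ne hst.symm) ((hf.flipCurve_eq_iff h).1 ht)
  double r s t h1 h2 := by
    have := hγ.double _ _ _ ((hf.flipCurve_eq_iff h).1 h1) ((hf.flipCurve_eq_iff h).1 h2)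
    simpa only [hf.strandMap_injective.eq_iff] using this
  transverse s t hst e := by
    obtain ⟨V, hV, hV'⟩ := hf.exists_hasDerivAt h hγ
    have e' := (hf.flipCurve_eq_iff h).1 e
    have hne := hf.strandMap_injective.ne hst
    have hs := hγ.mem_ends_of_eq hne.symm e'.symm
    have ht := hγ.mem_ends_of_eq hne e'
    have h1 := hV s hs
    have h2 := hV t ht
    refine ⟨h1.differentiableAt, h2.differentiableAt, ?_⟩
    rw [h1.deriv, h2.deriv]
    refine linearIndependent_of_det3 (p := flipCurve γ Ψ b c d ρ₁ ρ₂ t) ?_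
    rw [← sign_ne_zero, hV' t s ht (hγ.partner_eq hne e').symm, mul_ne_zero_iff]
    refine ⟨by split_ifs <;> decide, ?_⟩
    rw [sign_ne_zero]
    exact hγ.det_ne_zero ht

lemma IsStrandFlip.isNormalTangle (hf : IsStrandFlip γ Ψ b c d ρ₁ ρ₂ κ₁ κ₂)
    (h : IsNormalTangle γ Ψ b c d) (hγ : IsGeneric γ) :
    IsNormalTangle (flipCurve γ Ψ b c d ρ₁ ρ₂) Ψ b c d := by
  have hs := hf.sign_height_flipCurve h
  have z : ∀ z, height Ψ (γ z) = 0 → height Ψ (flipCurve γ Ψ b c d ρ₁ ρ₂ z) = 0 := fun z hz => by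
    rw [← sign_eq_zero_iff, hs, hz, sign_zero]
  have p : ∀ z, 0 < height Ψ (γ z) → 0 < height Ψ (flipCurve γ Ψ b c d ρ₁ ρ₂ z) := fun z hz => by
    rw [← sign_eq_one_iff, hs, sign_pos hz]
  have n : ∀ z, height Ψ (γ z) < 0 → height Ψ (flipCurve γ Ψ b c d ρ₁ ρ₂ z) < 0 := fun z hz => by
    rw [← sign_eq_neg_one_iff, hs, sign_neg hz]
  exact ⟨h.b_pos, h.b_lt, h.c_lt, h.d_lt, z _ h.height_zero, z _ h.height_b, z _ h.height_c,
    z _ h.height_d, fun u hu => p _ (h.inside₁ u hu), fun u hu => n _ (h.outside₁ u hu),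
    fun u hu => p _ (h.inside₂ u hu), fun u hu => n _ (h.outside₂ u hu), fun s hs' => by
      obtain ⟨t, hts, e⟩ := (hf.isGeneric h hγ).mem_ends.1 hs'
      rw [hf.height_flipCurve h]
      exact h.off _ (hγ.mem_ends_of_eq (hf.strandMap_injective.ne hts)
        ((hf.flipCurve_eq_iff h).1 e))⟩

lemma IsStrandFlip.range_flipCurve (hf : IsStrandFlip γ Ψ b c d ρ₁ ρ₂ κ₁ κ₂)
    (h : IsNormalTangle γ Ψ b c d) :
    range (flipCurve γ Ψ b c d ρ₁ ρ₂) = flip Ψ (range γ) := by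
  ext x
  constructor
  · rintro ⟨z, rfl⟩
    rcases lt_or_ge (height Ψ (γ z)) 0 with hz | hz
    · rw [flipCurve_of_outside h hz]
      exact Or.inl ⟨⟨z, rfl⟩, fun hd => hz.not_ge hd⟩
    · rw [hf.flipCurve_of_inside h hz]
      exact Or.inr ⟨_, ⟨⟨_, rfl⟩, hf.height_strandMap_nonneg h hz⟩, rfl⟩
  · rintro (⟨⟨z, rfl⟩, hz⟩ | ⟨_, ⟨⟨z, rfl⟩, hz⟩, rfl⟩)
    · exact ⟨z, flipCurve_of_outside h (not_le.1 hz)⟩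
    · refine ⟨strandMap b c d ρ₁ ρ₂ z, ?_⟩
      rw [hf.flipCurve_of_inside h (hf.height_strandMap_nonneg h hz), hf.invol]

/-- The defect of the flipped curve, if the order on the inside may be exchanged. -/
theorem IsStrandFlip.defect_flipCurve (hf : IsStrandFlip γ Ψ b c d ρ₁ ρ₂ κ₁ κ₂)
    (h : IsNormalTangle γ Ψ b c d) (hγ : IsGeneric γ)
    (ho : interSum (insideEnds γ Ψ) (partner γ) (eps γ) pos
      = interSum (insideEnds γ Ψ) (partner γ) (eps γ) fun s => pos (strandMap b c d ρ₁ ρ₂ s)) :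
    defect (flipCurve γ Ψ b c d ρ₁ ρ₂) = defect γ := by
  set γ' := flipCurve γ Ψ b c d ρ₁ ρ₂ with hγ'
  set k := strandMap b c d ρ₁ ρ₂ with hk
  have hg : IsGeneric γ' := hf.isGeneric h hγ
  have hn : IsNormalTangle γ' Ψ b c d := hf.isNormalTangle h hγ
  have hinv : ∀ z, k (k z) = z := hf.invol
  have hinj : Function.Injective k := hf.strandMap_injective
  have heq : ∀ {s t}, γ' s = γ' t ↔ γ (k s) = γ (k t) := hf.flipCurve_eq_iff h
  have hmem : ∀ s, s ∈ ends γ' ↔ k s ∈ ends γ := by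
    intro s
    rw [hg.mem_ends, hγ.mem_ends]
    constructor
    · rintro ⟨t, h1, h2⟩
      exact ⟨k t, hinj.ne h1, heq.1 h2⟩
    · rintro ⟨t, h1, h2⟩
      refine ⟨k t, fun e => h1 (by rw [← e, hinv]), heq.2 ?_⟩
      rwa [hinv]
  have hpart : ∀ s ∈ ends γ', k (partner γ' s) = partner γ (k s) := fun s hs =>
    (hγ.partner_eq (hinj.ne (hg.partner_ne hs)) (heq.1 (apply_partner γ' s))).symm
  obtain ⟨V, hV, hV'⟩ := hf.exists_hasDerivAt h hγ
  have hvel : ∀ s ∈ ends γ', velocity γ' s = V s := fun s hs => by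
    have h1 := hV (pos s) (by rw [coe_pos]; exact (hmem s).1 hs)
    rw [coe_pos] at h1
    rw [← coe_pos s, velocity_coe, coe_pos]
    exact h1.deriv
  -- All signs inside change and none outside. A product of an inside and an outside sign would
  -- change, which is why the mixed pairs had to cancel beforehand.
  have heps : ∀ s ∈ ends γ', eps γ' s = (if 0 < height Ψ (γ s) then -1 else 1) * eps γ (k s) := by
    intro s hs
    rw [eps, eps, hvel s hs, hvel _ (hg.partner_mem hs),
      hV' s (partner γ' s) ((hmem s).1 hs) (hpart s hs), SignType.coe_mul]
    congr 1
    split_ifs <;> rfl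
  have hsg := hf.sign_height_flipCurve h
  have hsk := hf.sign_height_strandMap h
  have hin : ∀ s, s ∈ insideEnds γ' Ψ ↔ k s ∈ insideEnds γ Ψ := fun s => by
    rw [mem_insideEnds, mem_insideEnds, hmem, ← sign_eq_one_iff, hsg, ← hsk, sign_eq_one_iff]
  have hout : ∀ s, s ∈ outsideEnds γ' Ψ ↔ k s ∈ outsideEnds γ Ψ := fun s => by
    rw [mem_outsideEnds, mem_outsideEnds, hmem, ← sign_eq_neg_one_iff, hsg, ← hsk,
      sign_eq_neg_one_iff]
  have hpos : ∀ s ∈ insideEnds γ' Ψ, 0 < height Ψ (γ s) := fun s hs => by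
    rw [← sign_eq_one_iff, ← hsg, sign_eq_one_iff]
    exact (mem_insideEnds.1 hs).2
  have hneg : ∀ s ∈ outsideEnds γ' Ψ, ¬ 0 < height Ψ (γ s) := fun s hs => by
    rw [← sign_eq_one_iff, ← hsg, sign_eq_one_iff]
    exact (mem_outsideEnds.1 hs).2.le.not_gt
  have e1 := interSum_transfer (T := insideEnds γ Ψ) (τ := partner γ) (ε := eps γ)
    (T' := insideEnds γ' Ψ) (τ' := partner γ') (ε' := eps γ') (k := k)
    (fun s hs => (hin s).1 hs) hinj.injOn
    (fun s hs => ⟨k s, (hin _).2 (by rwa [hinv]), hinv s⟩)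
    (fun s hs => hpart s (mem_insideEnds.1 hs).1)
    (fun s hs t ht => by
      rw [heps s (mem_insideEnds.1 hs).1, heps t (mem_insideEnds.1 ht).1, if_pos (hpos s hs),
        if_pos (hpos t ht)]
      ring) (fun s => pos (k s))
  have e2 := interSum_transfer (T := outsideEnds γ Ψ) (τ := partner γ) (ε := eps γ)
    (T' := outsideEnds γ' Ψ) (τ' := partner γ') (ε' := eps γ') (k := k)
    (fun s hs => (hout s).1 hs) hinj.injOn
    (fun s hs => ⟨k s, (hout _).2 (by rwa [hinv]), hinv s⟩)
    (fun s hs => hpart s (mem_outsideEnds.1 hs).1)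
    (fun s hs t ht => by
      rw [heps s (mem_outsideEnds.1 hs).1, heps t (mem_outsideEnds.1 ht).1, if_neg (hneg s hs),
        if_neg (hneg t ht)]
      ring) (fun s => pos (k s))
  simp only [hinv] at e1 e2
  rw [hg.defect_eq, hγ.defect_eq, hn.interSum_eq hg, h.interSum_eq hγ, ho, e1, e2]
  congr 2
  -- Only the ends outside remain, and their times are fixed by `strandMap`.
  refine interSum_congr (hγ.isChordDiagram.filter fun s _ hs => by rwa [apply_partner γ]) ?_
  intro s hs t ht
  rw [hk, strandMap_of_outside h (mem_outsideEnds.1 hs).2,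
    strandMap_of_outside h (mem_outsideEnds.1 ht).2]

end

/-! ### The three ways to flip -/

section

variable {γ : UnitAddCircle → S2} {Ψ : DiskChart} {b c d κ₁ κ₂ : ℝ} {ρ₁ ρ₂ : ℝ → ℝ}

lemma pos_strandMap_left (hbc : b < c) (hcd : c < d) (hd : d < 1) (hb : 0 < b)
    (maps₁ : ∀ u ∈ Icc 0 b, ρ₁ u ∈ strands b c d) {z : UnitAddCircle} (hz : pos z ≤ b) :
    pos (strandMap b c d ρ₁ ρ₂ z) = ρ₁ (pos z) := by
  rw [strandMap, if_pos hz]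
  have h1 := maps₁ _ ⟨pos_nonneg z, hz⟩
  refine pos_coe ?_ ?_ <;> rcases h1 with h1 | h1 <;> linarith [h1.1, h1.2]

lemma pos_strandMap_right (hbc : b < c) (hcd : c < d) (hd : d < 1) (hb : 0 < b)
    (maps₂ : ∀ u ∈ Icc c d, ρ₂ u ∈ strands b c d) {z : UnitAddCircle} (hz : c ≤ pos z)
    (hz' : pos z ≤ d) : pos (strandMap b c d ρ₁ ρ₂ z) = ρ₂ (pos z) := by
  rw [strandMap, if_neg (by linarith), if_neg (by linarith), if_pos hz']
  have h1 := maps₂ _ ⟨hz, hz'⟩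
  refine pos_coe ?_ ?_ <;> rcases h1 with h1 | h1 <;> linarith [h1.1, h1.2]

/-- The strand containing `ρ₁ u` or `ρ₂ u` decides which of the two maps is applied next; comparing
with `b` suffices, since both strands are preserved as a union. -/
lemma strandMap_strandMap (hbc : b < c) (hcd : c < d) (hd : d < 1) (hb : 0 < b)
    (maps₁ : ∀ u ∈ Icc 0 b, ρ₁ u ∈ strands b c d) (maps₂ : ∀ u ∈ Icc c d, ρ₂ u ∈ strands b c d)
    (inv₁ : ∀ u ∈ Icc 0 b, (if ρ₁ u ≤ b then ρ₁ (ρ₁ u) else ρ₂ (ρ₁ u)) = u)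
    (inv₂ : ∀ u ∈ Icc c d, (if ρ₂ u ≤ b then ρ₁ (ρ₂ u) else ρ₂ (ρ₂ u)) = u) (z : UnitAddCircle) :
    strandMap b c d ρ₁ ρ₂ (strandMap b c d ρ₁ ρ₂ z) = z := by
  have key : ∀ y w, w ∈ strands b c d → pos (strandMap b c d ρ₁ ρ₂ y) = w →
      (if w ≤ b then ρ₁ w else ρ₂ w) = pos y →
      strandMap b c d ρ₁ ρ₂ (strandMap b c d ρ₁ ρ₂ y) = y := by
    intro y w hw e h
    refine pos_injective ?_
    rw [← h, ← e]
    rw [← e] at hw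
    split_ifs with h1
    · exact pos_strandMap_left hbc hcd hd hb maps₁ h1
    · rcases hw with hw | hw
      · exact absurd hw.2 h1
      · exact pos_strandMap_right hbc hcd hd hb maps₂ hw.1 hw.2
  by_cases h1 : pos z ≤ b
  · exact key z _ (maps₁ _ ⟨pos_nonneg z, h1⟩) (pos_strandMap_left hbc hcd hd hb maps₁ h1)
      (inv₁ _ ⟨pos_nonneg z, h1⟩)
  by_cases h2 : c ≤ pos z ∧ pos z ≤ d
  · exact key z _ (maps₂ _ h2) (pos_strandMap_right hbc hcd hd hb maps₂ h2.1 h2.2) (inv₂ _ h2)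
  · have e : strandMap b c d ρ₁ ρ₂ z = z := by
      rw [strandMap, if_neg h1]
      split_ifs with h3 h4
      · rfl
      · exact absurd ⟨not_lt.1 h3, h4⟩ h2
      · rfl
    rw [e, e]

/-- Each strand is reversed. -/
lemma IsNormalTangle.exists_flip_of_reverse (h : IsNormalTangle γ Ψ b c d) (hγ : IsGeneric γ)
    (h1 : reflect Ψ (γ (b : UnitAddCircle)) = γ ((0 : ℝ) : UnitAddCircle))
    (h2 : reflect Ψ (γ ((0 : ℝ) : UnitAddCircle)) = γ (b : UnitAddCircle))
    (h3 : reflect Ψ (γ (d : UnitAddCircle)) = γ (c : UnitAddCircle))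
    (h4 : reflect Ψ (γ (c : UnitAddCircle)) = γ (d : UnitAddCircle)) :
    ∃ γ', IsGeneric γ' ∧ range γ' = flip Ψ (range γ) ∧ defect γ' = defect γ := by
  obtain ⟨hb, hbc, hcd, hd⟩ : 0 < b ∧ b < c ∧ c < d ∧ d < 1 := ⟨h.b_pos, h.b_lt, h.c_lt, h.d_lt⟩
  have m1 : ∀ u ∈ Icc 0 b, b - u ∈ strands b c d := fun u hu =>
    Or.inl ⟨by linarith [hu.2], by linarith [hu.1]⟩
  have m2 : ∀ u ∈ Icc c d, c + d - u ∈ strands b c d := fun u hu =>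
    Or.inr ⟨by linarith [hu.2], by linarith [hu.1]⟩
  have hf : IsStrandFlip γ Ψ b c d (fun u => b - u) (fun u => c + d - u) (-1) (-1) := by
    refine ⟨fun u => (hasDerivAt_id' u).const_sub b, fun u => (hasDerivAt_id' u).const_sub _,
      by norm_num, m1, m2, strandMap_strandMap hbc hcd hd hb m1 m2 (fun u hu => ?_)
      (fun u hu => ?_), ?_, ?_, ?_, ?_⟩
    · rw [if_pos (by linarith [hu.1])]; ring
    · rw [if_neg (by linarith [hu.2])]; ring
    · simpa using h1
    · simpa using h2
    · simpa using h3
    · simpa using h4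
  refine ⟨_, hf.isGeneric h hγ, hf.range_flipCurve h, hf.defect_flipCurve h hγ ?_⟩
  -- Reversing each strand and then the whole order leaves each strand as it was and exchanges the
  -- two.
  rw [← interSum_neg (hγ.isChordDiagram_inside Ψ)
    (x := fun s => pos (strandMap b c d (fun u => b - u) (fun u => c + d - u) s))]
  have k1 : ∀ s, pos s < b → pos (strandMap b c d (fun u => b - u) (fun u => c + d - u) s)
      = b - pos s := fun s hs => pos_strandMap_left hbc hcd hd hb m1 hs.le
  have k2 : ∀ s, c < pos s → pos s < d → pos (strandMap b c d (fun u => b - u)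
      (fun u => c + d - u) s) = c + d - pos s := fun s hs hs' =>
    pos_strandMap_right hbc hcd hd hb m2 hs.le hs'.le
  refine h.interSum_inside_swap hγ ?_ ?_ ?_
  · intro s t s1 s2 t1 t2
    rw [k1 s s2, k2 t t1 t2]
    linarith
  · intro s t s1 s2 t1 t2
    rw [k1 s s2, k1 t t2]
    constructor <;> intro <;> linarith
  · intro s t s1 s2 t1 t2
    rw [k2 s s1 s2, k2 t t1 t2]
    constructor <;> intro <;> linarith

/-- The strands are exchanged. -/
lemma IsNormalTangle.exists_flip_of_swap (h : IsNormalTangle γ Ψ b c d) (hγ : IsGeneric γ)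
    (h1 : reflect Ψ (γ (c : UnitAddCircle)) = γ ((0 : ℝ) : UnitAddCircle))
    (h2 : reflect Ψ (γ ((0 : ℝ) : UnitAddCircle)) = γ (c : UnitAddCircle))
    (h3 : reflect Ψ (γ (d : UnitAddCircle)) = γ (b : UnitAddCircle))
    (h4 : reflect Ψ (γ (b : UnitAddCircle)) = γ (d : UnitAddCircle)) :
    ∃ γ', IsGeneric γ' ∧ range γ' = flip Ψ (range γ) ∧ defect γ' = defect γ := by
  obtain ⟨hb, hbc, hcd, hd⟩ : 0 < b ∧ b < c ∧ c < d ∧ d < 1 := ⟨h.b_pos, h.b_lt, h.c_lt, h.d_lt⟩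
  -- The slopes of the affine bijections between `[0, b]` and `[c, d]`, inverse to each other.
  obtain ⟨m, n, hm, hn, hmn, hbm, hcn⟩ : ∃ m n : ℝ, 0 < m ∧ 0 < n ∧ m * n = 1 ∧ b * m = d - c ∧
      (d - c) * n = b := by
    have : 0 < d - c := sub_pos.2 hcd
    exact ⟨(d - c) / b, b / (d - c), by positivity, by positivity, by field_simp, by field_simp,
      by field_simp⟩
  have m1 : ∀ u ∈ Icc 0 b, c + u * m ∈ strands b c d := fun u hu => by
    have := mul_nonneg hu.1 hm.le
    have := mul_le_mul_of_nonneg_right hu.2 hm.le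
    exact Or.inr ⟨by linarith, by linarith⟩
  have m2 : ∀ u ∈ Icc c d, (u - c) * n ∈ strands b c d := fun u hu => by
    have := mul_nonneg (sub_nonneg.2 hu.1) hn.le
    have := mul_le_mul_of_nonneg_right (sub_le_sub_right hu.2 c) hn.le
    exact Or.inl ⟨by linarith, by linarith⟩
  have hf : IsStrandFlip γ Ψ b c d (fun u => c + u * m) (fun u => (u - c) * n) m n := by
    refine ⟨fun u => (hasDerivAt_mul_const m).const_add c,
      fun u => by simpa using ((hasDerivAt_id' u).sub_const c).mul_const n,
      mul_pos hm hn, m1, m2, strandMap_strandMap hbc hcd hd hb m1 m2 (fun u hu => ?_)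
      (fun u hu => ?_), ?_, ?_, ?_, ?_⟩
    · have := mul_nonneg hu.1 hm.le
      rw [if_neg (by linarith)]
      linear_combination u * hmn
    · have := mul_le_mul_of_nonneg_right (sub_le_sub_right hu.2 c) hn.le
      rw [if_pos (by linarith)]
      linear_combination (u - c) * hmn
    · simpa using h1
    · rwa [hbm, add_sub_cancel]
    · simpa using h2
    · rwa [hcn]
  refine ⟨_, hf.isGeneric h hγ, hf.range_flipCurve h, hf.defect_flipCurve h hγ ?_⟩
  have k1 : ∀ s, pos s < b → pos (strandMap b c d (fun u => c + u * m) (fun u => (u - c) * n) s)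
      = c + pos s * m := fun s hs => pos_strandMap_left hbc hcd hd hb m1 hs.le
  have k2 : ∀ s, c < pos s → pos s < d → pos (strandMap b c d (fun u => c + u * m)
      (fun u => (u - c) * n) s) = (pos s - c) * n := fun s hs hs' =>
    pos_strandMap_right hbc hcd hd hb m2 hs.le hs'.le
  refine h.interSum_inside_swap hγ ?_ ?_ ?_
  · intro s t s1 s2 t1 t2
    rw [k1 s s2, k2 t t1 t2]
    have := mul_nonneg s1.le hm.le
    have := mul_le_mul_of_nonneg_right (sub_le_sub_right t2.le c) hn.le
    linarith
  · intro s t s1 s2 t1 t2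
    rw [k1 s s2, k1 t t2, add_lt_add_iff_left, mul_lt_mul_iff_left₀ hm]
  · intro s t s1 s2 t1 t2
    rw [k2 s s1 s2, k2 t t1 t2, mul_lt_mul_iff_left₀ hn, sub_lt_sub_iff_right]

/-- The strands are exchanged and reversed. -/
lemma IsNormalTangle.exists_flip_of_swap_reverse (h : IsNormalTangle γ Ψ b c d) (hγ : IsGeneric γ)
    (h1 : reflect Ψ (γ (d : UnitAddCircle)) = γ ((0 : ℝ) : UnitAddCircle))
    (h2 : reflect Ψ (γ ((0 : ℝ) : UnitAddCircle)) = γ (d : UnitAddCircle))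
    (h3 : reflect Ψ (γ (c : UnitAddCircle)) = γ (b : UnitAddCircle))
    (h4 : reflect Ψ (γ (b : UnitAddCircle)) = γ (c : UnitAddCircle)) :
    ∃ γ', IsGeneric γ' ∧ range γ' = flip Ψ (range γ) ∧ defect γ' = defect γ := by
  obtain ⟨hb, hbc, hcd, hd⟩ : 0 < b ∧ b < c ∧ c < d ∧ d < 1 := ⟨h.b_pos, h.b_lt, h.c_lt, h.d_lt⟩
  obtain ⟨m, n, hm, hn, hmn, hbm, hcn⟩ : ∃ m n : ℝ, 0 < m ∧ 0 < n ∧ m * n = 1 ∧ b * m = d - c ∧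
      (d - c) * n = b := by
    have : 0 < d - c := sub_pos.2 hcd
    exact ⟨(d - c) / b, b / (d - c), by positivity, by positivity, by field_simp, by field_simp,
      by field_simp⟩
  have m1 : ∀ u ∈ Icc 0 b, d - u * m ∈ strands b c d := fun u hu => by
    have := mul_nonneg hu.1 hm.le
    have := mul_le_mul_of_nonneg_right hu.2 hm.le
    exact Or.inr ⟨by linarith, by linarith⟩
  have m2 : ∀ u ∈ Icc c d, (d - u) * n ∈ strands b c d := fun u hu => by
    have := mul_nonneg (sub_nonneg.2 hu.2) hn.le
    have := mul_le_mul_of_nonneg_right (sub_le_sub_left hu.1 d) hn.le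
    exact Or.inl ⟨by linarith, by linarith⟩
  have hf : IsStrandFlip γ Ψ b c d (fun u => d - u * m) (fun u => (d - u) * n) (-m) (-n) := by
    refine ⟨fun u => (hasDerivAt_mul_const m).const_sub d,
      fun u => by simpa using ((hasDerivAt_id' u).const_sub d).mul_const n,
      by rw [neg_mul_neg]; exact mul_pos hm hn, m1, m2,
      strandMap_strandMap hbc hcd hd hb m1 m2 (fun u hu => ?_) (fun u hu => ?_), ?_, ?_, ?_, ?_⟩
    · have := mul_le_mul_of_nonneg_right hu.2 hm.le
      rw [if_neg (by linarith)]
      linear_combination u * hmn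
    · have := mul_le_mul_of_nonneg_right (sub_le_sub_left hu.1 d) hn.le
      rw [if_pos (by linarith)]
      linear_combination (u - d) * hmn
    · simpa using h1
    · rwa [hbm, sub_sub_cancel]
    · rwa [hcn]
    · simpa using h2
  refine ⟨_, hf.isGeneric h hγ, hf.range_flipCurve h, hf.defect_flipCurve h hγ ?_⟩
  have k1 : ∀ s, pos s < b → pos (strandMap b c d (fun u => d - u * m) (fun u => (d - u) * n) s)
      = d - pos s * m := fun s hs => pos_strandMap_left hbc hcd hd hb m1 hs.le
  have k2 : ∀ s, c < pos s → pos s < d → pos (strandMap b c d (fun u => d - u * m)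
      (fun u => (d - u) * n) s) = (d - pos s) * n := fun s hs hs' =>
    pos_strandMap_right hbc hcd hd hb m2 hs.le hs'.le
  -- Exchanging and reversing the strands reverses the whole order of the times inside, so no block
  -- exchange is needed.
  rw [← interSum_neg (hγ.isChordDiagram_inside Ψ)]
  refine (interSum_congr (hγ.isChordDiagram_inside Ψ) fun s hs t ht => ?_)
  have x : ∀ s, 0 < pos s → pos s < b → 0 < pos s * m ∧ pos s * m < d - c := fun s s1 s2 =>
    ⟨mul_pos s1 hm, by rw [← hbm]; exact mul_lt_mul_of_pos_right s2 hm⟩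
  have y : ∀ s, c < pos s → pos s < d → 0 < (d - pos s) * n ∧ (d - pos s) * n < b := fun s s1 s2 =>
    ⟨mul_pos (by linarith) hn, by
      rw [← hcn]; exact mul_lt_mul_of_pos_right (by linarith) hn⟩
  rcases (h.inside_iff s).1 (mem_insideEnds.1 hs).2 with ⟨s1, s2⟩ | ⟨s1, s2⟩ <;>
    rcases (h.inside_iff t).1 (mem_insideEnds.1 ht).2 with ⟨t1, t2⟩ | ⟨t1, t2⟩
  · rw [k1 s s2, k1 t t2, neg_lt_neg_iff, sub_lt_sub_iff_left, mul_lt_mul_iff_left₀ hm]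
  · rw [k1 s s2, k2 t t1 t2]
    have := x s s1 s2
    have := y t t1 t2
    constructor <;> intro <;> linarith
  · rw [k2 s s1 s2, k1 t t2]
    have := y s s1 s2
    have := x t t1 t2
    constructor <;> intro <;> linarith
  · rw [k2 s s1 s2, k2 t t1 t2, neg_lt_neg_iff, mul_lt_mul_iff_left₀ hn, sub_lt_sub_iff_left]

/-- Reflecting the inside of a normal tangle gives a generic closed curve of the same defect. -/
theorem IsNormalTangle.exists_flip (h : IsNormalTangle γ Ψ b c d) (hγ : IsGeneric γ)
    (hr : ∀ x ∈ range γ ∩ boundaryCurve Ψ,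
      reflect Ψ x ∈ range γ ∩ boundaryCurve Ψ ∧ reflect Ψ x ≠ x) :
    ∃ γ', IsGeneric γ' ∧ range γ' = flip Ψ (range γ) ∧ defect γ' = defect γ := by
  obtain ⟨hb, hbc, hcd, hd⟩ : 0 < b ∧ b < c ∧ c < d ∧ d < 1 := ⟨h.b_pos, h.b_lt, h.c_lt, h.d_lt⟩
  have key : ∀ u : ℝ, height Ψ (γ (u : UnitAddCircle)) = 0 →
      (reflect Ψ (γ (u : UnitAddCircle)) = γ ((0 : ℝ) : UnitAddCircle) ∨
        reflect Ψ (γ (u : UnitAddCircle)) = γ (b : UnitAddCircle) ∨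
        reflect Ψ (γ (u : UnitAddCircle)) = γ (c : UnitAddCircle) ∨
        reflect Ψ (γ (u : UnitAddCircle)) = γ (d : UnitAddCircle)) ∧
      reflect Ψ (γ (u : UnitAddCircle)) ≠ γ (u : UnitAddCircle) := by
    intro u hu
    obtain ⟨⟨⟨z, hz⟩, h1⟩, h2⟩ := hr (γ (u : UnitAddCircle)) ⟨⟨_, rfl⟩, hu⟩
    refine ⟨?_, h2⟩
    rw [← hz] at h1 ⊢
    rw [← coe_pos z]
    rcases h.pos_mem_of_height_eq_zero h1 with e | e | e | e <;> rw [e] <;> simp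
  have hinv : ∀ {x y : S2}, reflect Ψ x = y → reflect Ψ y = x := fun {x y} e => by
    rw [← e, reflect_reflect]
  have ne : ∀ {u v : ℝ}, height Ψ (γ (u : UnitAddCircle)) = 0 →
      height Ψ (γ (v : UnitAddCircle)) = 0 → u < v → v < u + 1 →
      γ (u : UnitAddCircle) ≠ γ (v : UnitAddCircle) := fun hu hv h1 h2 e =>
    hγ.diskPoint_ne h.off hu hv h1 h2 (congrArg _ e)
  have n1 := ne h.height_zero h.height_b hb (by linarith)
  have n2 := ne h.height_zero h.height_c (by linarith) (by linarith)
  have n3 := ne h.height_zero h.height_d (by linarith) (by linarith)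
  have n4 := ne h.height_b h.height_c hbc (by linarith)
  have n5 := ne h.height_b h.height_d (by linarith) (by linarith)
  have n6 := ne h.height_c h.height_d hcd (by linarith)
  have inj := (reflect_injective Ψ)
  obtain ⟨h0, h0'⟩ := key 0 h.height_zero
  -- The reflection is an involution of four points without fixed points, so the image of the first
  -- point determines the pairing.
  rcases h0 with h0 | h0 | h0 | h0
  · exact absurd h0 h0'
  · have e : reflect Ψ (γ (c : UnitAddCircle)) = γ (d : UnitAddCircle) := by
      obtain ⟨h1 | h1 | h1 | h1, h1'⟩ := key c h.height_c
      · exact absurd (inj (h1.trans (hinv h0).symm)) n4.symm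
      · exact absurd (inj (h1.trans h0.symm)) n2.symm
      · exact absurd h1 h1'
      · exact h1
    exact h.exists_flip_of_reverse hγ (hinv h0) h0 (hinv e) e
  · have e : reflect Ψ (γ (b : UnitAddCircle)) = γ (d : UnitAddCircle) := by
      obtain ⟨h1 | h1 | h1 | h1, h1'⟩ := key b h.height_b
      · exact absurd (inj (h1.trans (hinv h0).symm)) n4
      · exact absurd h1 h1'
      · exact absurd (inj (h1.trans h0.symm)) n1.symm
      · exact h1
    exact h.exists_flip_of_swap hγ (hinv h0) h0 (hinv e) e
  · have e : reflect Ψ (γ (b : UnitAddCircle)) = γ (c : UnitAddCircle) := by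
      obtain ⟨h1 | h1 | h1 | h1, h1'⟩ := key b h.height_b
      · exact absurd (inj (h1.trans (hinv h0).symm)) n5
      · exact absurd h1 h1'
      · exact h1
      · exact absurd (inj (h1.trans h0.symm)) n1.symm
    exact h.exists_flip_of_swap_reverse hγ (hinv h0) h0 (hinv e) e

end

/-! ### Normalization -/

lemma forall_pos_or_forall_neg {H : ℝ → ℝ} (hH : Continuous H) {a b : ℝ}
    (h : ∀ u ∈ Ioo a b, H u ≠ 0) : (∀ u ∈ Ioo a b, 0 < H u) ∨ ∀ u ∈ Ioo a b, H u < 0 := by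
  by_contra hcon
  push Not at hcon
  obtain ⟨⟨u, hu, hu'⟩, v, hv, hv'⟩ := hcon
  obtain ⟨w, hw, hw'⟩ := isPreconnected_Ioo.intermediate_value hu hv hH.continuousOn ⟨hu', hv'⟩
  exact h w hw hw'

section

variable {γ : UnitAddCircle → S2} {Ψ : DiskChart}

/-- The curve changes sides at a crossing with `σ`. -/
lemma CrossesAt.alternate {a b c : ℝ} (h : CrossesAt γ Ψ b) (hab : a < b) (hbc : b < c)
    (hγ : Continuous γ) (hne : ∀ u ∈ Ioo b c, height Ψ (γ (u : UnitAddCircle)) ≠ 0) :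
    ((∀ u ∈ Ioo a b, 0 < height Ψ (γ (u : UnitAddCircle))) →
      ∀ u ∈ Ioo b c, height Ψ (γ (u : UnitAddCircle)) < 0) ∧
    ((∀ u ∈ Ioo a b, height Ψ (γ (u : UnitAddCircle)) < 0) →
      ∀ u ∈ Ioo b c, 0 < height Ψ (γ (u : UnitAddCircle))) := by
  have hH : Continuous fun u : ℝ => height Ψ (γ (u : UnitAddCircle)) :=
    (continuous_height Ψ).comp (hγ.comp (AddCircle.continuous_mk' 1))
  have hl : ∀ {P : ℝ → Prop}, (∀ᶠ u in 𝓝[<] b, P u) → ∃ u ∈ Ioo a b, P u := fun hP => by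
    obtain ⟨u, h1, h2⟩ := (hP.and (Ioo_mem_nhdsLT hab)).exists
    exact ⟨u, h2, h1⟩
  have hr : ∀ {P : ℝ → Prop}, (∀ᶠ u in 𝓝[>] b, P u) → ∃ u ∈ Ioo b c, P u := fun hP => by
    obtain ⟨u, h1, h2⟩ := (hP.and (Ioo_mem_nhdsGT hbc)).exists
    exact ⟨u, h2, h1⟩
  have hs := forall_pos_or_forall_neg hH hne
  rcases h with ⟨h1, h2⟩ | ⟨h1, h2⟩
  · obtain ⟨u, hu, hu'⟩ := hl h1
    obtain ⟨v, hv, hv'⟩ := hr h2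
    refine ⟨fun h3 => absurd (h3 u hu) hu'.le.not_gt, fun _ => ?_⟩
    exact hs.resolve_right fun h4 => (h4 v hv).not_gt hv'
  · obtain ⟨u, hu, hu'⟩ := hl h1
    obtain ⟨v, hv, hv'⟩ := hr h2
    refine ⟨fun _ => ?_, fun h3 => absurd (h3 u hu) hu'.le.not_gt⟩
    exact hs.resolve_left fun h4 => (h4 v hv).not_gt hv'

lemma IsTwoStrandTangle.isNormalTangle_rotate (hΨ : IsTwoStrandTangle γ Ψ) (hγ : IsGeneric γ)
    {a b c d : ℝ} (hab : a < b) (hbc : b < c) (hcd : c < d) (hd : d < a + 1)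
    (ha0 : height Ψ (γ (a : UnitAddCircle)) = 0) (hb0 : height Ψ (γ (b : UnitAddCircle)) = 0)
    (hc0 : height Ψ (γ (c : UnitAddCircle)) = 0) (hd0 : height Ψ (γ (d : UnitAddCircle)) = 0)
    (h1 : ∀ u ∈ Ioo a b, 0 < height Ψ (γ (u : UnitAddCircle)))
    (h2 : ∀ u ∈ Ioo b c, height Ψ (γ (u : UnitAddCircle)) < 0)
    (h3 : ∀ u ∈ Ioo c d, 0 < height Ψ (γ (u : UnitAddCircle)))
    (h4 : ∀ u ∈ Ioo d (a + 1), height Ψ (γ (u : UnitAddCircle)) < 0) :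
    IsNormalTangle (rotate a γ) Ψ (b - a) (c - a) (d - a) := by
  have e : ∀ u : ℝ, rotate a γ (u : UnitAddCircle) = γ ((u + a : ℝ) : UnitAddCircle) := fun u => by
    rw [rotate, AddCircle.coe_add]
  refine ⟨by linarith, by linarith, by linarith, by linarith, ?_, ?_, ?_, ?_, fun u hu => ?_,
    fun u hu => ?_, fun u hu => ?_, fun u hu => ?_, fun s hs hs0 => ?_⟩
  · rwa [e, zero_add]
  · rwa [e, sub_add_cancel]
  · rwa [e, sub_add_cancel]
  · rwa [e, sub_add_cancel]
  · rw [e]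
    exact h1 _ ⟨by linarith [hu.1], by linarith [hu.2]⟩
  · rw [e]
    exact h2 _ ⟨by linarith [hu.1], by linarith [hu.2]⟩
  · rw [e]
    exact h3 _ ⟨by linarith [hu.1], by linarith [hu.2]⟩
  · rw [e]
    exact h4 _ ⟨by linarith [hu.1], by linarith [hu.2]⟩
  · obtain ⟨t, ht, hts⟩ := hγ.mem_ends.1 (hγ.mem_ends_rotate.1 hs)
    exact disjoint_left.1 hΨ.avoids_vertices ⟨t, s + a, ht, hts, rfl⟩ hs0

/-- A tangle with two strands is normal, after a change of the basepoint. -/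
theorem IsTwoStrandTangle.exists_isNormalTangle (hΨ : IsTwoStrandTangle γ Ψ) (hγ : IsGeneric γ) :
    ∃ (t : UnitAddCircle) (b c d : ℝ), IsNormalTangle (rotate t γ) Ψ b c d := by
  let Z : Set ℝ := pos '' (γ ⁻¹' boundaryCurve Ψ)
  have hinj : InjOn γ (γ ⁻¹' boundaryCurve Ψ) := fun s hs t _ hst => by
    by_contra hne
    exact disjoint_left.1 hΨ.avoids_vertices ⟨s, t, hne, rfl, hst.symm⟩ hs
  have hcard : Z.ncard = 4 := by
    rw [ncard_image_of_injective _ pos_injective, ← hinj.ncard_image,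
      image_preimage_eq_inter_range, inter_comm]
    exact hΨ.four_points
  have hfin : Z.Finite := finite_of_ncard_ne_zero (by rw [hcard]; norm_num)
  have hcard' : hfin.toFinset.card = 4 := by rw [← ncard_eq_toFinset_card Z hfin, hcard]
  let e := hfin.toFinset.orderEmbOfFin hcard'
  have he : ∀ i, e i ∈ Z := fun i =>
    hfin.mem_toFinset.1 (Finset.orderEmbOfFin_mem hfin.toFinset hcard' i)
  have he' : ∀ u ∈ Z, ∃ i, e i = u := fun u hu => by
    have : u ∈ range e := by
      rw [Finset.range_orderEmbOfFin]
      exact hfin.mem_toFinset.2 hu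
    exact this
  have h01 : e 0 < e 1 := e.strictMono (by decide)
  have h12 : e 1 < e 2 := e.strictMono (by decide)
  have h23 : e 2 < e 3 := e.strictMono (by decide)
  have hZ : ∀ u ∈ Z, 0 ≤ u ∧ u < 1 ∧ height Ψ (γ (u : UnitAddCircle)) = 0 := by
    rintro _ ⟨z, hz, rfl⟩
    refine ⟨pos_nonneg z, pos_lt_one z, ?_⟩
    rw [coe_pos]
    exact hz
  have hZ' : ∀ u : ℝ, 0 ≤ u → u < 1 → height Ψ (γ (u : UnitAddCircle)) = 0 →
      u = e 0 ∨ u = e 1 ∨ u = e 2 ∨ u = e 3 := by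
    intro u h0 h1 h2
    obtain ⟨i, rfl⟩ := he' u ⟨(u : UnitAddCircle), h2, pos_coe h0 h1⟩
    fin_cases i <;> simp
  have hcr : ∀ i, CrossesAt γ Ψ (e i) := fun i => hΨ.crosses _ (hZ _ (he i)).2.2
  have p0 := hZ _ (he 0)
  have p1 := hZ _ (he 1)
  have p2 := hZ _ (he 2)
  have p3 := hZ _ (he 3)
  have hper : ∀ u : ℝ, γ ((u + 1 : ℝ) : UnitAddCircle) = γ (u : UnitAddCircle) := fun u => by
    rw [AddCircle.coe_add_period]
  have n1 : ∀ u ∈ Ioo (e 0) (e 1), height Ψ (γ (u : UnitAddCircle)) ≠ 0 := fun u hu h => by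
    have := hZ' u (by linarith [hu.1]) (by linarith [hu.2]) h
    grind
  have n2 : ∀ u ∈ Ioo (e 1) (e 2), height Ψ (γ (u : UnitAddCircle)) ≠ 0 := fun u hu h => by
    have := hZ' u (by linarith [hu.1]) (by linarith [hu.2]) h
    grind
  have n3 : ∀ u ∈ Ioo (e 2) (e 3), height Ψ (γ (u : UnitAddCircle)) ≠ 0 := fun u hu h => by
    have := hZ' u (by linarith [hu.1]) (by linarith [hu.2]) h
    grind
  have n4 : ∀ u ∈ Ioo (e 3) (e 0 + 1), height Ψ (γ (u : UnitAddCircle)) ≠ 0 := fun u hu h => by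
    rcases lt_or_ge u 1 with h1 | h1
    · have := hZ' u (by linarith [hu.1]) h1 h
      grind
    -- The last interval runs past the basepoint; its later times are moved back by a period.
    · have e1 := hper (u - 1)
      rw [sub_add_cancel] at e1
      rw [e1] at h
      have := hZ' (u - 1) (by linarith) (by linarith [hu.2]) h
      grind
  have a1 := (hcr 1).alternate h01 h12 hγ.continuous n2
  have a2 := (hcr 2).alternate h12 h23 hγ.continuous n3
  have a3 := (hcr 3).alternate h23 (by linarith) hγ.continuous n4
  have hH : Continuous fun u : ℝ => height Ψ (γ (u : UnitAddCircle)) :=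
    (continuous_height Ψ).comp (hγ.continuous.comp (AddCircle.continuous_mk' 1))
  rcases forall_pos_or_forall_neg hH n1 with h1 | h1
  · have h2 := a1.1 h1
    have h3 := a2.2 h2
    exact ⟨_, _, _, _, hΨ.isNormalTangle_rotate hγ h01 h12 h23 (by linarith) p0.2.2 p1.2.2 p2.2.2
      p3.2.2 h1 h2 h3 (a3.1 h3)⟩
  · have h2 := a1.2 h1
    have h3 := a2.1 h2
    -- The first interval is outside, so the basepoint goes to the second crossing, and the first
    -- crossing returns as the last, one period later.
    refine ⟨_, _, _, _, hΨ.isNormalTangle_rotate hγ h12 h23 (d := e 0 + 1) (by linarith)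
      (by linarith) p1.2.2 p2.2.2 p3.2.2 (by rw [hper]; exact p0.2.2) h2 h3 (a3.2 h3)
      fun u hu => ?_⟩
    have := h1 (u - 1) ⟨by linarith [hu.1], by linarith [hu.2]⟩
    rwa [← hper, sub_add_cancel] at this

end

end TangleFlip

end

/-- One curve with the flipped image and the same defect is constructed; since the defect depends
only on the image, every other such curve has this defect as well. -/
theorem mainTheorem7 (γ : UnitAddCircle → TangleFlip.S2) (hγ : TangleFlip.IsGeneric γ)
    (Ψ : TangleFlip.DiskChart) (hΨ : TangleFlip.IsTwoStrandTangle γ Ψ) :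
    (∃ γ' : UnitAddCircle → TangleFlip.S2, TangleFlip.IsGeneric γ' ∧
      Set.range γ' = TangleFlip.flip Ψ (Set.range γ)) ∧
    ∀ γ' : UnitAddCircle → TangleFlip.S2, TangleFlip.IsGeneric γ' →
      Set.range γ' = TangleFlip.flip Ψ (Set.range γ) →
      TangleFlip.defect γ' = TangleFlip.defect γ := by
  obtain ⟨t, b, c, d, h⟩ := hΨ.exists_isNormalTangle hγ
  obtain ⟨δ, hδ, hr, hd⟩ := h.exists_flip (hγ.rotate t) (by
    rw [TangleFlip.range_rotate]
    exact hΨ.reflect_endpoint)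
  rw [TangleFlip.range_rotate] at hr
  rw [hγ.defect_rotate] at hd
  exact ⟨⟨δ, hδ, hr⟩, fun γ' hγ' hr' =>
    (hγ'.defect_eq_of_range_eq hδ (hr'.trans hr.symm)).trans hd⟩
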